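/- Let $\Omega=(l_1,l_2)\times(l_3,l_4)$ be an open rectangle, let $\psi$ be a smooth function on $\mathbb R^2$, $\Gamma=\{q\in\Omega:\psi(q)=0\}$, and let $a>0$ and $f$ be smooth in $\Omega\setminus\Gamma$. For a centre $p=(x,y)$ and a mesh size $h>0$ the nine stencil points are $(x+kh,y+\ell h)$, $k,\ell\in\{-1,0,1\}$; $p$ is called regular (for $h$) if $\psi\ge 0$ at all nine stencil points or $\psi<0$ at all nine stencil points. For $p\in\Omega\setminus\Gamma$ write $a_{mn}=a^{(m,n)}=\partial_x^m\partial_y^n a(p)$, and $f^{(m,n)}=\partial_x^m\partial_y^n f(p)$, $u^{(m,n)}=\partial_x^m\partial_y^n u(p)$. Put $$C_{-1,-1}(h)=(((2a_{12}+a_{21}+a_{03}+2a_{30})a_{10}-a_{01}(a_{21}+a_{03}))a_{00}^{2}+((-2a_{02}-8a_{20}-3a_{11})a_{10}^{2}-(2(a_{02}+\tfrac{3}{2}a_{20}+\tfrac{3}{2}a_{11}))a_{01}a_{10}+2a_{01}^{2}(a_{02}+\tfrac{3}{2}a_{20}))a_{00}-a_{01}^{4}-2a_{01}^{2}a_{10}^{2}+4a_{01}a_{10}^{3}+7a_{10}^{4})h^4-a_{00}((a_{12}-a_{21}-a_{03}+a_{30})a_{00}^{2}+((a_{02}-6a_{20}+3a_{11})a_{10}+(5(a_{20}-\tfrac{3}{5}a_{11}))a_{01})a_{00}+(-a_{10}+a_{01})(a_{01}^{2}+3a_{01}a_{10}-6a_{10}^{2}))h^3+(-2a_{01}^{2}+2a_{10}^{2})a_{00}^{2}h^2-4a_{10}ha_{00}^{3}+4a_{00}^{4},$$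 $$C_{-1,0}(h)=(((-a_{12}+a_{21}+a_{03}-a_{30})a_{01}-a_{10}(a_{21}+a_{03}))a_{00}^{2}+((-2a_{02}-3a_{20}+a_{11})a_{01}^{2}+3a_{10}(a_{02}+\tfrac{7}{3}a_{20}+\tfrac{1}{3}a_{11})a_{01}+a_{10}^{2}a_{11})a_{00}+a_{01}(a_{01}^{3}-a_{01}^{2}a_{10}+3a_{01}a_{10}^{2}-7a_{10}^{3}))h^4-2a_{00}((a_{21}+a_{03})a_{00}^{2}+(-5a_{01}a_{20}-2a_{10}(a_{02}-a_{20}+\tfrac{3}{2}a_{11}))a_{00}-a_{01}^{3}-a_{01}^{2}a_{10}+7a_{01}a_{10}^{2}-a_{10}^{3})h^3-8a_{10}(-a_{10}+a_{01})h^2a_{00}^{2}+(8(a_{01}-2a_{10}))ha_{00}^{3}+16a_{00}^{4},$$ $$C_{-1,1}(h)=-a_{00}(((a_{12}-a_{21}-a_{03}+a_{30})a_{00}^{2}+((a_{02}-6a_{20}-a_{11})a_{10}+5a_{01}(a_{20}+\tfrac{1}{5}a_{11}))a_{00}+a_{01}^{3}-7a_{01}a_{10}^{2}+6a_{10}^{3})h^3+(4a_{00}^{2}a_{11}-2a_{00}a_{10}^{2})h^2-(4(-a_{10}+a_{01}))ha_{00}^{2}-4a_{00}^{3}),$$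 $$C_{0,-1}(h)=((a_{01}-2a_{10})(a_{12}+a_{30})a_{00}^{2}+((2a_{02}+8a_{20}+2a_{11})a_{10}^{2}-a_{01}(a_{02}+4a_{20}-2a_{11})a_{10}-a_{01}^{2}a_{11})a_{00}+a_{10}(a_{01}^{3}-a_{01}^{2}a_{10}+3a_{01}a_{10}^{2}-7a_{10}^{3}))h^4-2a_{00}((a_{21}+a_{03})a_{00}^{2}+(-3a_{10}a_{11}-2a_{01}(a_{02}+\tfrac{3}{2}a_{20}))a_{00}-2a_{01}a_{10}(a_{01}-3a_{10}))h^3+4a_{00}^{2}((a_{02}-a_{20})a_{00}-\tfrac{3}{2}a_{01}^{2}+\tfrac{3}{2}a_{10}^{2})h^2-8a_{10}ha_{00}^{3}+16a_{00}^{4},$$ $$C_{0,0}(h)=2a_{00}(((a_{12}+a_{21}+a_{03}+a_{30})a_{00}^{2}+((-a_{02}-4a_{20}-5a_{11})a_{10}-2a_{01}(a_{02}+\tfrac{3}{2}a_{20}+\tfrac{1}{2}a_{11}))a_{00}-2a_{01}^{2}a_{10}+5a_{01}a_{10}^{2}+5a_{10}^{3})h^3-4a_{00}((a_{02}-a_{20}-a_{11})a_{00}-a_{01}^{2}-\tfrac{3}{2}a_{01}a_{10}+3a_{10}^{2})h^2-(20(-a_{10}+a_{01}))ha_{00}^{2}-40a_{00}^{3}),$$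 $$C_{0,1}(h)=(4(((a_{02}-a_{20})a_{00}+(\tfrac{1}{2}(-a_{10}+a_{01}))(a_{01}-3a_{10}))h^2+(4(a_{01}-\tfrac{1}{2}a_{10}))a_{00}h+4a_{00}^{2}))a_{00}^{2},$$ $$C_{1,-1}(h)=-4a_{00}^{2}(-a_{00}^{2}+h^2a_{00}a_{11}+\tfrac{1}{2}h^2a_{01}(a_{01}-2a_{10})),$$ $$C_{1,0}(h)=8a_{00}^{3}(ha_{01}+2a_{00}),$$ $$C_{1,1}(h)=4a_{00}^{3}(ha_{01}+a_{00}).$$ For $m+n\le 3$ define polynomials $H_{m,n}(X,Y)$ as follows. If $-\nabla\cdot(a\nabla u)=f$, then differentiating the equation expresses recursively every $u^{(m',n')}$ with $m'\ge 2$ as a linear combination of the $u^{(0,j)}$, $u^{(1,j)}$ and $f^{(i,j)}$, with coefficients polynomial in the $a_{ij}$ and $1/a_{00}$ (starting with $u^{(2,0)}=-u^{(0,2)}-(a_{10}u^{(1,0)}+a_{01}u^{(0,1)}+f^{(0,0)})/a_{00}$). Insert these expressions into the Taylor polynomial $\sum_{m'+n'\le 5}\frac{u^{(m',n')}}{m'!\,n'!}X^{m'}Y^{n'}$;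 $H_{m,n}(X,Y)$ is the resulting coefficient of $f^{(m,n)}$. Put $$C_{f,m,n}(h)=\sum_{k=-1}^{1}\sum_{\ell=-1}^{1}C_{k,\ell}(h)\,H_{m,n}(kh,\ell h),\qquad m+n\le 3 .$$ (1) (Fourth-order consistency.) The scheme $\sum_{k,\ell}C_{k,\ell}(h)(u_h)_{i+k,j+\ell}=\sum_{m+n\le 3}f^{(m,n)}C_{f,m,n}(h)$ has fourth-order consistency error at regular points: let $u\in C^5(\Omega\setminus\Gamma)$ satisfy $-\nabla\cdot(a\nabla u)=f$ in $\Omega\setminus\Gamma$. For every compact $K\subset\Omega\setminus\Gamma$ there are constants $B,h_0>0$ such that, for all $0<h\le h_0$ and all $p=(x,y)\in K$ that are regular for $h$, the residual $$R=\sum_{k=-1}^{1}\sum_{\ell=-1}^{1}C_{k,\ell}(h)\,u(x+kh,y+\ell h)-\sum_{m+n\le 3}f^{(m,n)}C_{f,m,n}(h)$$ satisfies $|R|\le B h^6$, and $C_{f,0,0}(h)\ne 0$ and $|R/C_{f,0,0}(h)|\le B h^4$; that is, the equation at $p$, normalized so that $f(p)$ has coefficient $1$, holds up to $O(h^4)$.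 (2) (Maximal order.) For every $p=(x,y)\in\Omega\setminus\Gamma$, $M=6$ is the largest integer $M\ge 0$ for which there is a nine-point compact scheme of accuracy order $M$ at $p$, i.e. for which there are real polynomials $C_{k,\ell}$ ($k,\ell\in\{-1,0,1\}$) and $C_{f,m,n}$ ($m,n\ge 0$, $m+n\le M-1$) in $h$ of degree at most $M+1$ (depending on $a$ and $p$, but not on the function $u$ below), with $C_{k,\ell}(0)\neq 0$ for at least one $(k,\ell)$, such that for every $u$ smooth near $p$, with $f:=-\nabla\cdot(a\nabla u)$ and $f^{(m,n)}=\partial_x^m\partial_y^n f(p)$, $$\sum_{k=-1}^{1}\sum_{\ell=-1}^{1}C_{k,\ell}(h)\,u(x+kh,y+\ell h)=\sum_{m+n\le M-1}f^{(m,n)}C_{f,m,n}(h)+O(h^{M+2}),\qquad h\to 0^+ .$$ -/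

import Mathlib

open Set Filter Topology Polynomial
open scoped ContDiff

noncomputable section

/-- The partial derivative `∂g/∂x`. -/
def partialX (g : ℝ × ℝ → ℝ) (p : ℝ × ℝ) : ℝ := lineDeriv ℝ g p (1, 0)

/-- The partial derivative `∂g/∂y`. -/
def partialY (g : ℝ × ℝ → ℝ) (p : ℝ × ℝ) : ℝ := lineDeriv ℝ g p (0, 1)

/-- `g^{(m,n)}(p)`, the partial derivative of order `m` in `x` and `n` in `y`. -/
def mixedPartial (g : ℝ × ℝ → ℝ) (p : ℝ × ℝ) (m n : ℕ) : ℝ :=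
  (partialX^[m] (partialY^[n] g)) p

/-- `-∇ · (a ∇u)`. -/
def ellipticOp (a u : ℝ × ℝ → ℝ) (p : ℝ × ℝ) : ℝ :=
  -(partialX (fun q => a q * partialX u q) p + partialY (fun q => a q * partialY u q) p)

/-- The open rectangle `Ω = (l₁, l₂) × (l₃, l₄)`. -/
def rect (l₁ l₂ l₃ l₄ : ℝ) : Set (ℝ × ℝ) := Ioo l₁ l₂ ×ˢ Ioo l₃ l₄

/-- The interface `Γ = {q ∈ Ω : ψ q = 0}`. -/
def interface (Ω : Set (ℝ × ℝ)) (ψ : ℝ × ℝ → ℝ) : Set (ℝ × ℝ) := {q ∈ Ω | ψ q = 0}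

/-- The index range `{-1, 0, 1}` of the nine-point stencil in each direction. -/
def offsets : Finset ℤ := {-1, 0, 1}

/-- The stencil point `(x + k h, y + ℓ h)` of the centre `p = (x, y)`. -/
def stencilPoint (p : ℝ × ℝ) (h : ℝ) (k l : ℤ) : ℝ × ℝ := (p.1 + k * h, p.2 + l * h)

/-- `d⁺`: the indices of the stencil points with `ψ ≥ 0`. -/
def dPlus (ψ : ℝ × ℝ → ℝ) (p : ℝ × ℝ) (h : ℝ) : Set (ℤ × ℤ) :=
  {q | q.1 ∈ offsets ∧ q.2 ∈ offsets ∧ 0 ≤ ψ (stencilPoint p h q.1 q.2)}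

/-- `d⁻`: the indices of the stencil points with `ψ < 0`. -/
def dMinus (ψ : ℝ × ℝ → ℝ) (p : ℝ × ℝ) (h : ℝ) : Set (ℤ × ℤ) :=
  {q | q.1 ∈ offsets ∧ q.2 ∈ offsets ∧ ψ (stencilPoint p h q.1 q.2) < 0}

/-- The centre `p` is a regular point for the mesh size `h`. -/
def IsRegularPoint (ψ : ℝ × ℝ → ℝ) (p : ℝ × ℝ) (h : ℝ) : Prop :=
  dPlus ψ p h = ∅ ∨ dMinus ψ p h = ∅

/-- The pairs `(m, n)` with `m + n < K`. -/
def indicesBelow (K : ℕ) : Finset (ℕ × ℕ) :=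
  (Finset.range K ×ˢ Finset.range K).filter fun q => q.1 + q.2 < K

/-- The partial derivatives `u^{(m,n)}` at a point of the solution of `-∇ · (a ∇u) = f` for which
`a^{(m,n)} = A m n`, `f^{(m,n)} = F m n`, `u^{(0,n)} = w₀ n`, `u^{(1,n)} = w₁ n` there. The
recursion is the `(m, n)`-th derivative of `a u_xx + a u_yy + a_x u_x + a_y u_y = -f`, expanded by
the Leibniz rule and solved for `u^{(m+2,n)}`. -/
def solutionJet (A F : ℕ → ℕ → ℝ) (w₀ w₁ : ℕ → ℝ) : ℕ → ℕ → ℝ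
  | 0, n => w₀ n
  | 1, n => w₁ n
  | m + 2, n =>
    -(F m n + ∑ i : Fin (m + 1), ∑ j : Fin (n + 1), (m.choose i : ℝ) * (n.choose j : ℝ) *
        (A i j * ((if _h : 0 < (i : ℕ) + j
                    then solutionJet A F w₀ w₁ (m - i + 2) (n - j) else 0)
                  + solutionJet A F w₀ w₁ (m - i) (n - j + 2))
          + A (i + 1) j * solutionJet A F w₀ w₁ (m - i + 1) (n - j)
          + A i (j + 1) * solutionJet A F w₀ w₁ (m - i) (n - j + 1))) / A 0 0
termination_by m n => (m, n)
decreasing_by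
  all_goals simp_wf
  all_goals simp only [Prod.lex_def]
  all_goals omega

/-- The polynomial `H_{m,n}(x, y)`, the coefficient of `f^{(m,n)}` in the Taylor polynomial of
degree `K` of `u` at the base point once every `u^{(m',n')}` with `m' ≥ 2` has been eliminated by
the differential equation in favour of the `u^{(0,j)}`, `u^{(1,j)}` and the `f^{(i,j)}`. -/
def sourcePoly (A : ℕ → ℕ → ℝ) (K m n : ℕ) (x y : ℝ) : ℝ :=
  ∑ q ∈ indicesBelow (K + 1),
    solutionJet A (fun i j => if i = m ∧ j = n then 1 else 0) 0 0 q.1 q.2 *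
      x ^ q.1 * y ^ q.2 / ((q.1.factorial : ℝ) * (q.2.factorial : ℝ))

/-- The stencil coefficients `C_{k,ℓ}(h)` of the fourth order scheme, with `A m n` standing for
`a^{(m,n)}`. -/
def stencilCoeff (A : ℕ → ℕ → ℝ) (h : ℝ) : ℤ → ℤ → ℝ
  | -1, -1 =>
      (((2 * A 1 2 + A 2 1 + A 0 3 + 2 * A 3 0) * A 1 0 - A 0 1 * (A 2 1 + A 0 3)) * A 0 0 ^ 2 +
      ((-2 * A 0 2 - 8 * A 2 0 - 3 * A 1 1) * A 1 0 ^ 2 - (2 * (A 0 2 + (3 / 2) * A 2 0 +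
      (3 / 2) * A 1 1)) * A 0 1 * A 1 0 + 2 * A 0 1 ^ 2 * (A 0 2 + (3 / 2) * A 2 0)) * A 0 0 -
      A 0 1 ^ 4 - 2 * A 0 1 ^ 2 * A 1 0 ^ 2 + 4 * A 0 1 * A 1 0 ^ 3 + 7 * A 1 0 ^ 4) * h ^ 4 -
      A 0 0 * ((A 1 2 - A 2 1 - A 0 3 + A 3 0) * A 0 0 ^ 2 + ((A 0 2 - 6 * A 2 0 + 3 * A 1 1) *
      A 1 0 + (5 * (A 2 0 - (3 / 5) * A 1 1)) * A 0 1) * A 0 0 + (-A 1 0 + A 0 1) * (A 0 1 ^ 2 +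
      3 * A 0 1 * A 1 0 - 6 * A 1 0 ^ 2)) * h ^ 3 + (-2 * A 0 1 ^ 2 + 2 * A 1 0 ^ 2) *
      A 0 0 ^ 2 * h ^ 2 - 4 * A 1 0 * h * A 0 0 ^ 3 + 4 * A 0 0 ^ 4
  | -1, 0 =>
      (((-A 1 2 + A 2 1 + A 0 3 - A 3 0) * A 0 1 - A 1 0 * (A 2 1 + A 0 3)) * A 0 0 ^ 2 + ((-2 *
      A 0 2 - 3 * A 2 0 + A 1 1) * A 0 1 ^ 2 + 3 * A 1 0 * (A 0 2 + (7 / 3) * A 2 0 + (1 / 3) *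
      A 1 1) * A 0 1 + A 1 0 ^ 2 * A 1 1) * A 0 0 + A 0 1 * (A 0 1 ^ 3 - A 0 1 ^ 2 * A 1 0 + 3 *
      A 0 1 * A 1 0 ^ 2 - 7 * A 1 0 ^ 3)) * h ^ 4 - 2 * A 0 0 * ((A 2 1 + A 0 3) * A 0 0 ^ 2 +
      (-5 * A 0 1 * A 2 0 - 2 * A 1 0 * (A 0 2 - A 2 0 + (3 / 2) * A 1 1)) * A 0 0 - A 0 1 ^ 3 -
      A 0 1 ^ 2 * A 1 0 + 7 * A 0 1 * A 1 0 ^ 2 - A 1 0 ^ 3) * h ^ 3 - 8 * A 1 0 * (-A 1 0 +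
      A 0 1) * h ^ 2 * A 0 0 ^ 2 + (8 * (A 0 1 - 2 * A 1 0)) * h * A 0 0 ^ 3 + 16 * A 0 0 ^ 4
  | -1, 1 =>
      -A 0 0 * (((A 1 2 - A 2 1 - A 0 3 + A 3 0) * A 0 0 ^ 2 + ((A 0 2 - 6 * A 2 0 - A 1 1) *
      A 1 0 + 5 * A 0 1 * (A 2 0 + (1 / 5) * A 1 1)) * A 0 0 + A 0 1 ^ 3 - 7 * A 0 1 *
      A 1 0 ^ 2 + 6 * A 1 0 ^ 3) * h ^ 3 + (4 * A 0 0 ^ 2 * A 1 1 - 2 * A 0 0 * A 1 0 ^ 2) *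
      h ^ 2 - (4 * (-A 1 0 + A 0 1)) * h * A 0 0 ^ 2 - 4 * A 0 0 ^ 3)
  | 0, -1 =>
      ((A 0 1 - 2 * A 1 0) * (A 1 2 + A 3 0) * A 0 0 ^ 2 + ((2 * A 0 2 + 8 * A 2 0 + 2 * A 1 1) *
      A 1 0 ^ 2 - A 0 1 * (A 0 2 + 4 * A 2 0 - 2 * A 1 1) * A 1 0 - A 0 1 ^ 2 * A 1 1) * A 0 0 +
      A 1 0 * (A 0 1 ^ 3 - A 0 1 ^ 2 * A 1 0 + 3 * A 0 1 * A 1 0 ^ 2 - 7 * A 1 0 ^ 3)) * h ^ 4 -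
      2 * A 0 0 * ((A 2 1 + A 0 3) * A 0 0 ^ 2 + (-3 * A 1 0 * A 1 1 - 2 * A 0 1 * (A 0 2 +
      (3 / 2) * A 2 0)) * A 0 0 - 2 * A 0 1 * A 1 0 * (A 0 1 - 3 * A 1 0)) * h ^ 3 + 4 *
      A 0 0 ^ 2 * ((A 0 2 - A 2 0) * A 0 0 - (3 / 2) * A 0 1 ^ 2 + (3 / 2) * A 1 0 ^ 2) * h ^ 2 -
      8 * A 1 0 * h * A 0 0 ^ 3 + 16 * A 0 0 ^ 4
  | 0, 0 =>
      2 * A 0 0 * (((A 1 2 + A 2 1 + A 0 3 + A 3 0) * A 0 0 ^ 2 + ((-A 0 2 - 4 * A 2 0 - 5 *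
      A 1 1) * A 1 0 - 2 * A 0 1 * (A 0 2 + (3 / 2) * A 2 0 + (1 / 2) * A 1 1)) * A 0 0 - 2 *
      A 0 1 ^ 2 * A 1 0 + 5 * A 0 1 * A 1 0 ^ 2 + 5 * A 1 0 ^ 3) * h ^ 3 - 4 * A 0 0 * ((A 0 2 -
      A 2 0 - A 1 1) * A 0 0 - A 0 1 ^ 2 - (3 / 2) * A 0 1 * A 1 0 + 3 * A 1 0 ^ 2) * h ^ 2 -
      (20 * (-A 1 0 + A 0 1)) * h * A 0 0 ^ 2 - 40 * A 0 0 ^ 3)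
  | 0, 1 =>
      (4 * (((A 0 2 - A 2 0) * A 0 0 + (1 / 2 * (-A 1 0 + A 0 1)) * (A 0 1 - 3 * A 1 0)) *
      h ^ 2 + (4 * (A 0 1 - (1 / 2) * A 1 0)) * A 0 0 * h + 4 * A 0 0 ^ 2)) * A 0 0 ^ 2
  | 1, -1 =>
      -4 * A 0 0 ^ 2 * (-A 0 0 ^ 2 + h ^ 2 * A 0 0 * A 1 1 + (1 / 2) * h ^ 2 * A 0 1 * (A 0 1 -
      2 * A 1 0))
  | 1, 0 =>
      8 * A 0 0 ^ 3 * (h * A 0 1 + 2 * A 0 0)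
  | 1, 1 =>
      4 * A 0 0 ^ 3 * (h * A 0 1 + A 0 0)
  | _, _ => 0

/-- `C_{f,m,n}(h) = ∑_{k,ℓ} C_{k,ℓ}(h) H_{m,n}(k h, ℓ h)`, where the `H_{m,n}` are those of the
Taylor polynomial of degree five. -/
def sourceCoeff (A : ℕ → ℕ → ℝ) (h : ℝ) (m n : ℕ) : ℝ :=
  ∑ k ∈ offsets, ∑ l ∈ offsets, stencilCoeff A h k l * sourcePoly A 5 m n (k * h) (l * h)

/-- The consistency residual at `p` of the explicit scheme
`∑ C_{k,ℓ}(h) u_{i+k,j+ℓ} = ∑_{m+n≤3} f^{(m,n)} C_{f,m,n}(h)` at the function `u`. -/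
def schemeResidual (a f u : ℝ × ℝ → ℝ) (p : ℝ × ℝ) (h : ℝ) : ℝ :=
  (∑ k ∈ offsets, ∑ l ∈ offsets,
      stencilCoeff (mixedPartial a p) h k l * u (stencilPoint p h k l))
    - ∑ q ∈ indicesBelow 4, mixedPartial f p q.1 q.2 * sourceCoeff (mixedPartial a p) h q.1 q.2

/-- There is a nine-point compact scheme at `p` for `-∇ · (a ∇u) = f` of accuracy order `M`: there
are polynomials `C_{k,ℓ}`, `C_{f,m,n}` of degree at most `M + 1`, not all `C_{k,ℓ}(0)` being zero,
such that every smooth `u` satisfies, with `f = -∇ · (a ∇u)`,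
`∑ C_{k,ℓ}(h) u(x + k h, y + ℓ h) = ∑_{m+n≤M-1} f^{(m,n)} C_{f,m,n}(h) + O(h^{M+2})`, `h → 0⁺`. -/
def HasCompactScheme (a : ℝ × ℝ → ℝ) (p : ℝ × ℝ) (M : ℕ) : Prop :=
  ∃ (C : ℤ → ℤ → ℝ[X]) (Cf : ℕ → ℕ → ℝ[X]),
    (∀ k ∈ offsets, ∀ l ∈ offsets, (C k l).natDegree ≤ M + 1) ∧
    (∀ q ∈ indicesBelow M, (Cf q.1 q.2).natDegree ≤ M + 1) ∧
    (∃ k ∈ offsets, ∃ l ∈ offsets, (C k l).eval 0 ≠ 0) ∧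
    ∀ u : ℝ × ℝ → ℝ, ContDiffAt ℝ ∞ u p →
      (fun h : ℝ =>
        (∑ k ∈ offsets, ∑ l ∈ offsets, (C k l).eval h * u (stencilPoint p h k l))
          - ∑ q ∈ indicesBelow M, mixedPartial (ellipticOp a u) p q.1 q.2 * (Cf q.1 q.2).eval h)
        =O[𝓝[>] 0] fun h : ℝ => h ^ (M + 2)

end

/-! Everything is done on jets. Near a point the equation and its derivatives form a linear
recursion: the values u^(0,j), u^(1,j) and the source derivatives determine all other derivatives
(`eq_solutionJet`), and by linearity the jet is the sum of a source-free jet and the responses to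
the f^(m,n) (`solutionJet_decomp`). A stencil applied to a jet expands in powers of h with
coefficients `stencilMoment`, so consistency becomes the vanishing of finitely many moments on
source-free jets.

Fourth-order consistency. By construction the C_{f,m,n} cancel the source responses, so the residual
is a Taylor remainder plus the stencil applied to a source-free jet (`schemeResidual_eq`). The
moments of order below 6 vanish because each is an explicit combination of derivatives of the
equation (`stencilMoment_stencilTerm_eq_zero`). The remainder is O(h^6) only if u has six
derivatives, while five are given. Interior elliptic regularity (`contDiffOn_of_ellipticOp`) makes u
smooth: Fourier decay of cutoffs of u is bootstrapped one power at a time. Compactness gives uniform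
constants, and C_{f,0,0} has leading term -24 a^3 h^2, which yields the normalized estimate.

Upper bound on the order. The lowest-degree part of a source-free jet is an arbitrary harmonic
polynomial, so the values C_{k,l}(0) of a scheme of order M annihilate harmonic polynomials of every
degree below M + 2. For M at least 7 this includes degree 8. Harmonic polynomials of degrees 0 to 4
and 8 separate the nine stencil points, forcing all C_{k,l}(0) = 0 (`eq_zero_of_harmonic_moments`,
`not_hasCompactScheme`).

Order 6 is attained. With s = √a and v = s u the homogeneous equation becomes Δv = q v, q = Δs / s
(`liouville_transform`). For this equation there is an explicit nine-point scheme whose moments of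
order below 8 vanish (`stencilMoment_schrodingerTerm_eq_zero`). Multiplying its weights by the
Taylor polynomials of s at the stencil points and truncating gives a scheme for u when the source
vanishes to high order; `hasCompactScheme_of_vanishing_source` then supplies the coefficients of the
f^(m,n). -/

noncomputable section

/-! ### Iterated directional derivatives -/

section DirDeriv

variable {E : Type*} [NormedAddCommGroup E] [NormedSpace ℝ E]

/-- The directional derivative of `g` along `v`, as an operator on functions. -/
def dirDeriv (v : E) (g : E → ℝ) (p : E) : ℝ := lineDeriv ℝ g p v

/-- A derivative depends only on the germ. The calculus rules below are therefore germ equalities,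
so that they can be differentiated again; the space is general because they serve both in ℝ × ℝ and
in ℂ. -/
theorem dirDeriv_congr {v : E} {f g : E → ℝ} {p : E} (h : f =ᶠ[𝓝 p] g) :
    dirDeriv v f =ᶠ[𝓝 p] dirDeriv v g := by
  filter_upwards [eventually_eventually_nhds.2 h] with q hq
  exact Filter.EventuallyEq.lineDeriv_eq hq

theorem dirDeriv_iterate_congr {v : E} {f g : E → ℝ} {p : E} (n : ℕ) (h : f =ᶠ[𝓝 p] g) :
    (dirDeriv v)^[n] f =ᶠ[𝓝 p] (dirDeriv v)^[n] g := by
  induction n generalizing f g with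
  | zero => exact h
  | succ n ih => exact ih (dirDeriv_congr h)

theorem dirDeriv_eq_fderiv {v : E} {g : E → ℝ} {p : E} {n : ℕ}
    (hg : ContDiffAt ℝ (n + 1 : ℕ) g p) :
    dirDeriv v g =ᶠ[𝓝 p] fun q => fderiv ℝ g q v := by
  filter_upwards [hg.eventually (by simp)] with q hq
  exact (hq.differentiableAt (by simp)).lineDeriv_eq_fderiv

theorem ContDiffAt.dirDeriv {v : E} {g : E → ℝ} {p : E} {n : ℕ}
    (hg : ContDiffAt ℝ (n + 1 : ℕ) g p) : ContDiffAt ℝ n (dirDeriv v g) p := by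
  refine ContDiffAt.congr_of_eventuallyEq ?_ (dirDeriv_eq_fderiv hg)
  have : ContDiffAt ℝ n (fderiv ℝ g) p := hg.fderiv_right (by simp)
  exact this.clm_apply contDiffAt_const

theorem ContDiffAt.dirDeriv_iterate {v : E} {g : E → ℝ} {p : E} {n k : ℕ}
    (hg : ContDiffAt ℝ (n + k : ℕ) g p) : ContDiffAt ℝ n ((_root_.dirDeriv v)^[k] g) p := by
  induction k generalizing g with
  | zero => exact hg
  | succ k ih => exact ih (ContDiffAt.dirDeriv hg)

theorem dirDeriv_comm {v w : E} {g : E → ℝ} {p : E} {n : ℕ}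
    (hg : ContDiffAt ℝ (n + 2 : ℕ) g p) :
    dirDeriv v (dirDeriv w g) =ᶠ[𝓝 p] dirDeriv w (dirDeriv v g) := by
  have key : ∀ v w : E, ∀ q, ContDiffAt ℝ (n + 2 : ℕ) g q →
      dirDeriv v (dirDeriv w g) q = fderiv ℝ (fderiv ℝ g) q v w := by
    intro v w q hq
    have hd : DifferentiableAt ℝ (fderiv ℝ g) q := by
      refine ContDiffAt.differentiableAt (n := (n + 1 : ℕ)) (hq.fderiv_right ?_) (by simp)
      norm_cast
    rw [(dirDeriv_congr (dirDeriv_eq_fderiv (n := n + 1) hq)).eq_of_nhds, dirDeriv,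
      DifferentiableAt.lineDeriv_eq_fderiv (by fun_prop),
      fderiv_clm_apply hd (differentiableAt_const w)]
    simp
  -- Being C^k at a point is an open condition for finite k, but not for k = ∞.
  have hn : ((n + 2 : ℕ) : ℕ∞ω) ≠ ∞ := WithTop.coe_injective.ne (ENat.natCast_ne_top (n + 2))
  filter_upwards [hg.eventually hn] with q hq
  rw [key v w q hq, key w v q hq]
  refine (hq.isSymmSndFDerivAt ?_).eq v w
  simp only [minSmoothness_of_isRCLikeNormedField]
  norm_cast
  omega

theorem dirDeriv_iterate_comm {v w : E} {g : E → ℝ} {p : E} {k n : ℕ}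
    (hg : ContDiffAt ℝ (n + k + 1 : ℕ) g p) :
    (dirDeriv v)^[k] (dirDeriv w g) =ᶠ[𝓝 p] dirDeriv w ((dirDeriv v)^[k] g) := by
  induction k generalizing g with
  | zero => exact EventuallyEq.rfl
  | succ k ih =>
    have h1 : dirDeriv v (dirDeriv w g) =ᶠ[𝓝 p] dirDeriv w (dirDeriv v g) :=
      dirDeriv_comm (n := n + k) hg
    exact (dirDeriv_iterate_congr k h1).trans (ih (ContDiffAt.dirDeriv hg))

theorem dirDeriv_add {v : E} {f g : E → ℝ} {p : E} {n : ℕ}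
    (hf : ContDiffAt ℝ (n + 1 : ℕ) f p) (hg : ContDiffAt ℝ (n + 1 : ℕ) g p) :
    dirDeriv v (fun q => f q + g q) =ᶠ[𝓝 p] fun q => dirDeriv v f q + dirDeriv v g q := by
  filter_upwards [dirDeriv_eq_fderiv (v := v) hf, dirDeriv_eq_fderiv (v := v) hg,
    dirDeriv_eq_fderiv (v := v) (hf.add hg), hf.eventually (by simp), hg.eventually (by simp)]
    with q h1 h2 h3 h4 h5
  rw [h1, h2]
  refine h3.trans ?_
  rw [fderiv_fun_add (h4.differentiableAt (by simp)) (h5.differentiableAt (by simp))]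
  rfl

theorem dirDeriv_const_mul {v : E} {g : E → ℝ} {p : E} {n : ℕ} (c : ℝ)
    (hg : ContDiffAt ℝ (n + 1 : ℕ) g p) :
    dirDeriv v (fun q => c * g q) =ᶠ[𝓝 p] fun q => c * dirDeriv v g q := by
  filter_upwards [dirDeriv_eq_fderiv (v := v) hg,
    dirDeriv_eq_fderiv (v := v) (contDiffAt_const (c := c) |>.mul hg), hg.eventually (by simp)]
    with q h2 h3 h5
  rw [h2]
  refine h3.trans ?_
  rw [fderiv_const_mul (h5.differentiableAt (by simp))]
  rfl

theorem dirDeriv_mul {v : E} {f g : E → ℝ} {p : E} {n : ℕ}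
    (hf : ContDiffAt ℝ (n + 1 : ℕ) f p) (hg : ContDiffAt ℝ (n + 1 : ℕ) g p) :
    dirDeriv v (fun q => f q * g q) =ᶠ[𝓝 p] fun q => dirDeriv v f q * g q + f q * dirDeriv v g q := by
  filter_upwards [dirDeriv_eq_fderiv (v := v) hf, dirDeriv_eq_fderiv (v := v) hg,
    dirDeriv_eq_fderiv (v := v) (hf.mul hg), hf.eventually (by simp), hg.eventually (by simp)]
    with q h1 h2 h3 h4 h5
  rw [h1, h2]
  refine h3.trans ?_
  rw [fderiv_fun_mul (h4.differentiableAt (by simp)) (h5.differentiableAt (by simp))]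
  simp only [add_apply, smul_apply, smul_eq_mul]
  ring

theorem dirDeriv_iterate_add {v : E} {f g : E → ℝ} {p : E} {n k : ℕ}
    (hf : ContDiffAt ℝ (n + k : ℕ) f p) (hg : ContDiffAt ℝ (n + k : ℕ) g p) :
    (dirDeriv v)^[k] (fun q => f q + g q) =ᶠ[𝓝 p]
      fun q => (dirDeriv v)^[k] f q + (dirDeriv v)^[k] g q := by
  induction k generalizing f g with
  | zero => exact EventuallyEq.rfl
  | succ k ih =>
    exact (dirDeriv_iterate_congr k (dirDeriv_add (n := n + k) hf hg)).trans
      (ih (ContDiffAt.dirDeriv hf) (ContDiffAt.dirDeriv hg))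

theorem dirDeriv_iterate_const_mul {v : E} {g : E → ℝ} {p : E} {n k : ℕ} (c : ℝ)
    (hg : ContDiffAt ℝ (n + k : ℕ) g p) :
    (dirDeriv v)^[k] (fun q => c * g q) =ᶠ[𝓝 p] fun q => c * (dirDeriv v)^[k] g q := by
  induction k generalizing g with
  | zero => exact EventuallyEq.rfl
  | succ k ih =>
    exact (dirDeriv_iterate_congr k (dirDeriv_const_mul (n := n + k) c hg)).trans
      (ih (ContDiffAt.dirDeriv hg))

theorem dirDeriv_iterate_sum {v : E} {ι : Type*} (s : Finset ι) {g : ι → E → ℝ} {p : E} {n k : ℕ}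
    (hg : ∀ i ∈ s, ContDiffAt ℝ (n + k : ℕ) (g i) p) :
    (dirDeriv v)^[k] (fun q => ∑ i ∈ s, g i q) =ᶠ[𝓝 p]
      fun q => ∑ i ∈ s, (dirDeriv v)^[k] (g i) q := by
  classical
  induction s using Finset.induction_on with
  | empty =>
    simp only [Finset.sum_empty]
    have := dirDeriv_iterate_const_mul (v := v) (p := p) (n := n) (k := k) (g := fun _ => 0) 0
      contDiffAt_const
    simpa using this
  | insert i s hi ih =>
    simp only [Finset.sum_insert hi]
    have h1 := dirDeriv_iterate_add (v := v) (hg i (Finset.mem_insert_self i s))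
      (ContDiffAt.sum fun j hj => hg j (Finset.mem_insert_of_mem hj))
    refine h1.trans ?_
    filter_upwards [ih fun j hj => hg j (Finset.mem_insert_of_mem hj)] with q hq
    rw [hq]

theorem dirDeriv_iterate_mul_antidiagonal {v : E} {f g : E → ℝ} {p : E} {n k : ℕ}
    (hf : ContDiffAt ℝ (n + k : ℕ) f p) (hg : ContDiffAt ℝ (n + k : ℕ) g p) :
    (dirDeriv v)^[k] (fun q => f q * g q) =ᶠ[𝓝 p] fun q =>
      ∑ ij ∈ Finset.HasAntidiagonal.antidiagonal k, (k.choose ij.1 : ℝ) *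
        ((dirDeriv v)^[ij.1] f q * (dirDeriv v)^[ij.2] g q) := by
  induction k generalizing f g with
  | zero => simp
  | succ k ih =>
    have h1 := dirDeriv_iterate_congr (v := v) k (dirDeriv_mul (v := v) (n := n + k) hf hg)
    have hf0 : ContDiffAt ℝ (n + k : ℕ) f p := hf.of_le (by norm_cast; omega)
    have hg0 : ContDiffAt ℝ (n + k : ℕ) g p := hg.of_le (by norm_cast; omega)
    have hf1 := ContDiffAt.dirDeriv (v := v) (n := n + k) hf
    have hg1 := ContDiffAt.dirDeriv (v := v) (n := n + k) hg
    refine h1.trans ((dirDeriv_iterate_add (hf1.mul hg0) (hf0.mul hg1)).trans ?_)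
    filter_upwards [ih hf1 hg0, ih hf0 hg1] with q h2 h3
    rw [h2, h3, Finset.sum_antidiagonal_choose_succ_mul
      (fun i j => (dirDeriv v)^[i] f q * (dirDeriv v)^[j] g q), add_comm]
    refine congrArg₂ (· + ·) rfl (Finset.sum_congr rfl fun ij hij => ?_)
    have hij' := Finset.HasAntidiagonal.mem_antidiagonal.1 hij
    rw [← hij', Nat.choose_symm_add]
    rfl

theorem dirDeriv_iterate_mul {v : E} {f g : E → ℝ} {p : E} {n k : ℕ}
    (hf : ContDiffAt ℝ (n + k : ℕ) f p) (hg : ContDiffAt ℝ (n + k : ℕ) g p) :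
    (dirDeriv v)^[k] (fun q => f q * g q) =ᶠ[𝓝 p] fun q =>
      ∑ i ∈ Finset.range (k + 1), (k.choose i : ℝ) *
        ((dirDeriv v)^[i] f q * (dirDeriv v)^[k - i] g q) := by
  filter_upwards [dirDeriv_iterate_mul_antidiagonal (v := v) hf hg] with q hq
  rw [hq, Finset.Nat.sum_antidiagonal_eq_sum_range_succ
    fun i j => (k.choose i : ℝ) * ((dirDeriv v)^[i] f q * (dirDeriv v)^[j] g q)]

end DirDeriv

/-! ### Mixed partial derivatives in the plane and the nondivergence form. -/

theorem partialX_eq_dirDeriv : partialX = dirDeriv ((1, 0) : ℝ × ℝ) := rfl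

theorem partialY_eq_dirDeriv : partialY = dirDeriv ((0, 1) : ℝ × ℝ) := rfl

theorem ContDiffAt.partialX {g : ℝ × ℝ → ℝ} {p : ℝ × ℝ} {n : ℕ}
    (hg : ContDiffAt ℝ (n + 1 : ℕ) g p) : ContDiffAt ℝ n (partialX g) p := hg.dirDeriv

theorem ContDiffAt.partialY {g : ℝ × ℝ → ℝ} {p : ℝ × ℝ} {n : ℕ}
    (hg : ContDiffAt ℝ (n + 1 : ℕ) g p) : ContDiffAt ℝ n (partialY g) p := hg.dirDeriv

theorem ContDiffAt.mixedPartial {g : ℝ × ℝ → ℝ} {p : ℝ × ℝ} {k m n : ℕ}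
    (hg : ContDiffAt ℝ (k + m + n : ℕ) g p) :
    ContDiffAt ℝ k (fun q => mixedPartial g q m n) p :=
  ContDiffAt.dirDeriv_iterate (v := ((1, 0) : ℝ × ℝ)) (n := k) (k := m)
    (ContDiffAt.dirDeriv_iterate hg)

theorem mixedPartial_congr {f g : ℝ × ℝ → ℝ} {p : ℝ × ℝ} (h : f =ᶠ[𝓝 p] g) (m n : ℕ) :
    mixedPartial f p m n = mixedPartial g p m n :=
  (dirDeriv_iterate_congr m (dirDeriv_iterate_congr n h)).eq_of_nhds

theorem mixedPartial_partialY (g : ℝ × ℝ → ℝ) (p : ℝ × ℝ) (m n : ℕ) :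
    mixedPartial (partialY g) p m n = mixedPartial g p m (n + 1) := rfl

theorem mixedPartial_partialX {g : ℝ × ℝ → ℝ} {p : ℝ × ℝ} {m n : ℕ}
    (hg : ContDiffAt ℝ (m + n + 1 : ℕ) g p) :
    mixedPartial (partialX g) p m n = mixedPartial g p (m + 1) n :=
  (dirDeriv_iterate_congr m (dirDeriv_iterate_comm (v := ((0, 1) : ℝ × ℝ)) hg)).eq_of_nhds

theorem mixedPartial_add {f g : ℝ × ℝ → ℝ} {p : ℝ × ℝ} {m n : ℕ}
    (hf : ContDiffAt ℝ (m + n : ℕ) f p) (hg : ContDiffAt ℝ (m + n : ℕ) g p) :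
    mixedPartial (fun q => f q + g q) p m n = mixedPartial f p m n + mixedPartial g p m n := by
  refine (dirDeriv_iterate_congr m (dirDeriv_iterate_add hf hg)).eq_of_nhds.trans ?_
  refine (dirDeriv_iterate_add (n := 0) (k := m) ?_ ?_).eq_of_nhds
  · rw [zero_add]; exact hf.dirDeriv_iterate
  · rw [zero_add]; exact hg.dirDeriv_iterate

theorem mixedPartial_const_mul {g : ℝ × ℝ → ℝ} {p : ℝ × ℝ} {m n : ℕ} (c : ℝ)
    (hg : ContDiffAt ℝ (m + n : ℕ) g p) :
    mixedPartial (fun q => c * g q) p m n = c * mixedPartial g p m n := by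
  refine (dirDeriv_iterate_congr m (dirDeriv_iterate_const_mul c hg)).eq_of_nhds.trans ?_
  refine (dirDeriv_iterate_const_mul (n := 0) (k := m) c ?_).eq_of_nhds
  rw [zero_add]; exact hg.dirDeriv_iterate

theorem mixedPartial_sum {ι : Type*} (s : Finset ι) {g : ι → ℝ × ℝ → ℝ} {p : ℝ × ℝ} {m n : ℕ}
    (hg : ∀ i ∈ s, ContDiffAt ℝ (m + n : ℕ) (g i) p) :
    mixedPartial (fun q => ∑ i ∈ s, g i q) p m n = ∑ i ∈ s, mixedPartial (g i) p m n := by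
  refine (dirDeriv_iterate_congr m (dirDeriv_iterate_sum s hg)).eq_of_nhds.trans ?_
  refine (dirDeriv_iterate_sum (n := 0) (k := m) s fun i hi => ?_).eq_of_nhds
  rw [zero_add]; exact (hg i hi).dirDeriv_iterate

/-- The Leibniz rule for mixed partial derivatives. -/
theorem mixedPartial_mul {f g : ℝ × ℝ → ℝ} {p : ℝ × ℝ} {m n : ℕ}
    (hf : ContDiffAt ℝ (m + n : ℕ) f p) (hg : ContDiffAt ℝ (m + n : ℕ) g p) :
    mixedPartial (fun q => f q * g q) p m n =
      ∑ i ∈ Finset.range (m + 1), ∑ j ∈ Finset.range (n + 1), (m.choose i : ℝ) * (n.choose j : ℝ) *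
        (mixedPartial f p i j * mixedPartial g p (m - i) (n - j)) := by
  have hF : ∀ j ∈ Finset.range (n + 1), ContDiffAt ℝ m ((dirDeriv ((0, 1) : ℝ × ℝ))^[j] f) p :=
    fun j hj => ContDiffAt.dirDeriv_iterate
      (hf.of_le (by have := Finset.mem_range.1 hj; norm_cast; omega))
  have hG : ∀ j ∈ Finset.range (n + 1),
      ContDiffAt ℝ m ((dirDeriv ((0, 1) : ℝ × ℝ))^[n - j] g) p :=
    fun j hj => ContDiffAt.dirDeriv_iterate
      (hg.of_le (by have := Finset.mem_range.1 hj; norm_cast; omega))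
  refine (dirDeriv_iterate_congr m (dirDeriv_iterate_mul hf hg)).eq_of_nhds.trans ?_
  refine (dirDeriv_iterate_sum (n := 0) (k := m) _ fun j hj => ?_).eq_of_nhds.trans ?_
  · rw [zero_add]
    exact contDiffAt_const.mul ((hF j hj).mul (hG j hj))
  rw [Finset.sum_comm]
  refine Finset.sum_congr rfl fun j hj => ?_
  refine (dirDeriv_iterate_const_mul (n := 0) (k := m) _ ?_).eq_of_nhds.trans ?_
  · rw [zero_add]
    exact (hF j hj).mul (hG j hj)
  rw [(dirDeriv_iterate_mul (n := 0) (k := m) (by rw [zero_add]; exact hF j hj)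
    (by rw [zero_add]; exact hG j hj)).eq_of_nhds, Finset.mul_sum]
  refine Finset.sum_congr rfl fun i _ => ?_
  simp only [mixedPartial, partialX_eq_dirDeriv, partialY_eq_dirDeriv]
  ring

/-- The operator `-∇ · (a ∇u)` in nondivergence form. -/
theorem ellipticOp_eventuallyEq {a u : ℝ × ℝ → ℝ} {p : ℝ × ℝ}
    (ha : ContDiffAt ℝ 1 a p) (hu : ContDiffAt ℝ 2 u p) :
    ellipticOp a u =ᶠ[𝓝 p] fun q => -1 * (a q * (partialX (partialX u) q + partialY (partialY u) q) +
      (partialX a q * partialX u q + partialY a q * partialY u q)) := by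
  have h1 := dirDeriv_mul (v := ((1, 0) : ℝ × ℝ)) (n := 0) ha (hu.partialX (n := 1))
  have h2 := dirDeriv_mul (v := ((0, 1) : ℝ × ℝ)) (n := 0) ha (hu.partialY (n := 1))
  filter_upwards [h1, h2] with q hq1 hq2
  simp only [ellipticOp, partialX_eq_dirDeriv, partialY_eq_dirDeriv] at hq1 hq2 ⊢
  rw [hq1, hq2]
  ring

theorem mixedPartial_ellipticOp {a u : ℝ × ℝ → ℝ} {p : ℝ × ℝ} {m n : ℕ}
    (ha : ContDiffAt ℝ (m + n + 1 : ℕ) a p) (hu : ContDiffAt ℝ (m + n + 2 : ℕ) u p) :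
    mixedPartial (ellipticOp a u) p m n =
      -∑ i ∈ Finset.range (m + 1), ∑ j ∈ Finset.range (n + 1),
        (m.choose i : ℝ) * (n.choose j : ℝ) *
        (mixedPartial a p i j * (mixedPartial u p (m - i + 2) (n - j) +
            mixedPartial u p (m - i) (n - j + 2))
          + mixedPartial a p (i + 1) j * mixedPartial u p (m - i + 1) (n - j)
          + mixedPartial a p i (j + 1) * mixedPartial u p (m - i) (n - j + 1)) := by
  have ha0 : ContDiffAt ℝ (m + n : ℕ) a p := ha.of_le (by norm_cast; omega)
  have hux := hu.partialX (n := m + n + 1)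
  have huy := hu.partialY (n := m + n + 1)
  have hux0 : ContDiffAt ℝ (m + n : ℕ) (partialX u) p := hux.of_le (by norm_cast; omega)
  have huy0 : ContDiffAt ℝ (m + n : ℕ) (partialY u) p := huy.of_le (by norm_cast; omega)
  have huxx := hux.partialX (n := m + n)
  have huyy := huy.partialY (n := m + n)
  have hax := ha.partialX (n := m + n)
  have hay := ha.partialY (n := m + n)
  rw [mixedPartial_congr (ellipticOp_eventuallyEq (ha.of_le (by norm_cast; omega))
      (hu.of_le (by norm_cast; omega))),
    mixedPartial_const_mul _ ((ha0.mul (huxx.add huyy)).add ((hax.mul hux0).add (hay.mul huy0))),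
    mixedPartial_add (ha0.mul (huxx.add huyy)) ((hax.mul hux0).add (hay.mul huy0)),
    mixedPartial_add (hax.mul hux0) (hay.mul huy0),
    mixedPartial_mul ha0 (huxx.add huyy), mixedPartial_mul hax hux0, mixedPartial_mul hay huy0,
    ← Finset.sum_add_distrib, ← Finset.sum_add_distrib, neg_one_mul]
  congr 1
  refine Finset.sum_congr rfl fun i hi => ?_
  rw [← Finset.sum_add_distrib, ← Finset.sum_add_distrib]
  refine Finset.sum_congr rfl fun j hj => ?_
  have hi' := Finset.mem_range.1 hi
  have hj' := Finset.mem_range.1 hj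
  rw [mixedPartial_add (huxx.of_le (by norm_cast; omega)) (huyy.of_le (by norm_cast; omega)),
    mixedPartial_partialX (hux.of_le (by norm_cast; omega)),
    mixedPartial_partialX (hu.of_le (by norm_cast; omega)),
    mixedPartial_partialX (ha.of_le (by norm_cast; omega)),
    mixedPartial_partialX (hu.of_le (by norm_cast; omega))]
  simp only [mixedPartial_partialY]
  ring

/-! ### Jets and Taylor polynomials -/

/-- The Taylor polynomial of degree less than `N` with partial derivatives `J m n`. -/
def jetPoly (N : ℕ) (J : ℕ → ℕ → ℝ) (X Y : ℝ) : ℝ :=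
  ∑ q ∈ indicesBelow N,
    J q.1 q.2 * X ^ q.1 * Y ^ q.2 / ((q.1.factorial : ℝ) * (q.2.factorial : ℝ))

theorem mem_indicesBelow {N : ℕ} {q : ℕ × ℕ} : q ∈ indicesBelow N ↔ q.1 + q.2 < N := by
  simp only [indicesBelow, Finset.mem_filter, Finset.mem_product, Finset.mem_range]
  omega

theorem sum_indicesBelow (N : ℕ) (g : ℕ → ℕ → ℝ) :
    ∑ q ∈ indicesBelow N, g q.1 q.2 =
      ∑ m ∈ Finset.range N, ∑ n ∈ Finset.range (N - m), g m n := by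
  rw [Finset.sum_sigma']
  refine Finset.sum_bij' (fun q _ => ⟨q.1, q.2⟩) (fun q _ => (q.1, q.2)) ?_ ?_ ?_ ?_ ?_
  · intro q hq
    have := mem_indicesBelow.1 hq
    simp only [Finset.mem_sigma, Finset.mem_range]
    omega
  · intro q hq
    simp only [Finset.mem_sigma, Finset.mem_range] at hq
    rw [mem_indicesBelow]
    dsimp only
    omega
  all_goals intros; rfl

theorem jetPoly_eq_sum (N : ℕ) (J : ℕ → ℕ → ℝ) (X Y : ℝ) :
    jetPoly N J X Y = ∑ m ∈ Finset.range N, ∑ n ∈ Finset.range (N - m),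
      J m n * (X ^ m / (m.factorial : ℝ)) * (Y ^ n / (n.factorial : ℝ)) := by
  rw [← sum_indicesBelow N fun m n =>
    J m n * (X ^ m / (m.factorial : ℝ)) * (Y ^ n / (n.factorial : ℝ))]
  refine Finset.sum_congr rfl fun q _ => ?_
  field_simp

theorem jetPoly_congr {N : ℕ} {J J' : ℕ → ℕ → ℝ} (h : ∀ m n, m + n < N → J m n = J' m n) :
    jetPoly N J = jetPoly N J' := by
  funext X Y
  refine Finset.sum_congr rfl fun q hq => ?_
  rw [h q.1 q.2 (mem_indicesBelow.1 hq)]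

theorem jetPoly_add (N : ℕ) (J J' : ℕ → ℕ → ℝ) (X Y : ℝ) :
    jetPoly N (fun m n => J m n + J' m n) X Y = jetPoly N J X Y + jetPoly N J' X Y := by
  simp only [jetPoly, ← Finset.sum_add_distrib]
  refine Finset.sum_congr rfl fun q _ => ?_
  ring

theorem jetPoly_sum {ι : Type*} (s : Finset ι) (c : ι → ℝ) (N : ℕ) (J : ι → ℕ → ℕ → ℝ) (X Y : ℝ) :
    jetPoly N (fun m n => ∑ i ∈ s, c i * J i m n) X Y = ∑ i ∈ s, c i * jetPoly N (J i) X Y := by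
  simp only [jetPoly, Finset.mul_sum]
  rw [Finset.sum_comm]
  refine Finset.sum_congr rfl fun q _ => ?_
  rw [Finset.sum_mul, Finset.sum_mul, Finset.sum_div]
  refine Finset.sum_congr rfl fun i _ => ?_
  ring

theorem jetPoly_zero_zero {N : ℕ} (hN : 0 < N) (J : ℕ → ℕ → ℝ) : jetPoly N J 0 0 = J 0 0 := by
  rw [jetPoly, Finset.sum_eq_single (0, 0)]
  · simp
  · rintro ⟨m, n⟩ - hmn
    rcases Nat.eq_zero_or_pos m with rfl | hm
    · rcases Nat.eq_zero_or_pos n with rfl | hn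
      · exact absurd rfl hmn
      · simp [hn.ne']
    · simp [hm.ne']
  · intro h
    exact absurd (mem_indicesBelow.2 (by simpa using hN)) h

theorem hasDerivAt_pow_div_factorial (n : ℕ) (x : ℝ) :
    HasDerivAt (fun x : ℝ => x ^ (n + 1) / ((n + 1).factorial : ℝ)) (x ^ n / (n.factorial : ℝ)) x := by
  have h := (hasDerivAt_pow (n + 1) x).div_const ((n + 1).factorial : ℝ)
  refine h.congr_deriv ?_
  rw [Nat.factorial_succ, Nat.add_sub_cancel]
  push_cast
  field_simp

theorem hasDerivAt_jetPoly_left (N : ℕ) (J : ℕ → ℕ → ℝ) (X Y : ℝ) :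
    HasDerivAt (fun X => jetPoly (N + 1) J X Y) (jetPoly N (fun m n => J (m + 1) n) X Y) X := by
  simp only [jetPoly_eq_sum]
  simp_rw [Finset.sum_range_succ' _ N]
  -- The row m = 0 does not depend on X; in the other rows, differentiation lowers X^(m+1)/(m+1)! to
  -- X^m/m!, which shifts the jet.
  have h0 : HasDerivAt (fun X : ℝ => ∑ n ∈ Finset.range (N + 1 - 0),
      J 0 n * (X ^ 0 / (Nat.factorial 0 : ℝ)) * (Y ^ n / (n.factorial : ℝ))) 0 X := by
    simp only [pow_zero]
    exact hasDerivAt_const _ _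
  rw [← add_zero (∑ m ∈ Finset.range N, _)]
  refine HasDerivAt.add ?_ h0
  refine HasDerivAt.fun_sum fun m _ => ?_
  rw [Nat.add_sub_add_right]
  refine HasDerivAt.fun_sum fun n _ => ?_
  exact ((hasDerivAt_pow_div_factorial m X).const_mul _).mul_const _

theorem jetPoly_swap (N : ℕ) (J : ℕ → ℕ → ℝ) (X Y : ℝ) :
    jetPoly N (fun m n => J n m) Y X = jetPoly N J X Y := by
  refine Finset.sum_bij' (fun q _ => q.swap) (fun q _ => q.swap) ?_ ?_ ?_ ?_ ?_
  · intro q hq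
    rw [mem_indicesBelow] at hq ⊢
    simpa [add_comm] using hq
  · intro q hq
    rw [mem_indicesBelow] at hq ⊢
    simpa [add_comm] using hq
  · intros; simp
  · intros; simp
  · intro q _
    simp only [Prod.fst_swap, Prod.snd_swap]
    ring

theorem hasDerivAt_jetPoly_right (N : ℕ) (J : ℕ → ℕ → ℝ) (X Y : ℝ) :
    HasDerivAt (fun Y => jetPoly (N + 1) J X Y) (jetPoly N (fun m n => J m (n + 1)) X Y) Y := by
  have h := hasDerivAt_jetPoly_left N (fun m n => J n m) Y X
  rw [jetPoly_swap N (fun m n => J m (n + 1))] at h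
  simpa only [jetPoly_swap (N + 1) J] using h

@[fun_prop]
theorem contDiff_jetPoly (N : ℕ) (J : ℕ → ℕ → ℝ) (n : ℕ∞ω) :
    ContDiff ℝ n (fun z : ℝ × ℝ => jetPoly N J z.1 z.2) := by
  unfold jetPoly
  fun_prop

theorem partialX_jetPoly (N : ℕ) (J : ℕ → ℕ → ℝ) (p : ℝ × ℝ) :
    partialX (fun q => jetPoly (N + 1) J (q.1 - p.1) (q.2 - p.2)) =
      fun q => jetPoly N (fun m n => J (m + 1) n) (q.1 - p.1) (q.2 - p.2) := by
  funext q
  refine HasLineDerivAt.lineDeriv ?_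
  have h := hasDerivAt_jetPoly_left N J (q.1 - p.1 + 0) (q.2 - p.2)
  have h2 : HasDerivAt (fun t : ℝ => q.1 - p.1 + t) 1 0 := (hasDerivAt_id 0).const_add _
  have h3 := HasDerivAt.comp (0 : ℝ) h h2
  simp only [add_zero, mul_one] at h3
  refine HasDerivAt.congr_of_eventuallyEq h3 (Eventually.of_forall fun t => ?_)
  simp only [Function.comp, Prod.fst_add, Prod.snd_add, Prod.smul_fst, Prod.smul_snd, smul_eq_mul]
  congr 1 <;> ring

theorem partialY_jetPoly (N : ℕ) (J : ℕ → ℕ → ℝ) (p : ℝ × ℝ) :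
    partialY (fun q => jetPoly (N + 1) J (q.1 - p.1) (q.2 - p.2)) =
      fun q => jetPoly N (fun m n => J m (n + 1)) (q.1 - p.1) (q.2 - p.2) := by
  funext q
  refine HasLineDerivAt.lineDeriv ?_
  have h := hasDerivAt_jetPoly_right N J (q.1 - p.1) (q.2 - p.2 + 0)
  have h2 : HasDerivAt (fun t : ℝ => q.2 - p.2 + t) 1 0 := (hasDerivAt_id 0).const_add _
  have h3 := HasDerivAt.comp (0 : ℝ) h h2
  simp only [add_zero, mul_one] at h3
  refine HasDerivAt.congr_of_eventuallyEq h3 (Eventually.of_forall fun t => ?_)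
  simp only [Function.comp, Prod.fst_add, Prod.snd_add, Prod.smul_fst, Prod.smul_snd, smul_eq_mul]
  congr 1 <;> ring

/-- A polynomial with prescribed partial derivatives at a point. -/
theorem mixedPartial_jetPoly {N m n : ℕ} (hmn : m + n < N) (J : ℕ → ℕ → ℝ) (p : ℝ × ℝ) :
    mixedPartial (fun q => jetPoly N J (q.1 - p.1) (q.2 - p.2)) p m n = J m n := by
  have hY : ∀ n N J, partialY^[n] (fun q => jetPoly (N + n) J (q.1 - p.1) (q.2 - p.2)) =
      fun q => jetPoly N (fun i j => J i (j + n)) (q.1 - p.1) (q.2 - p.2) := by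
    intro n
    induction n with
    | zero => intros; rfl
    | succ n ih =>
      intro N J
      rw [Function.iterate_succ_apply, ← add_assoc, partialY_jetPoly, ih]
      simp only [add_assoc]
  have hX : ∀ m N J, partialX^[m] (fun q => jetPoly (N + m) J (q.1 - p.1) (q.2 - p.2)) =
      fun q => jetPoly N (fun i j => J (i + m) j) (q.1 - p.1) (q.2 - p.2) := by
    intro m
    induction m with
    | zero => intros; rfl
    | succ m ih =>
      intro N J
      rw [Function.iterate_succ_apply, ← add_assoc, partialX_jetPoly, ih]
      simp only [add_assoc]
  obtain ⟨k, rfl⟩ : ∃ k, N = k + 1 + m + n := ⟨N - 1 - m - n, by omega⟩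
  rw [mixedPartial, hY, hX]
  simp only [sub_self]
  rw [jetPoly_zero_zero (Nat.succ_pos k)]
  simp

/-! ### The recursion for the derivatives of a solution -/

/-- The `(m, n)`-th derivative of `a u_xx + a u_yy + a_x u_x + a_y u_y` in terms of the derivatives
of `a` and `u`. -/
def ellipticJet (A U : ℕ → ℕ → ℝ) (m n : ℕ) : ℝ :=
  ∑ i ∈ Finset.range (m + 1), ∑ j ∈ Finset.range (n + 1), (m.choose i : ℝ) * (n.choose j : ℝ) *
    (A i j * (U (m - i + 2) (n - j) + U (m - i) (n - j + 2))
      + A (i + 1) j * U (m - i + 1) (n - j) + A i (j + 1) * U (m - i) (n - j + 1))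

/-- `ellipticJet` without its leading term. -/
def ellipticJetLower (A U : ℕ → ℕ → ℝ) (m n : ℕ) : ℝ :=
  ∑ i : Fin (m + 1), ∑ j : Fin (n + 1), (m.choose i : ℝ) * (n.choose j : ℝ) *
    (A i j * ((if _h : 0 < (i : ℕ) + j then U (m - i + 2) (n - j) else 0)
                  + U (m - i) (n - j + 2))
          + A (i + 1) j * U (m - i + 1) (n - j) + A i (j + 1) * U (m - i) (n - j + 1))

theorem ellipticJet_eq (A U : ℕ → ℕ → ℝ) (m n : ℕ) :
    ellipticJet A U m n = A 0 0 * U (m + 2) n + ellipticJetLower A U m n := by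
  have h : A 0 0 * U (m + 2) n = ∑ i ∈ Finset.range (m + 1), ∑ j ∈ Finset.range (n + 1),
      if i = 0 ∧ j = 0 then A 0 0 * U (m + 2) n else 0 := by
    rw [Finset.sum_eq_single 0, Finset.sum_eq_single 0]
    · simp
    · intro j _ hj; simp [hj]
    · simp
    · intro i _ hi; simp [hi]
    · simp
  rw [h, ellipticJetLower, Fin.sum_univ_eq_sum_range (fun i => ∑ j : Fin (n + 1),
    (m.choose i : ℝ) * (n.choose j : ℝ) *
      (A i j * ((if _h : 0 < i + j then U (m - i + 2) (n - j) else 0) + U (m - i) (n - j + 2))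
        + A (i + 1) j * U (m - i + 1) (n - j) + A i (j + 1) * U (m - i) (n - j + 1))) (m + 1),
    ← Finset.sum_add_distrib]
  refine Finset.sum_congr rfl fun i _ => ?_
  rw [Fin.sum_univ_eq_sum_range (fun j => (m.choose i : ℝ) * (n.choose j : ℝ) *
      (A i j * ((if _h : 0 < i + j then U (m - i + 2) (n - j) else 0) + U (m - i) (n - j + 2))
        + A (i + 1) j * U (m - i + 1) (n - j) + A i (j + 1) * U (m - i) (n - j + 1))) (n + 1),
    ← Finset.sum_add_distrib]
  refine Finset.sum_congr rfl fun j _ => ?_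
  by_cases hij : i = 0 ∧ j = 0
  · obtain ⟨rfl, rfl⟩ := hij
    simp
    ring
  · rw [dif_pos (by omega), if_neg hij, zero_add]

theorem solutionJet_zero (A F : ℕ → ℕ → ℝ) (w₀ w₁ : ℕ → ℝ) (n : ℕ) :
    solutionJet A F w₀ w₁ 0 n = w₀ n := by
  rw [solutionJet]

theorem solutionJet_one (A F : ℕ → ℕ → ℝ) (w₀ w₁ : ℕ → ℝ) (n : ℕ) :
    solutionJet A F w₀ w₁ 1 n = w₁ n := by
  rw [solutionJet]

theorem solutionJet_add_two (A F : ℕ → ℕ → ℝ) (w₀ w₁ : ℕ → ℝ) (m n : ℕ) :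
    solutionJet A F w₀ w₁ (m + 2) n =
      -(F m n + ellipticJetLower A (solutionJet A F w₀ w₁) m n) / A 0 0 := by
  rw [solutionJet]
  rfl

theorem solutionJet_spec {A : ℕ → ℕ → ℝ} (hA : A 0 0 ≠ 0) (F : ℕ → ℕ → ℝ) (w₀ w₁ : ℕ → ℝ)
    (m n : ℕ) : F m n + ellipticJet A (solutionJet A F w₀ w₁) m n = 0 := by
  rw [ellipticJet_eq, solutionJet_add_two]
  field_simp
  ring

/-- The recursion leaves no freedom: every term on its right side has a smaller first index, or the
same first index and a smaller second one, hence the nested strong induction. An equation of order m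
+ n involves derivatives of total order up to m + n + 2, hence the bound L + 2. -/
theorem eq_solutionJet {A F U : ℕ → ℕ → ℝ} (hA : A 0 0 ≠ 0) {L : ℕ}
    (h : ∀ m n, m + n < L → F m n + ellipticJet A U m n = 0) (m n : ℕ) (hmn : m + n < L + 2) :
    U m n = solutionJet A F (U 0) (U 1) m n := by
  induction m using Nat.strong_induction_on generalizing n with
  | _ m ihm =>
    induction n using Nat.strong_induction_on with
    | _ n ihn =>
      match m with
      | 0 => rw [solutionJet_zero]
      | 1 => rw [solutionJet_one]
      | m + 2 =>
        rw [solutionJet_add_two, eq_div_iff hA]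
        have h1 := h m n (by omega)
        rw [ellipticJet_eq] at h1
        have h2 : ellipticJetLower A U m n =
            ellipticJetLower A (solutionJet A F (U 0) (U 1)) m n := by
          unfold ellipticJetLower
          refine Finset.sum_congr rfl fun i _ => Finset.sum_congr rfl fun j _ => ?_
          have hi := i.2
          have hj := j.2
          rw [ihm (m - i) (by omega) (n - j + 2) (by omega),
            ihm (m - i + 1) (by omega) (n - j) (by omega),
            ihm (m - i) (by omega) (n - j + 1) (by omega)]
          split_ifs with hij
          · have : U (m - i + 2) (n - j) =
                solutionJet A F (U 0) (U 1) (m - i + 2) (n - j) := by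
              rcases Nat.eq_zero_or_pos (i : ℕ) with hi0 | hi0
              · rw [hi0]
                exact ihn (n - j) (by omega) (by omega)
              · exact ihm (m - i + 2) (by omega) (n - j) (by omega)
            rw [this]
          · rfl
        rw [← h2]
        linarith

theorem mixedPartial_ellipticOp_eq_ellipticJet {a u : ℝ × ℝ → ℝ} {p : ℝ × ℝ} {m n : ℕ}
    (ha : ContDiffAt ℝ (m + n + 1 : ℕ) a p) (hu : ContDiffAt ℝ (m + n + 2 : ℕ) u p) :
    mixedPartial (ellipticOp a u) p m n =
      -ellipticJet (mixedPartial a p) (mixedPartial u p) m n :=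
  mixedPartial_ellipticOp ha hu

theorem ellipticJet_add (A U V : ℕ → ℕ → ℝ) (m n : ℕ) :
    ellipticJet A (fun i j => U i j + V i j) m n = ellipticJet A U m n + ellipticJet A V m n := by
  simp only [ellipticJet, ← Finset.sum_add_distrib]
  refine Finset.sum_congr rfl fun i _ => Finset.sum_congr rfl fun j _ => ?_
  ring

theorem ellipticJet_sum {ι : Type*} (s : Finset ι) (c : ι → ℝ) (A : ℕ → ℕ → ℝ)
    (U : ι → ℕ → ℕ → ℝ) (m n : ℕ) :
    ellipticJet A (fun i j => ∑ k ∈ s, c k * U k i j) m n =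
      ∑ k ∈ s, c k * ellipticJet A (U k) m n := by
  simp only [ellipticJet, Finset.mul_sum]
  rw [Finset.sum_comm' (t' := Finset.range (m + 1)) (s' := fun _ => s) (by simp [and_comm])]
  refine Finset.sum_congr rfl fun i _ => ?_
  rw [Finset.sum_comm]
  refine Finset.sum_congr rfl fun j _ => ?_
  simp only [← Finset.sum_add_distrib, Finset.mul_sum]
  refine Finset.sum_congr rfl fun k _ => ?_
  ring

/-- The contributions of the initial data and of the source to the derivatives of a solution. -/
theorem solutionJet_decomp {A F U : ℕ → ℕ → ℝ} (hA : A 0 0 ≠ 0) {L : ℕ}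
    (h : ∀ m n, m + n < L → F m n + ellipticJet A U m n = 0) (m n : ℕ) (hmn : m + n < L + 2) :
    U m n = solutionJet A 0 (U 0) (U 1) m n + ∑ q ∈ indicesBelow L, F q.1 q.2 *
      solutionJet A (fun i j => if i = q.1 ∧ j = q.2 then 1 else 0) 0 0 m n := by
  set V : ℕ → ℕ → ℝ := fun m n => solutionJet A 0 (U 0) (U 1) m n +
    ∑ q ∈ indicesBelow L, F q.1 q.2 *
      solutionJet A (fun i j => if i = q.1 ∧ j = q.2 then 1 else 0) 0 0 m n with hV
  -- `V` solves the same equations as `U`: at (m, n) only the response to F m n contributes a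
  -- source, and m + n < L ensures that this summand is present. Uniqueness then identifies `V` with
  -- `U`.
  have hspec : ∀ m n, m + n < L → F m n + ellipticJet A V m n = 0 := by
    intro m n hmn
    have h1 := solutionJet_spec hA 0 (U 0) (U 1) m n
    have h2 : ∀ q ∈ indicesBelow L, F q.1 q.2 * ellipticJet A
        (solutionJet A (fun i j => if i = q.1 ∧ j = q.2 then 1 else 0) 0 0) m n =
        if q = (m, n) then -F m n else 0 := by
      intro q _
      have := solutionJet_spec hA (fun i j => if i = q.1 ∧ j = q.2 then 1 else 0) 0 0 m n
      by_cases hq : q = (m, n)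
      · subst hq
        simp only [and_self, if_true] at this ⊢
        rw [eq_neg_of_add_eq_zero_right this]
        ring
      · have hq' : ¬ (m = q.1 ∧ n = q.2) := fun h => hq (Prod.ext h.1.symm h.2.symm)
        rw [if_neg hq'] at this
        rw [if_neg hq, ← zero_add (ellipticJet _ _ _ _), this, mul_zero]
    rw [hV, ellipticJet_add, ellipticJet_sum, Finset.sum_congr rfl h2, Finset.sum_ite_eq',
      if_pos (mem_indicesBelow.2 hmn)]
    simp only [Pi.zero_apply, zero_add] at h1
    rw [h1]
    ring
  have h0 : V 0 = U 0 := by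
    funext n
    simp [hV, solutionJet_zero]
  have h1 : V 1 = U 1 := by
    funext n
    simp [hV, solutionJet_one]
  rw [eq_solutionJet hA h m n hmn]
  change _ = V m n
  rw [eq_solutionJet hA hspec m n hmn, h0, h1]

/-- Continuity in the base point is what turns pointwise jets into bounds uniform on a compact set.
The induction follows the order of the recursion, whose only division is by `A t 0 0`. -/
theorem continuousOn_solutionJet {T : Type*} [TopologicalSpace T] {s : Set T}
    {A F : T → ℕ → ℕ → ℝ} {w₀ w₁ : T → ℕ → ℝ}
    (hA : ∀ i j, ContinuousOn (fun t => A t i j) s) (hA0 : ∀ t ∈ s, A t 0 0 ≠ 0)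
    (hF : ∀ i j, ContinuousOn (fun t => F t i j) s)
    (h₀ : ∀ j, ContinuousOn (fun t => w₀ t j) s) (h₁ : ∀ j, ContinuousOn (fun t => w₁ t j) s)
    (m n : ℕ) : ContinuousOn (fun t => solutionJet (A t) (F t) (w₀ t) (w₁ t) m n) s := by
  induction m using Nat.strong_induction_on generalizing n with
  | _ m ihm =>
    induction n using Nat.strong_induction_on with
    | _ n ihn =>
      match m with
      | 0 => simpa only [solutionJet_zero] using h₀ n
      | 1 => simpa only [solutionJet_one] using h₁ n
      | m + 2 =>
        simp only [solutionJet_add_two]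
        refine ContinuousOn.div ((hF m n).add ?_).neg (hA 0 0) hA0
        refine continuousOn_finsetSum _ fun i _ => continuousOn_finsetSum _ fun j _ => ?_
        have hi := i.2
        have hj := j.2
        refine continuousOn_const.mul ((((hA i j).mul (ContinuousOn.add ?_ ?_)).add
          ((hA (i + 1) j).mul ?_)).add ((hA i (j + 1)).mul ?_))
        · split_ifs with hij
          · rcases Nat.eq_zero_or_pos (i : ℕ) with hi0 | hi0
            · rw [hi0]
              exact ihn (n - j) (by omega)
            · exact ihm (m - i + 2) (by omega) (n - j)
          · exact continuousOn_const
        · exact ihm (m - i) (by omega) (n - j + 2)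
        · exact ihm (m - i + 1) (by omega) (n - j)
        · exact ihm (m - i) (by omega) (n - j + 1)

/-! ### Taylor's theorem with a uniform remainder -/

theorem ContDiffOn.continuousOn_mixedPartial {g : ℝ × ℝ → ℝ} {U : Set (ℝ × ℝ)} (hU : IsOpen U)
    {k m n : ℕ} (hmn : m + n ≤ k) (hg : ContDiffOn ℝ k g U) :
    ContinuousOn (fun p => mixedPartial g p m n) U := by
  intro p hp
  have h : ContDiffAt ℝ (0 + m + n : ℕ) g p :=
    (hg.contDiffAt (hU.mem_nhds hp)).of_le (by norm_cast; omega)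
  exact (ContDiffAt.mixedPartial h).continuousAt.continuousWithinAt

theorem ContDiffOn.partialX {g : ℝ × ℝ → ℝ} {U : Set (ℝ × ℝ)} (hU : IsOpen U) {k : ℕ}
    (hg : ContDiffOn ℝ (k + 1 : ℕ) g U) : ContDiffOn ℝ k (partialX g) U :=
  fun _ hp => ((hg.contDiffAt (hU.mem_nhds hp)).partialX).contDiffWithinAt

theorem ContDiffOn.partialY {g : ℝ × ℝ → ℝ} {U : Set (ℝ × ℝ)} (hU : IsOpen U) {k : ℕ}
    (hg : ContDiffOn ℝ (k + 1 : ℕ) g U) : ContDiffOn ℝ k (partialY g) U :=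
  fun _ hp => ((hg.contDiffAt (hU.mem_nhds hp)).partialY).contDiffWithinAt

theorem hasDerivAt_jetPoly_ray (N : ℕ) (J : ℕ → ℕ → ℝ) (X Y t : ℝ) :
    HasDerivAt (fun t => jetPoly (N + 1) J (t * X) (t * Y))
      (X * jetPoly N (fun m n => J (m + 1) n) (t * X) (t * Y) +
        Y * jetPoly N (fun m n => J m (n + 1)) (t * X) (t * Y)) t := by
  set G : ℝ × ℝ → ℝ := fun z => jetPoly (N + 1) J z.1 z.2 with hG
  have hd : DifferentiableAt ℝ G (t * X, t * Y) :=
    (contDiff_jetPoly (N + 1) J 1).differentiable (by simp) _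
  have hx : fderiv ℝ G (t * X, t * Y) (1, 0) =
      jetPoly N (fun m n => J (m + 1) n) (t * X) (t * Y) := by
    rw [← hd.lineDeriv_eq_fderiv]
    have := congrFun (partialX_jetPoly N J 0) (t * X, t * Y)
    simpa [partialX] using this
  have hy : fderiv ℝ G (t * X, t * Y) (0, 1) =
      jetPoly N (fun m n => J m (n + 1)) (t * X) (t * Y) := by
    rw [← hd.lineDeriv_eq_fderiv]
    have := congrFun (partialY_jetPoly N J 0) (t * X, t * Y)
    simpa [partialY] using this
  have hc : HasDerivAt (fun t : ℝ => (t * X, t * Y)) (X, Y) t := by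
    have h1 := (hasDerivAt_id t).mul_const X
    have h2 := (hasDerivAt_id t).mul_const Y
    simpa using h1.prodMk h2
  refine (hd.hasFDerivAt.comp_hasDerivAt t hc).congr_deriv ?_
  have : ((X, Y) : ℝ × ℝ) = X • (1, 0) + Y • (0, 1) := by simp
  rw [this, map_add, map_smul, map_smul, hx, hy]
  rfl

theorem hasDerivAt_ray {g : ℝ × ℝ → ℝ} {p z : ℝ × ℝ} {t : ℝ}
    (hg : ContDiffAt ℝ 1 g (p + t • z)) :
    HasDerivAt (fun t => g (p + t • z))
      (z.1 * partialX g (p + t • z) + z.2 * partialY g (p + t • z)) t := by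
  have hd := hg.differentiableAt (by simp)
  have hc : HasDerivAt (fun t : ℝ => p + t • z) z t := by
    simpa using ((hasDerivAt_id t).smul_const z).const_add p
  refine (hd.hasFDerivAt.comp_hasDerivAt t hc).congr_deriv ?_
  have : z = z.1 • (1, 0) + z.2 • (0, 1) := by ext <;> simp
  nth_rewrite 2 [this]
  rw [map_add, map_smul, map_smul, partialX, partialY, hd.lineDeriv_eq_fderiv,
    hd.lineDeriv_eq_fderiv]
  rfl

/-- Along the ray t ↦ p + t z the derivative of the remainder of g is z.1 times the remainder of
`partialX g` plus z.2 times that of `partialY g`. Both are one order lower, so induction and the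
mean value inequality on [0, 1] suffice. The closed thickening of K is compact and contains all
these rays; it supplies the base case. -/
theorem exists_taylor_bound {U K : Set (ℝ × ℝ)} (hU : IsOpen U) (hK : IsCompact K) {δ : ℝ}
    (hKU : Metric.cthickening δ K ⊆ U) (N : ℕ) (g : ℝ × ℝ → ℝ) (hg : ContDiffOn ℝ N g U) :
    ∃ C, 0 ≤ C ∧ ∀ p ∈ K, ∀ z : ℝ × ℝ, ‖z‖ ≤ δ →
      |g (p + z) - jetPoly N (mixedPartial g p) z.1 z.2| ≤ C * ‖z‖ ^ N := by
  have hmem : ∀ p ∈ K, ∀ z : ℝ × ℝ, ‖z‖ ≤ δ → p + z ∈ Metric.cthickening δ K := by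
    intro p hp z hz
    exact Metric.mem_cthickening_of_dist_le _ p δ K hp (by simpa using hz)
  induction N generalizing g with
  | zero =>
    obtain ⟨C, hC⟩ := hK.cthickening.exists_bound_of_continuousOn (hg.continuousOn.mono hKU)
    refine ⟨max C 0, le_max_right _ _, fun p hp z hz => ?_⟩
    have h1 := hC _ (hmem p hp z hz)
    simp only [jetPoly, indicesBelow, Finset.range_zero, Finset.product_empty,
      Finset.filter_empty, Finset.sum_empty, sub_zero, pow_zero, mul_one]
    exact h1.trans (le_max_left _ _)
  | succ N ih =>
    obtain ⟨C₁, hC₁, h₁⟩ := ih (partialX g) (hg.partialX hU)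
    obtain ⟨C₂, hC₂, h₂⟩ := ih (partialY g) (hg.partialY hU)
    refine ⟨C₁ + C₂, by positivity, fun p hp z hz => ?_⟩
    have hpU : p ∈ U := by simpa using hKU (hmem p hp 0 (by simpa using (norm_nonneg z).trans hz))
    have hseg : ∀ t ∈ Icc (0 : ℝ) 1, ‖t • z‖ ≤ ‖z‖ := by
      intro t ht
      rw [norm_smul, Real.norm_of_nonneg ht.1]
      exact mul_le_of_le_one_left (norm_nonneg z) ht.2
    have hjX : ∀ X Y, jetPoly N (fun m n => mixedPartial g p (m + 1) n) X Y =
        jetPoly N (mixedPartial (partialX g) p) X Y := by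
      intro X Y
      rw [jetPoly_congr fun m n hmn => (mixedPartial_partialX ?_).symm]
      exact (hg.contDiffAt (hU.mem_nhds hpU)).of_le (by norm_cast; omega)
    have hderiv : ∀ t ∈ Icc (0 : ℝ) 1, HasDerivWithinAt
        (fun t : ℝ => g (p + t • z) - jetPoly (N + 1) (mixedPartial g p) (t * z.1) (t * z.2))
        (z.1 * (partialX g (p + t • z) -
            jetPoly N (mixedPartial (partialX g) p) (t • z).1 (t • z).2) +
          z.2 * (partialY g (p + t • z) -
            jetPoly N (mixedPartial (partialY g) p) (t • z).1 (t • z).2)) (Icc 0 1) t := by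
      intro t ht
      have hpt : p + t • z ∈ U := hKU (hmem p hp _ ((hseg t ht).trans hz))
      have h3 := hasDerivAt_ray ((hg.contDiffAt (hU.mem_nhds hpt)).of_le (by norm_cast; omega))
      have h4 := hasDerivAt_jetPoly_ray N (mixedPartial g p) z.1 z.2 t
      refine ((h3.sub h4).congr_deriv ?_).hasDerivWithinAt
      rw [hjX]
      simp only [Prod.smul_fst, Prod.smul_snd, smul_eq_mul]
      change _ = z.1 * _ + z.2 * (_ - jetPoly N (fun m n => mixedPartial g p m (n + 1)) _ _)
      ring
    have hbound : ∀ t ∈ Ico (0 : ℝ) 1, ‖z.1 * (partialX g (p + t • z) -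
            jetPoly N (mixedPartial (partialX g) p) (t • z).1 (t • z).2) +
          z.2 * (partialY g (p + t • z) -
            jetPoly N (mixedPartial (partialY g) p) (t • z).1 (t • z).2)‖ ≤
          (C₁ + C₂) * ‖z‖ ^ (N + 1) := by
      intro t ht
      have ht' := hseg t (Ico_subset_Icc_self ht)
      have e1 := h₁ p hp (t • z) (ht'.trans hz)
      have e2 := h₂ p hp (t • z) (ht'.trans hz)
      have e3 : ‖t • z‖ ^ N ≤ ‖z‖ ^ N := pow_le_pow_left₀ (norm_nonneg _) ht' N
      have n1 : |z.1| ≤ ‖z‖ := norm_fst_le z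
      have n2 : |z.2| ≤ ‖z‖ := norm_snd_le z
      refine (norm_add_le _ _).trans ?_
      rw [norm_mul, norm_mul, Real.norm_eq_abs, Real.norm_eq_abs, Real.norm_eq_abs,
        Real.norm_eq_abs]
      calc _ ≤ ‖z‖ * (C₁ * ‖z‖ ^ N) + ‖z‖ * (C₂ * ‖z‖ ^ N) := by
            refine add_le_add
              (mul_le_mul n1 (e1.trans ?_) (abs_nonneg _) (norm_nonneg _))
              (mul_le_mul n2 (e2.trans ?_) (abs_nonneg _) (norm_nonneg _))
            · exact mul_le_mul_of_nonneg_left e3 hC₁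
            · exact mul_le_mul_of_nonneg_left e3 hC₂
        _ = (C₁ + C₂) * ‖z‖ ^ (N + 1) := by ring
    have key := norm_image_sub_le_of_norm_deriv_le_segment_01' hderiv hbound
    simp only [one_smul, one_mul, zero_smul, add_zero, zero_mul] at key
    rw [jetPoly_zero_zero (Nat.succ_pos N)] at key
    simpa [mixedPartial] using key

/-- **Taylor's theorem**, uniformly on a compact set. -/
theorem exists_uniform_taylor_bound {U K : Set (ℝ × ℝ)} (hU : IsOpen U) (hK : IsCompact K)
    (hKU : K ⊆ U) {N : ℕ} {g : ℝ × ℝ → ℝ} (hg : ContDiffOn ℝ N g U) :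
    ∃ δ > 0, ∃ C, 0 ≤ C ∧ ∀ p ∈ K, ∀ z : ℝ × ℝ, ‖z‖ ≤ δ →
      |g (p + z) - jetPoly N (mixedPartial g p) z.1 z.2| ≤ C * ‖z‖ ^ N := by
  obtain ⟨δ, hδ, h⟩ := hK.exists_cthickening_subset_open hU hKU
  exact ⟨δ, hδ, exists_taylor_bound hU hK h N g hg⟩

/-- **Taylor's theorem** at a point. -/
theorem exists_taylor_bound_at {N : ℕ} {g : ℝ × ℝ → ℝ} {p : ℝ × ℝ} (hg : ContDiffAt ℝ N g p) :
    ∃ δ > 0, ∃ C, 0 ≤ C ∧ ∀ z : ℝ × ℝ, ‖z‖ ≤ δ →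
      |g (p + z) - jetPoly N (mixedPartial g p) z.1 z.2| ≤ C * ‖z‖ ^ N := by
  obtain ⟨V, hV, hgV⟩ := hg.contDiffOn (m := N) le_rfl (by simp)
  obtain ⟨U, hUV, hU, hpU⟩ := mem_nhds_iff.1 (mem_of_superset hV fun x hx => hx)
  obtain ⟨δ, hδ, C, hC, h⟩ := exists_uniform_taylor_bound hU (isCompact_singleton (x := p))
    (by simpa using hpU) (hgV.mono hUV)
  exact ⟨δ, hδ, C, hC, h p rfl⟩

/-! ### Interior regularity of solutions of second order elliptic equations in the plane -/

/-! ### Cutoff functions and extension by zero. -/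

section Cutoff

variable {E : Type*} [NormedAddCommGroup E] [NormedSpace ℝ E]

/-- A smooth function with compact support in `U`. -/
structure IsCutoff (U : Set E) (χ : E → ℝ) : Prop where
  contDiff : ContDiff ℝ ∞ χ
  hasCompactSupport : HasCompactSupport χ
  tsupport_subset : tsupport χ ⊆ U

omit [NormedSpace ℝ E] in
theorem tsupport_subset_tsupport {f g : E → ℝ} (h : ∀ z, z ∉ tsupport f → g z = 0) :
    tsupport g ⊆ tsupport f :=
  closure_minimal (fun z hz => by_contra fun hz' => hz (h z hz')) (isClosed_tsupport f)

/-- On the support of χ the function g is smooth, and off it the product is locally zero. Values of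
g outside U never matter. -/
theorem contDiff_cutoff_mul {U : Set E} (hU : IsOpen U) {χ g : E → ℝ} (hχ : IsCutoff U χ) {n : ℕ∞}
    (hg : ContDiffOn ℝ n g U) : ContDiff ℝ n fun z => χ z * g z := by
  rw [contDiff_iff_contDiffAt]
  intro z
  by_cases hz : z ∈ tsupport χ
  · exact (hχ.contDiff.contDiffAt.of_le (by exact_mod_cast le_top)).mul
      (hg.contDiffAt (hU.mem_nhds (hχ.tsupport_subset hz)))
  · refine (contDiffAt_const (c := (0 : ℝ))).congr_of_eventuallyEq ?_
    filter_upwards [(isClosed_tsupport χ).isOpen_compl.mem_nhds hz] with y hy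
    rw [image_eq_zero_of_notMem_tsupport hy, zero_mul]

theorem hasCompactSupport_cutoff_mul {U : Set E} {χ : E → ℝ} (hχ : IsCutoff U χ) (g : E → ℝ) :
    HasCompactSupport fun z => χ z * g z := hχ.hasCompactSupport.mul_right

theorem IsCutoff.mul {U : Set E} (hU : IsOpen U) {χ g : E → ℝ} (hχ : IsCutoff U χ)
    (hg : ContDiffOn ℝ ∞ g U) : IsCutoff U fun z => χ z * g z where
  contDiff := contDiff_cutoff_mul (n := ⊤) hU hχ hg
  hasCompactSupport := hasCompactSupport_cutoff_mul hχ g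
  tsupport_subset := (tsupport_subset_tsupport fun z hz => by
    rw [image_eq_zero_of_notMem_tsupport hz, zero_mul]).trans hχ.tsupport_subset

theorem IsCutoff.add {U : Set E} {χ η : E → ℝ} (hχ : IsCutoff U χ)
    (hη : IsCutoff U η) : IsCutoff U fun z => χ z + η z where
  contDiff := hχ.contDiff.add hη.contDiff
  hasCompactSupport := hχ.hasCompactSupport.add hη.hasCompactSupport
  tsupport_subset := by
    refine (closure_minimal ?_ ((isClosed_tsupport χ).union (isClosed_tsupport η))).trans
      (union_subset hχ.tsupport_subset hη.tsupport_subset)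
    intro z hz
    by_contra h
    rw [mem_union, not_or] at h
    refine hz ?_
    change χ z + η z = 0
    rw [image_eq_zero_of_notMem_tsupport h.1, image_eq_zero_of_notMem_tsupport h.2, add_zero]

theorem contDiff_dirDeriv {v : E} {g : E → ℝ} {n : ℕ} (hg : ContDiff ℝ (n + 1 : ℕ) g) :
    ContDiff ℝ n (dirDeriv v g) :=
  contDiff_iff_contDiffAt.2 fun _ => hg.contDiffAt.dirDeriv

theorem dirDeriv_eq_zero_of_notMem_tsupport {v z : E} {g : E → ℝ} (hz : z ∉ tsupport g) :
    dirDeriv v g z = 0 := by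
  have h : g =ᶠ[𝓝 z] fun _ => 0 := by
    filter_upwards [(isClosed_tsupport g).isOpen_compl.mem_nhds hz] with y hy
    exact image_eq_zero_of_notMem_tsupport hy
  rw [(dirDeriv_congr h).eq_of_nhds]
  simp [dirDeriv, lineDeriv]

theorem hasCompactSupport_dirDeriv {v : E} {g : E → ℝ} (hg : HasCompactSupport g) :
    HasCompactSupport (dirDeriv v g) :=
  IsCompact.of_isClosed_subset hg (isClosed_tsupport _)
    (tsupport_subset_tsupport fun _ hz => dirDeriv_eq_zero_of_notMem_tsupport hz)

theorem IsCutoff.dirDeriv {U : Set E} {χ : E → ℝ} (hχ : IsCutoff U χ) (v : E) :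
    IsCutoff U (dirDeriv v χ) where
  contDiff := contDiff_infty.2 fun _ => contDiff_dirDeriv (contDiff_infty.1 hχ.contDiff _)
  hasCompactSupport := hasCompactSupport_dirDeriv hχ.hasCompactSupport
  tsupport_subset := (tsupport_subset_tsupport fun _ hz =>
    dirDeriv_eq_zero_of_notMem_tsupport hz).trans hχ.tsupport_subset

theorem IsCutoff.const_mul {U : Set E} {χ : E → ℝ} (hχ : IsCutoff U χ) (c : ℝ) :
    IsCutoff U fun z => c * χ z where
  contDiff := contDiff_const.mul hχ.contDiff
  hasCompactSupport := hχ.hasCompactSupport.mul_left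
  tsupport_subset := (tsupport_subset_tsupport fun z hz => by
    rw [image_eq_zero_of_notMem_tsupport hz, mul_zero]).trans hχ.tsupport_subset

end Cutoff

/-! ### Fourier decay and the elliptic bootstrap. -/

section Regularity

open scoped FourierTransform RealInnerProductSpace

/-- The Fourier transform of a real valued function in the plane. -/
def planeFourier (g : ℂ → ℝ) : ℂ → ℂ := 𝓕 fun z => (g z : ℂ)

theorem integrable_ofReal_of_hasCompactSupport {g : ℂ → ℝ} (hg : Continuous g)
    (hs : HasCompactSupport g) : MeasureTheory.Integrable fun z => (g z : ℂ) :=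
  (hg.integrable_of_hasCompactSupport hs).ofReal

theorem planeFourier_add {f g : ℂ → ℝ} (hf : Continuous f) (hfs : HasCompactSupport f)
    (hg : Continuous g) (hgs : HasCompactSupport g) (ξ : ℂ) :
    planeFourier (fun z => f z + g z) ξ = planeFourier f ξ + planeFourier g ξ := by
  have := VectorFourier.fourierIntegral_add (L := innerₗ ℂ) Real.continuous_fourierChar
    (by exact continuous_inner) (integrable_ofReal_of_hasCompactSupport hf hfs)
    (integrable_ofReal_of_hasCompactSupport hg hgs)
  have h2 := congrFun this ξ
  simp only [planeFourier, Complex.ofReal_add]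
  exact h2

theorem planeFourier_dirDeriv {g : ℂ → ℝ} (hg : ContDiff ℝ 1 g) (hs : HasCompactSupport g)
    (v ξ : ℂ) : planeFourier (dirDeriv v g) ξ = 2 * Real.pi * Complex.I * ⟪v, ξ⟫ * planeFourier g ξ := by
  have hd : Differentiable ℝ fun z => (g z : ℂ) := by
    have := hg.differentiable (by simp)
    exact Complex.ofRealCLM.differentiable.comp this
  have hc : ContDiff ℝ 1 fun z => (g z : ℂ) := Complex.ofRealCLM.contDiff.comp hg
  have hs' : HasCompactSupport fun z => (g z : ℂ) := hs.comp_left (g := Complex.ofReal) rfl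
  have hi : MeasureTheory.Integrable (fderiv ℝ fun z => (g z : ℂ)) :=
    (hc.continuous_fderiv (by simp)).integrable_of_hasCompactSupport (hs'.fderiv ℝ)
  have h := Real.fourier_fderiv (integrable_ofReal_of_hasCompactSupport hg.continuous hs) hd hi
  have h1 : (fun z => (dirDeriv v g z : ℂ)) = fun z => fderiv ℝ (fun z => (g z : ℂ)) z v := by
    funext z
    have hgd : DifferentiableAt ℝ g z := hg.differentiable (by simp) z
    rw [dirDeriv, hgd.lineDeriv_eq_fderiv]
    have := Complex.ofRealCLM.hasFDerivAt.comp z hgd.hasFDerivAt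
    rw [HasFDerivAt.fderiv (f := fun z => (g z : ℂ)) this]
    rfl
  rw [planeFourier, h1, ← Real.fourier_continuousLinearMap_apply hi, h]
  have hinner : innerSL ℝ ξ v = ⟪v, ξ⟫ :=
    (innerSL_apply_apply ℝ ξ v).trans (real_inner_comm _ _)
  simp only [VectorFourier.fourierSMulRight_apply, planeFourier, neg_apply, neg_smul,
    hinner, Complex.real_smul, smul_eq_mul]
  ring

theorem norm_planeFourier_le (g : ℂ → ℝ) : ∃ C, ∀ ξ, ‖planeFourier g ξ‖ ≤ C :=
  ⟨_, fun ξ => VectorFourier.norm_fourierIntegral_le_integral_norm _ _ _ _ ξ⟩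

/-- The Fourier transform of `g` decays at infinity like the power `-s`. -/
def FourierDecay (s : ℕ) (g : ℂ → ℝ) : Prop :=
  ∃ C, 0 ≤ C ∧ ∀ ξ : ℂ, 1 ≤ ‖ξ‖ → ‖ξ‖ ^ s * ‖planeFourier g ξ‖ ≤ C

theorem IsCutoff.fourierDecay {U : Set ℂ} {χ : ℂ → ℝ} (hχ : IsCutoff U χ) (s : ℕ) :
    FourierDecay s χ := by
  have hc : ContDiff ℝ ∞ fun z => (χ z : ℂ) := Complex.ofRealCLM.contDiff.comp hχ.contDiff
  have hs' : HasCompactSupport fun z => (χ z : ℂ) :=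
    hχ.hasCompactSupport.comp_left (g := Complex.ofReal) rfl
  obtain ⟨C, hC⟩ := (𝓕 (hs'.toSchwartzMap hc)).decay s 0
  refine ⟨C, hC.1.le, fun ξ _ => ?_⟩
  have := hC.2 ξ
  rw [norm_iteratedFDeriv_zero] at this
  exact this

theorem dirDeriv_dirDeriv_mul {E : Type*} [NormedAddCommGroup E] [NormedSpace ℝ E] {v z : E}
    {f g : E → ℝ} (hf : ContDiffAt ℝ 2 f z) (hg : ContDiffAt ℝ 2 g z) :
    dirDeriv v (dirDeriv v fun y => f y * g y) z = dirDeriv v (dirDeriv v f) z * g z +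
      2 * (dirDeriv v f z * dirDeriv v g z) + f z * dirDeriv v (dirDeriv v g) z := by
  have hf1 : ContDiffAt ℝ (0 + 1 : ℕ) f z := hf.of_le (by norm_cast)
  have hg1 : ContDiffAt ℝ (0 + 1 : ℕ) g z := hg.of_le (by norm_cast)
  have hf' : ContDiffAt ℝ (0 + 1 : ℕ) (dirDeriv v f) z := ContDiffAt.dirDeriv (n := 1) hf
  have hg' : ContDiffAt ℝ (0 + 1 : ℕ) (dirDeriv v g) z := ContDiffAt.dirDeriv (n := 1) hg
  rw [(dirDeriv_congr (dirDeriv_mul (v := v) (n := 1) hf hg)).eq_of_nhds,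
    (dirDeriv_add (hf'.mul hg1) (hf1.mul hg')).eq_of_nhds, (dirDeriv_mul hf' hg1).eq_of_nhds,
    (dirDeriv_mul hf1 hg').eq_of_nhds]
  ring

/-- The Laplacian of χ u can be written as a smooth cutoff plus first derivatives of cutoffs times u
plus a cutoff times u. Under the Fourier transform the left side carries |ξ|^2 and the right side at
most |ξ|, so one power of decay is gained. The hypothesis ranges over all cutoffs because the right
side involves new ones built from χ, b₁ and b₂. -/
theorem fourierDecay_succ {U : Set ℂ} (hU : IsOpen U) {u f b₁ b₂ : ℂ → ℝ}
    (hu : ContDiffOn ℝ 2 u U) (hf : ContDiffOn ℝ ∞ f U) (hb₁ : ContDiffOn ℝ ∞ b₁ U)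
    (hb₂ : ContDiffOn ℝ ∞ b₂ U)
    (hpde : ∀ z ∈ U, dirDeriv 1 (dirDeriv 1 u) z + dirDeriv Complex.I (dirDeriv Complex.I u) z =
      -(f z + b₁ z * dirDeriv 1 u z + b₂ z * dirDeriv Complex.I u z)) {s : ℕ}
    (hs : ∀ χ, IsCutoff U χ → FourierDecay s fun z => χ z * u z) {χ : ℂ → ℝ}
    (hχ : IsCutoff U χ) : FourierDecay (s + 1) fun z => χ z * u z := by
  set v : ℂ → ℝ := fun z => χ z * u z with hv
  have hvc : ContDiff ℝ 2 v := contDiff_cutoff_mul (n := 2) hU hχ hu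
  have hvs : HasCompactSupport v := hasCompactSupport_cutoff_mul hχ u
  set F₀ : ℂ → ℝ := fun z => -1 * (χ z * f z)
  have hF₀ : IsCutoff U F₀ := (hχ.mul hU hf).const_mul (-1)
  set B₁ : ℂ → ℝ := fun z => 2 * dirDeriv 1 χ z + -1 * (χ z * b₁ z)
  have hB₁ : IsCutoff U B₁ := ((hχ.dirDeriv 1).const_mul 2).add ((hχ.mul hU hb₁).const_mul (-1))
  set B₂ : ℂ → ℝ := fun z => 2 * dirDeriv Complex.I χ z + -1 * (χ z * b₂ z)
  have hB₂ : IsCutoff U B₂ :=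
    ((hχ.dirDeriv Complex.I).const_mul 2).add ((hχ.mul hU hb₂).const_mul (-1))
  -- All derivatives of u are moved into ∂(B₁ u) and ∂(B₂ u); `c` collects the zeroth-order terms
  -- left by the product rule, namely the divergence of χ b minus Δχ.
  set c : ℂ → ℝ := fun z => dirDeriv 1 (fun z => χ z * b₁ z) z +
    dirDeriv Complex.I (fun z => χ z * b₂ z) z +
    -1 * (dirDeriv 1 (dirDeriv 1 χ) z + dirDeriv Complex.I (dirDeriv Complex.I χ) z)
  have hc : IsCutoff U c := (((hχ.mul hU hb₁).dirDeriv 1).add ((hχ.mul hU hb₂).dirDeriv _)).add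
    ((((hχ.dirDeriv 1).dirDeriv 1).add ((hχ.dirDeriv _).dirDeriv _)).const_mul (-1))
  have hB₁u : ContDiff ℝ 2 fun z => B₁ z * u z := contDiff_cutoff_mul (n := 2) hU hB₁ hu
  have hB₂u : ContDiff ℝ 2 fun z => B₂ z * u z := contDiff_cutoff_mul (n := 2) hU hB₂ hu
  have hcu : ContDiff ℝ 2 fun z => c z * u z := contDiff_cutoff_mul (n := 2) hU hc hu
  have key : ∀ z, dirDeriv 1 (dirDeriv 1 v) z + dirDeriv Complex.I (dirDeriv Complex.I v) z =
      F₀ z + (dirDeriv 1 (fun z => B₁ z * u z) z + (dirDeriv Complex.I (fun z => B₂ z * u z) z +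
        c z * u z)) := by
    intro z
    by_cases hz : z ∈ U
    · have hχ2 : ContDiffAt ℝ 2 χ z := (contDiff_infty.1 hχ.contDiff 2).contDiffAt
      have hu2 : ContDiffAt ℝ 2 u z := hu.contDiffAt (hU.mem_nhds hz)
      have hu1 : ContDiffAt ℝ (0 + 1 : ℕ) u z := hu2.of_le (by norm_cast)
      have hs1 : ∀ {g : ℂ → ℝ}, IsCutoff U g → ContDiffAt ℝ (0 + 1 : ℕ) g z := fun hg =>
        (contDiff_infty.1 hg.contDiff 1).contDiffAt
      rw [hv, dirDeriv_dirDeriv_mul hχ2 hu2, dirDeriv_dirDeriv_mul hχ2 hu2,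
        (dirDeriv_mul (hs1 hB₁) hu1).eq_of_nhds, (dirDeriv_mul (hs1 hB₂) hu1).eq_of_nhds,
        (dirDeriv_add (hs1 ((hχ.dirDeriv 1).const_mul 2))
          (hs1 ((hχ.mul hU hb₁).const_mul (-1)))).eq_of_nhds,
        (dirDeriv_add (hs1 ((hχ.dirDeriv Complex.I).const_mul 2))
          (hs1 ((hχ.mul hU hb₂).const_mul (-1)))).eq_of_nhds,
        (dirDeriv_const_mul _ (hs1 (hχ.dirDeriv 1))).eq_of_nhds,
        (dirDeriv_const_mul _ (hs1 (hχ.dirDeriv Complex.I))).eq_of_nhds,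
        (dirDeriv_const_mul _ (hs1 (hχ.mul hU hb₁))).eq_of_nhds,
        (dirDeriv_const_mul _ (hs1 (hχ.mul hU hb₂))).eq_of_nhds]
      simp only [F₀, B₁, B₂, c]
      linear_combination χ z * hpde z hz
    · have h0 : ∀ {g : ℂ → ℝ}, tsupport g ⊆ U → g z = 0 := fun hg =>
        image_eq_zero_of_notMem_tsupport fun h => hz (hg h)
      have hd : ∀ {g : ℂ → ℝ} (w : ℂ), tsupport g ⊆ U → tsupport (dirDeriv w g) ⊆ U :=
        fun w hg => (tsupport_subset_tsupport fun _ h =>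
          dirDeriv_eq_zero_of_notMem_tsupport h).trans hg
      have hm : ∀ {g : ℂ → ℝ}, IsCutoff U g → tsupport (fun z => g z * u z) ⊆ U := fun hg =>
        (tsupport_subset_tsupport fun y hy => by
          rw [image_eq_zero_of_notMem_tsupport hy, zero_mul]).trans hg.tsupport_subset
      rw [h0 (hd 1 (hd 1 (hm hχ))), h0 (hd Complex.I (hd Complex.I (hm hχ))),
        h0 hF₀.tsupport_subset, h0 (hd 1 (hm hB₁)), h0 (hd Complex.I (hm hB₂)), h0 (hm hc)]
      simp
  have cd1 : ∀ {g : ℂ → ℝ} (w : ℂ), ContDiff ℝ 2 g → ContDiff ℝ 1 (dirDeriv w g) :=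
    fun w hg => contDiff_dirDeriv (n := 1) hg
  have le2 : ∀ {g : ℂ → ℝ}, ContDiff ℝ 2 g → ContDiff ℝ 1 g := fun hg => hg.of_le (by norm_num)
  obtain ⟨C₀, hC₀, h₀⟩ := hF₀.fourierDecay s
  obtain ⟨C₁, hC₁, h₁⟩ := hs B₁ hB₁
  obtain ⟨C₂, hC₂, h₂⟩ := hs B₂ hB₂
  obtain ⟨C₃, hC₃, h₃⟩ := hs c hc
  refine ⟨C₀ + 2 * Real.pi * C₁ + 2 * Real.pi * C₂ + C₃, by positivity, fun ξ hξ => ?_⟩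
  have hB₁s := hasCompactSupport_cutoff_mul hB₁ u
  have hB₂s := hasCompactSupport_cutoff_mul hB₂ u
  have hcs := hasCompactSupport_cutoff_mul hc u
  have hL : planeFourier (fun z => dirDeriv 1 (dirDeriv 1 v) z +
      dirDeriv Complex.I (dirDeriv Complex.I v) z) ξ =
      -(4 * Real.pi ^ 2 * ‖ξ‖ ^ 2 : ℝ) * planeFourier v ξ := by
    rw [planeFourier_add (contDiff_dirDeriv (n := 0) (cd1 1 hvc)).continuous
      (hasCompactSupport_dirDeriv (hasCompactSupport_dirDeriv hvs))
      (contDiff_dirDeriv (n := 0) (cd1 Complex.I hvc)).continuous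
      (hasCompactSupport_dirDeriv (hasCompactSupport_dirDeriv hvs)),
      planeFourier_dirDeriv (cd1 1 hvc) (hasCompactSupport_dirDeriv hvs),
      planeFourier_dirDeriv (le2 hvc) hvs,
      planeFourier_dirDeriv (cd1 Complex.I hvc) (hasCompactSupport_dirDeriv hvs),
      planeFourier_dirDeriv (le2 hvc) hvs, Complex.sq_norm, Complex.normSq_apply]
    have i1 : ⟪(1 : ℂ), ξ⟫ = ξ.re := by simp [Complex.inner]
    have i2 : ⟪Complex.I, ξ⟫ = ξ.im := by simp [Complex.inner]
    rw [i1, i2]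
    push_cast
    linear_combination (4 * (Real.pi : ℂ) ^ 2 * (ξ.re ^ 2 + ξ.im ^ 2) * planeFourier v ξ) *
      Complex.I_sq
  have hR : planeFourier (fun z => dirDeriv 1 (dirDeriv 1 v) z +
      dirDeriv Complex.I (dirDeriv Complex.I v) z) ξ =
      planeFourier F₀ ξ + (2 * Real.pi * Complex.I * ⟪(1 : ℂ), ξ⟫ *
        planeFourier (fun z => B₁ z * u z) ξ + (2 * Real.pi * Complex.I * ⟪Complex.I, ξ⟫ *
        planeFourier (fun z => B₂ z * u z) ξ + planeFourier (fun z => c z * u z) ξ)) := by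
    have e1 := (cd1 1 hB₁u).continuous
    have e2 := (cd1 Complex.I hB₂u).continuous
    have s1 := hasCompactSupport_dirDeriv (v := (1 : ℂ)) hB₁s
    have s2 := hasCompactSupport_dirDeriv (v := Complex.I) hB₂s
    rw [funext key, planeFourier_add (g := fun z => dirDeriv 1 (fun z => B₁ z * u z) z +
      (dirDeriv Complex.I (fun z => B₂ z * u z) z + c z * u z)) hF₀.contDiff.continuous
      hF₀.hasCompactSupport (e1.add (e2.add hcu.continuous)) (s1.add (s2.add hcs)),
      planeFourier_add (g := fun z => dirDeriv Complex.I (fun z => B₂ z * u z) z + c z * u z)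
      e1 s1 (e2.add hcu.continuous) (s2.add hcs),
      planeFourier_add e2 s2 hcu.continuous hcs, planeFourier_dirDeriv (le2 hB₁u) hB₁s,
      planeFourier_dirDeriv (le2 hB₂u) hB₂s]
  have hn := congrArg norm (hL.symm.trans hR)
  have hπ := Real.pi_gt_three
  have hin : ∀ w : ℂ, ‖w‖ = 1 → ‖(2 * Real.pi * Complex.I * ⟪w, ξ⟫ : ℂ)‖ ≤ 2 * Real.pi * ‖ξ‖ := by
    intro w hw
    have := norm_inner_le_norm (𝕜 := ℝ) w ξ
    rw [hw, one_mul] at this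
    rw [norm_mul, norm_mul, norm_mul, Complex.norm_I, Complex.norm_real, Complex.norm_real,
      Real.norm_of_nonneg Real.pi_pos.le, Complex.norm_ofNat, mul_one]
    gcongr
  rw [norm_mul, norm_neg, Complex.norm_real, Real.norm_of_nonneg (by positivity)] at hn
  set x := ‖ξ‖
  set w := ‖planeFourier v ξ‖
  have hx0 : 0 ≤ x ^ s := by positivity
  have hw0 : 0 ≤ w := norm_nonneg _
  have hle : 4 * Real.pi ^ 2 * x ^ 2 * w ≤ ‖planeFourier F₀ ξ‖ +
      (2 * Real.pi * x * ‖planeFourier (fun z => B₁ z * u z) ξ‖ +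
      (2 * Real.pi * x * ‖planeFourier (fun z => B₂ z * u z) ξ‖ +
        ‖planeFourier (fun z => c z * u z) ξ‖)) := by
    rw [hn]
    refine (norm_add_le _ _).trans (add_le_add_right ((norm_add_le _ _).trans (add_le_add ?_
      ((norm_add_le _ _).trans (add_le_add ?_ le_rfl)))) _)
    · rw [norm_mul]
      exact mul_le_mul_of_nonneg_right (hin 1 (by simp)) (norm_nonneg _)
    · rw [norm_mul]
      exact mul_le_mul_of_nonneg_right (hin Complex.I (by simp)) (norm_nonneg _)
  -- Multiply by x^s and use the decay of each term; 1 ≤ x lets the terms without a factor x be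
  -- absorbed, and the common factor x is cancelled at the end.
  have hle2 : x * (x ^ (s + 1) * w) ≤
      x * (C₀ + 2 * Real.pi * C₁ + 2 * Real.pi * C₂ + C₃) := by
    have e0 := h₀ ξ hξ
    have e1 := h₁ ξ hξ
    have e2 := h₂ ξ hξ
    have e3 := h₃ ξ hξ
    calc x * (x ^ (s + 1) * w) = 1 * (x ^ s * (x ^ 2 * w)) := by ring
      _ ≤ 4 * Real.pi ^ 2 * (x ^ s * (x ^ 2 * w)) := by
        refine mul_le_mul_of_nonneg_right ?_ (by positivity)
        nlinarith
      _ = x ^ s * (4 * Real.pi ^ 2 * x ^ 2 * w) := by ring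
      _ ≤ _ := mul_le_mul_of_nonneg_left hle hx0
      _ = x ^ s * ‖planeFourier F₀ ξ‖ +
          (2 * Real.pi * x * (x ^ s * ‖planeFourier (fun z => B₁ z * u z) ξ‖) +
          (2 * Real.pi * x * (x ^ s * ‖planeFourier (fun z => B₂ z * u z) ξ‖) +
          x ^ s * ‖planeFourier (fun z => c z * u z) ξ‖)) := by ring
      _ ≤ C₀ + (2 * Real.pi * x * C₁ + (2 * Real.pi * x * C₂ + C₃)) := by gcongr
      _ ≤ x * C₀ + (2 * Real.pi * x * C₁ + (2 * Real.pi * x * C₂ + x * C₃)) := by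
        gcongr
        · exact le_mul_of_one_le_left hC₀ hξ
        · exact le_mul_of_one_le_left hC₃ hξ
      _ = _ := by ring
  exact le_of_mul_le_mul_left hle2 (by linarith)

/-- The extra exponent 3 exceeds the dimension 2, so |ξ|^k times the transform is integrable for k ≤
n. Fourier inversion then writes g as the transform of a function with integrable moments, which may
be differentiated n times under the integral. -/
theorem contDiff_of_fourierDecay {g : ℂ → ℝ} (hg : Continuous g) (hgs : HasCompactSupport g)
    {n : ℕ} (h : FourierDecay (n + 3) g) : ContDiff ℝ n g := by
  obtain ⟨C, hC, hd⟩ := h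
  obtain ⟨C', hC'⟩ := norm_planeFourier_le g
  have hgi := integrable_ofReal_of_hasCompactSupport hg hgs
  have hcont : Continuous (planeFourier g) :=
    VectorFourier.fourierIntegral_continuous (L := innerₗ ℂ) Real.continuous_fourierChar
      (by exact continuous_inner) hgi
  have hC'0 : 0 ≤ C' := (norm_nonneg _).trans (hC' 0)
  have hbound : ∀ k ≤ n, ∀ ξ : ℂ, ‖ξ‖ ^ k * ‖planeFourier g ξ‖ ≤
      (2 ^ 3 * (C + C')) * (1 + ‖ξ‖) ^ (-(3 : ℝ)) := by
    intro k hk ξ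
    rw [Real.rpow_neg (by positivity), ← div_eq_mul_inv, le_div_iff₀ (by positivity),
      show (3 : ℝ) = ((3 : ℕ) : ℝ) by norm_num, Real.rpow_natCast]
    rcases le_total 1 ‖ξ‖ with hξ | hξ
    · calc ‖ξ‖ ^ k * ‖planeFourier g ξ‖ * (1 + ‖ξ‖) ^ 3
          ≤ ‖ξ‖ ^ n * ‖planeFourier g ξ‖ * (‖ξ‖ + ‖ξ‖) ^ 3 := by gcongr
        _ = 2 ^ 3 * (‖ξ‖ ^ (n + 3) * ‖planeFourier g ξ‖) := by ring
        _ ≤ 2 ^ 3 * C := by gcongr; exact hd ξ hξ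
        _ ≤ 2 ^ 3 * (C + C') := by linarith
    · calc ‖ξ‖ ^ k * ‖planeFourier g ξ‖ * (1 + ‖ξ‖) ^ 3
          ≤ 1 * C' * (1 + 1) ^ 3 := by
            gcongr
            · exact pow_le_one₀ (norm_nonneg _) hξ
            · exact hC' ξ
        _ ≤ 2 ^ 3 * (C + C') := by linarith
  have hint : ∀ k ≤ n, MeasureTheory.Integrable fun ξ : ℂ => ‖ξ‖ ^ k * ‖planeFourier g ξ‖ := by
    intro k hk
    have hj : MeasureTheory.Integrable fun ξ : ℂ => (1 + ‖ξ‖) ^ (-(3 : ℝ)) :=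
      integrable_one_add_norm (by rw [Complex.finrank_real_complex]; norm_num)
    refine (hj.const_mul (2 ^ 3 * (C + C'))).mono' (by fun_prop) (Eventually.of_forall fun ξ => ?_)
    rw [Real.norm_of_nonneg (by positivity)]
    exact hbound k hk ξ
  have hFi : MeasureTheory.Integrable (planeFourier g) := by
    refine (hint 0 (Nat.zero_le n)).mono' hcont.aestronglyMeasurable
      (Eventually.of_forall fun ξ => ?_)
    simp
  have hinv := Continuous.fourierInv_fourier_eq (Complex.continuous_ofReal.comp hg) hgi hFi
  have hsm : ContDiff ℝ n (𝓕 (planeFourier g)) :=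
    Real.contDiff_fourier (N := n) fun k hk => hint k (by exact_mod_cast hk)
  have heq : g = fun z => (𝓕 (planeFourier g) (-z)).re := by
    funext z
    have := congrFun hinv z
    rw [Real.fourierInv_eq_fourier_neg] at this
    exact (congrArg Complex.re this).symm
  rw [heq]
  exact Complex.reCLM.contDiff.comp (hsm.comp contDiff_neg)

/-- The bootstrap starts from the bounded transform of an integrable function. Smoothness near z is
recovered by dividing χ u by a cutoff χ that does not vanish near z. -/
theorem contDiffOn_of_elliptic {U : Set ℂ} (hU : IsOpen U) {u f b₁ b₂ : ℂ → ℝ}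
    (hu : ContDiffOn ℝ 2 u U) (hf : ContDiffOn ℝ ∞ f U) (hb₁ : ContDiffOn ℝ ∞ b₁ U)
    (hb₂ : ContDiffOn ℝ ∞ b₂ U)
    (hpde : ∀ z ∈ U, dirDeriv 1 (dirDeriv 1 u) z + dirDeriv Complex.I (dirDeriv Complex.I u) z =
      -(f z + b₁ z * dirDeriv 1 u z + b₂ z * dirDeriv Complex.I u z)) :
    ContDiffOn ℝ ∞ u U := by
  have hdecay : ∀ s χ, IsCutoff U χ → FourierDecay s fun z => χ z * u z := by
    intro s
    induction s with
    | zero =>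
      intro χ _
      obtain ⟨C, hC⟩ := norm_planeFourier_le fun z => χ z * u z
      refine ⟨C, (norm_nonneg _).trans (hC 0), fun ξ _ => ?_⟩
      rw [pow_zero, one_mul]
      exact hC ξ
    | succ s ih => exact fun χ hχ => fourierDecay_succ hU hu hf hb₁ hb₂ hpde ih hχ
  rw [contDiffOn_infty]
  intro n z hz
  obtain ⟨χ, hχ₁, hχ₂, hχ₃, -, hχ₅⟩ := exists_contDiff_tsupport_subset (n := ⊤) (hU.mem_nhds hz)
  have hχ : IsCutoff U χ := ⟨hχ₃, hχ₂, hχ₁⟩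
  have hcont : Continuous fun z => χ z * u z := (contDiff_cutoff_mul (n := 2) hU hχ hu).continuous
  have h := contDiff_of_fourierDecay hcont (hasCompactSupport_cutoff_mul hχ u)
    (hdecay (n + 3) χ hχ)
  have hq : ContDiffAt ℝ n (fun z => χ z * u z / χ z) z :=
    h.contDiffAt.div (hχ₃.contDiffAt.of_le (by exact_mod_cast le_top)) (by rw [hχ₅]; norm_num)
  refine (hq.congr_of_eventuallyEq ?_).contDiffWithinAt
  have hne : ∀ᶠ y in 𝓝 z, χ y ≠ 0 :=
    hχ₃.continuous.continuousAt.eventually_ne (by rw [hχ₅]; norm_num)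
  filter_upwards [hne] with y hy
  field_simp

theorem dirDeriv_comp_equivRealProd (u : ℝ × ℝ → ℝ) (w : ℂ) :
    dirDeriv w (fun z => u (Complex.equivRealProdCLM z)) =
      fun z => dirDeriv (Complex.equivRealProdCLM w) u (Complex.equivRealProdCLM z) := by
  funext z
  simp only [dirDeriv, lineDeriv, map_add, map_smul]

/-- Interior regularity for the operator `-∇ · (a ∇u)`. -/
theorem contDiffOn_of_ellipticOp {U : Set (ℝ × ℝ)} (hU : IsOpen U) {a f u : ℝ × ℝ → ℝ}
    (ha : ContDiffOn ℝ ∞ a U) (ha0 : ∀ q ∈ U, a q ≠ 0) (hf : ContDiffOn ℝ ∞ f U)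
    (hu : ContDiffOn ℝ 2 u U) (h : ∀ q ∈ U, ellipticOp a u q = f q) : ContDiffOn ℝ ∞ u U := by
  -- The norm of ℝ × ℝ is the maximum norm. The Fourier argument needs an inner product space, so
  -- the equation is transported to ℂ and divided by a.
  set e := Complex.equivRealProdCLM with he
  have hV : IsOpen (e ⁻¹' U) := hU.preimage e.continuous
  have hcomp : ∀ {n : ℕ∞ω} {g : ℝ × ℝ → ℝ}, ContDiffOn ℝ n g U →
      ContDiffOn ℝ n (fun z => g (e z)) (e ⁻¹' U) := fun hg =>
    hg.comp e.contDiff.contDiffOn fun _ hz => hz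
  have hax : ContDiffOn ℝ ∞ (partialX a) U :=
    contDiffOn_infty.2 fun n => ContDiffOn.partialX hU (contDiffOn_infty.1 ha (n + 1))
  have hay : ContDiffOn ℝ ∞ (partialY a) U :=
    contDiffOn_infty.2 fun n => ContDiffOn.partialY hU (contDiffOn_infty.1 ha (n + 1))
  have h1 : e 1 = (1, 0) := by simp [he]
  have hI : e Complex.I = (0, 1) := by simp [he]
  have key := contDiffOn_of_elliptic hV (hcomp hu) (hcomp (hf.div ha ha0)) (hcomp (hax.div ha ha0))
    (hcomp (hay.div ha ha0)) (by
      intro z hz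
      have hz' : e z ∈ U := hz
      simp only [he, dirDeriv_comp_equivRealProd]
      rw [← he, h1, hI]
      have hp := h _ hz'
      rw [(ellipticOp_eventuallyEq ((ha.contDiffAt (hU.mem_nhds hz')).of_le
        (by exact_mod_cast le_top)) (hu.contDiffAt (hU.mem_nhds hz'))).eq_of_nhds] at hp
      simp only [partialX_eq_dirDeriv, partialY_eq_dirDeriv, Pi.div_apply] at hp ⊢
      have := ha0 _ hz'
      field_simp
      linear_combination -hp)
  have := key.comp (e.symm.contDiff.contDiffOn (s := U)) fun q hq => by simpa using hq
  simpa [Function.comp_def] using this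

end Regularity

/-! ### Nine-point stencils -/

/-- The weights of a nine-point stencil, listed row by row. -/
def nineWeights (a b c d e f g h i : ℝ) : ℤ → ℤ → ℝ
  | -1, -1 => a
  | -1, 0 => b
  | -1, 1 => c
  | 0, -1 => d
  | 0, 0 => e
  | 0, 1 => f
  | 1, -1 => g
  | 1, 0 => h
  | 1, 1 => i
  | _, _ => 0

theorem sum_offsets (g : ℤ → ℝ) : ∑ k ∈ offsets, g k = g (-1) + g 0 + g 1 := by
  simp [offsets, add_assoc]

theorem mem_offsets {k : ℤ} : k ∈ offsets ↔ k = -1 ∨ k = 0 ∨ k = 1 := by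
  simp [offsets]

theorem abs_le_one_of_mem_offsets {k : ℤ} (hk : k ∈ offsets) : |(k : ℝ)| ≤ 1 := by
  rcases mem_offsets.1 hk with rfl | rfl | rfl <;> simp

theorem continuousOn_nineWeights {T : Type*} [TopologicalSpace T] {s : Set T}
    {a b c d e f g h i : T → ℝ} (ha : ContinuousOn a s) (hb : ContinuousOn b s)
    (hc : ContinuousOn c s) (hd : ContinuousOn d s) (he : ContinuousOn e s)
    (hf : ContinuousOn f s) (hg : ContinuousOn g s) (hh : ContinuousOn h s)
    (hi : ContinuousOn i s) (k l : ℤ) :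
    ContinuousOn
      (fun t => nineWeights (a t) (b t) (c t) (d t) (e t) (f t) (g t) (h t) (i t) k l) s := by
  unfold nineWeights
  split <;> first | assumption | exact continuousOn_const

/-- The coefficient of `h ^ N` when the stencil `∑ h ^ j c j` is applied to the polynomial with
derivatives `J`. -/
def stencilMoment (c : ℕ → ℤ → ℤ → ℝ) (J : ℕ → ℕ → ℝ) (N : ℕ) : ℝ :=
  ∑ q ∈ indicesBelow (N + 1), ∑ k ∈ offsets, ∑ l ∈ offsets,
    c (N - (q.1 + q.2)) k l * (J q.1 q.2 * (k : ℝ) ^ q.1 * (l : ℝ) ^ q.2 /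
      ((q.1.factorial : ℝ) * (q.2.factorial : ℝ)))

/-- Multiply the finite sums out and sort by total power of h. Powers below N₀ give exactly the
moments, since N₀ ≤ L makes every contributing pair available; each other term is bounded by a
constant times h^N₀ because h ≤ 1. The constant depends only on bounds for the weights and the jet,
as uniformity in the base point requires. -/
theorem exists_stencil_expansion_bound (L N₀ : ℕ) (hN : N₀ ≤ L) {M₁ M₂ : ℝ} (hM₁ : 0 ≤ M₁)
    (hM₂ : 0 ≤ M₂) : ∃ B, 0 ≤ B ∧ ∀ (c : ℕ → ℤ → ℤ → ℝ) (J : ℕ → ℕ → ℝ) (h : ℝ),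
      (∀ j < L, ∀ k ∈ offsets, ∀ l ∈ offsets, |c j k l| ≤ M₁) → (∀ m n, m + n < L → |J m n| ≤ M₂) → 0 ≤ h → h ≤ 1 →
      |∑ k ∈ offsets, ∑ l ∈ offsets,
          (∑ j ∈ Finset.range L, h ^ j * c j k l) * jetPoly L J (k * h) (l * h)
        - ∑ N ∈ Finset.range N₀, h ^ N * stencilMoment c J N| ≤ B * h ^ N₀ := by
  set I := Finset.range L ×ˢ indicesBelow L with hI
  refine ⟨∑ x ∈ I, ∑ k ∈ offsets, ∑ l ∈ offsets, M₁ * M₂,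
    Finset.sum_nonneg fun _ _ => Finset.sum_nonneg fun _ _ => Finset.sum_nonneg fun _ _ =>
      mul_nonneg hM₁ hM₂, ?_⟩
  intro c J h hc hJ h0 h1
  set W : ℕ × (ℕ × ℕ) → ℝ := fun x => ∑ k ∈ offsets, ∑ l ∈ offsets,
    c x.1 k l * (J x.2.1 x.2.2 * (k : ℝ) ^ x.2.1 * (l : ℝ) ^ x.2.2 /
      ((x.2.1.factorial : ℝ) * (x.2.2.factorial : ℝ))) with hW
  have e1 : ∑ k ∈ offsets, ∑ l ∈ offsets,
      (∑ j ∈ Finset.range L, h ^ j * c j k l) * jetPoly L J (k * h) (l * h) =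
      ∑ x ∈ I, h ^ (x.1 + (x.2.1 + x.2.2)) * W x := by
    simp only [hW, Finset.mul_sum]
    rw [Finset.sum_comm (s := I)]
    refine Finset.sum_congr rfl fun k _ => ?_
    rw [Finset.sum_comm (s := I)]
    refine Finset.sum_congr rfl fun l _ => ?_
    rw [jetPoly, Finset.sum_mul_sum, ← Finset.sum_product']
    refine Finset.sum_congr rfl fun x _ => ?_
    rw [mul_pow, mul_pow, pow_add, pow_add]
    ring
  have e2 : ∑ x ∈ I with x.1 + (x.2.1 + x.2.2) < N₀, h ^ (x.1 + (x.2.1 + x.2.2)) * W x =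
      ∑ N ∈ Finset.range N₀, h ^ N * stencilMoment c J N := by
    rw [← Finset.sum_fiberwise_of_maps_to (t := Finset.range N₀)
      (g := fun x : ℕ × (ℕ × ℕ) => x.1 + (x.2.1 + x.2.2))
      (by intro x hx; simpa using (Finset.mem_filter.1 hx).2)]
    refine Finset.sum_congr rfl fun N hNr => ?_
    have hN' := Finset.mem_range.1 hNr
    rw [stencilMoment, Finset.mul_sum]
    refine Finset.sum_bij' (fun x _ => x.2) (fun q _ => (N - (q.1 + q.2), q)) ?_ ?_ ?_ ?_ ?_
    · intro x hx
      simp only [Finset.mem_filter] at hx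
      rw [mem_indicesBelow]
      omega
    · intro q hq
      rw [mem_indicesBelow] at hq
      simp only [Finset.mem_filter, hI, Finset.mem_product, Finset.mem_range, mem_indicesBelow]
      omega
    · intro x hx
      simp only [Finset.mem_filter] at hx
      ext <;> simp
      omega
    · intros; rfl
    · intro x hx
      simp only [Finset.mem_filter] at hx
      rw [hx.2, hW]
      dsimp only
      rw [show N - (x.2.1 + x.2.2) = x.1 by omega]
  rw [e1, ← Finset.sum_filter_add_sum_filter_not I fun x => x.1 + (x.2.1 + x.2.2) < N₀, e2,
    add_sub_cancel_left]
  refine (Finset.abs_sum_le_sum_abs _ _).trans ?_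
  rw [Finset.sum_mul]
  refine (Finset.sum_le_sum (g := fun _ => (∑ k ∈ offsets, ∑ l ∈ offsets, M₁ * M₂) * h ^ N₀)
    fun x hx => ?_).trans
    (Finset.sum_le_sum_of_subset_of_nonneg (Finset.filter_subset _ _) fun _ _ _ => by positivity)
  simp only [Finset.mem_filter, hI, Finset.mem_product, Finset.mem_range, mem_indicesBelow,
    not_lt] at hx
  rw [abs_mul, mul_comm, abs_of_nonneg (pow_nonneg h0 _)]
  refine mul_le_mul ?_ (pow_le_pow_of_le_one h0 h1 hx.2) (by positivity)
    (Finset.sum_nonneg fun _ _ => Finset.sum_nonneg fun _ _ => mul_nonneg hM₁ hM₂)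
  refine (Finset.abs_sum_le_sum_abs _ _).trans (Finset.sum_le_sum fun k hk => ?_)
  refine (Finset.abs_sum_le_sum_abs _ _).trans (Finset.sum_le_sum fun l hl => ?_)
  rw [abs_mul]
  refine mul_le_mul (hc _ hx.1.1 k hk l hl) ?_ (abs_nonneg _) hM₁
  have hf1 : (1 : ℝ) ≤ (x.2.1.factorial : ℝ) := by exact_mod_cast Nat.succ_le_of_lt (Nat.factorial_pos _)
  have hf2 : (1 : ℝ) ≤ (x.2.2.factorial : ℝ) := by exact_mod_cast Nat.succ_le_of_lt (Nat.factorial_pos _)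
  have hff := one_le_mul_of_one_le_of_one_le hf1 hf2
  rw [abs_div, abs_of_nonneg (zero_le_one.trans hff), div_le_iff₀ (zero_lt_one.trans_le hff),
    abs_mul, abs_mul, abs_pow, abs_pow]
  have hk1 := pow_le_one₀ (n := x.2.1) (abs_nonneg _) (abs_le_one_of_mem_offsets hk)
  have hl1 := pow_le_one₀ (n := x.2.2) (abs_nonneg _) (abs_le_one_of_mem_offsets hl)
  calc |J x.2.1 x.2.2| * |(k : ℝ)| ^ x.2.1 * |(l : ℝ)| ^ x.2.2 ≤ M₂ * 1 * 1 := by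
        gcongr
        exact hJ _ _ hx.1.2
    _ ≤ M₂ * ((x.2.1.factorial : ℝ) * (x.2.2.factorial : ℝ)) := by
        rw [mul_one, mul_one]
        exact le_mul_of_one_le_right hM₂ hff

/-! ### The fourth order scheme -/

/-- The coefficient of `h ^ j` in `stencilCoeff A h`, when `A 0 0 = 1`. -/
def stencilTerm (A : ℕ → ℕ → ℝ) : ℕ → ℤ → ℤ → ℝ
  | 0 => nineWeights
      (4)
      (16)
      (4)
      (16)
      (-80)
      (16)
      (4)
      (16)
      (4)
  | 1 => nineWeights
      (-4 * A 1 0)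
      (8 * A 0 1 - 16 * A 1 0)
      (4 * A 0 1 - 4 * A 1 0)
      (-8 * A 1 0)
      (-40 * A 0 1 + 40 * A 1 0)
      (16 * A 0 1 - 8 * A 1 0)
      (0)
      (8 * A 0 1)
      (4 * A 0 1)
  | 2 => nineWeights
      (-2 * A 0 1 ^ 2 + 2 * A 1 0 ^ 2)
      (-8 * A 0 1 * A 1 0 + 8 * A 1 0 ^ 2)
      (-4 * A 1 1 + 2 * A 1 0 ^ 2)
      (4 * A 0 2 - 4 * A 2 0 - 6 * A 0 1 ^ 2 + 6 * A 1 0 ^ 2)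
      (-8 * A 0 2 + 8 * A 1 1 + 8 * A 2 0 + 12 * A 0 1 * A 1 0 + 8 * A 0 1 ^ 2 - 24 * A 1 0
        ^ 2)
      (4 * A 0 2 - 4 * A 2 0 - 8 * A 0 1 * A 1 0 + 2 * A 0 1 ^ 2 + 6 * A 1 0 ^ 2)
      (-4 * A 1 1 + 4 * A 0 1 * A 1 0 - 2 * A 0 1 ^ 2)
      (0)
      (0)
  | 3 => nineWeights
      (A 0 3 - A 1 2 + A 2 1 - A 3 0 + 3 * A 0 1 * A 1 1 - 5 * A 0 1 * A 2 0 - A 0 2 * A 1 0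
        - 3 * A 1 0 * A 1 1 + 6 * A 1 0 * A 2 0 + 9 * A 0 1 * A 1 0 ^ 2 - 2 * A 0 1 ^ 2 * A
        1 0 - A 0 1 ^ 3 - 6 * A 1 0 ^ 3)
      (-2 * A 0 3 - 2 * A 2 1 + 10 * A 0 1 * A 2 0 + 4 * A 0 2 * A 1 0 + 6 * A 1 0 * A 1 1 -
        4 * A 1 0 * A 2 0 - 14 * A 0 1 * A 1 0 ^ 2 + 2 * A 0 1 ^ 2 * A 1 0 + 2 * A 0 1 ^ 3 +
        2 * A 1 0 ^ 3)
      (A 0 3 - A 1 2 + A 2 1 - A 3 0 - A 0 1 * A 1 1 - 5 * A 0 1 * A 2 0 - A 0 2 * A 1 0 + A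
        1 0 * A 1 1 + 6 * A 1 0 * A 2 0 + 7 * A 0 1 * A 1 0 ^ 2 - A 0 1 ^ 3 - 6 * A 1 0 ^ 3)
      (-2 * A 0 3 - 2 * A 2 1 + 4 * A 0 1 * A 0 2 + 6 * A 0 1 * A 2 0 + 6 * A 1 0 * A 1 1 -
        12 * A 0 1 * A 1 0 ^ 2 + 4 * A 0 1 ^ 2 * A 1 0)
      (2 * A 0 3 + 2 * A 1 2 + 2 * A 2 1 + 2 * A 3 0 - 4 * A 0 1 * A 0 2 - 2 * A 0 1 * A 1 1
        - 6 * A 0 1 * A 2 0 - 2 * A 0 2 * A 1 0 - 10 * A 1 0 * A 1 1 - 8 * A 1 0 * A 2 0 +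
        10 * A 0 1 * A 1 0 ^ 2 - 4 * A 0 1 ^ 2 * A 1 0 + 10 * A 1 0 ^ 3)
      (0)
      (0)
      (0)
      (0)
  | 4 => nineWeights
      (-A 0 1 * A 0 3 - A 0 1 * A 2 1 + A 0 3 * A 1 0 + 2 * A 1 0 * A 1 2 + A 1 0 * A 2 1 +
        2 * A 1 0 * A 3 0 - 2 * A 0 1 * A 0 2 * A 1 0 - 3 * A 0 1 * A 1 0 * A 1 1 - 3 * A 0
        1 * A 1 0 * A 2 0 + 2 * A 0 1 ^ 2 * A 0 2 + 3 * A 0 1 ^ 2 * A 2 0 - 2 * A 0 2 * A 1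
        0 ^ 2 - 3 * A 1 0 ^ 2 * A 1 1 - 8 * A 1 0 ^ 2 * A 2 0 + 4 * A 0 1 * A 1 0 ^ 3 - 2 *
        A 0 1 ^ 2 * A 1 0 ^ 2 - A 0 1 ^ 4 + 7 * A 1 0 ^ 4)
      (A 0 1 * A 0 3 - A 0 1 * A 1 2 + A 0 1 * A 2 1 - A 0 1 * A 3 0 - A 0 3 * A 1 0 - A 1 0
        * A 2 1 + 3 * A 0 1 * A 0 2 * A 1 0 + A 0 1 * A 1 0 * A 1 1 + 7 * A 0 1 * A 1 0 * A
        2 0 - 2 * A 0 1 ^ 2 * A 0 2 + A 0 1 ^ 2 * A 1 1 - 3 * A 0 1 ^ 2 * A 2 0 + A 1 0 ^ 2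
        * A 1 1 - 7 * A 0 1 * A 1 0 ^ 3 + 3 * A 0 1 ^ 2 * A 1 0 ^ 2 - A 0 1 ^ 3 * A 1 0 + A
        0 1 ^ 4)
      (0)
      (A 0 1 * A 1 2 + A 0 1 * A 3 0 - 2 * A 1 0 * A 1 2 - 2 * A 1 0 * A 3 0 - A 0 1 * A 0 2
        * A 1 0 + 2 * A 0 1 * A 1 0 * A 1 1 - 4 * A 0 1 * A 1 0 * A 2 0 - A 0 1 ^ 2 * A 1 1
        + 2 * A 0 2 * A 1 0 ^ 2 + 2 * A 1 0 ^ 2 * A 1 1 + 8 * A 1 0 ^ 2 * A 2 0 + 3 * A 0 1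
        * A 1 0 ^ 3 - A 0 1 ^ 2 * A 1 0 ^ 2 + A 0 1 ^ 3 * A 1 0 - 7 * A 1 0 ^ 4)
      (0)
      (0)
      (0)
      (0)
      (0)
  | _ => fun _ _ => 0

/-- Dividing a by the constant a(p) does not change the source-free equation, so the moment
identities need checking only for A 0 0 = 1. The weights stop at h^4; the sum runs to h^5 with a
zero term so that its length matches the six orders of the Taylor polynomial. -/
theorem stencilCoeff_eq {A : ℕ → ℕ → ℝ} (hA : A 0 0 ≠ 0) (h : ℝ) {k l : ℤ} (hk : k ∈ offsets)
    (hl : l ∈ offsets) : stencilCoeff A h k l = A 0 0 ^ 4 *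
      ∑ j ∈ Finset.range 6, h ^ j * stencilTerm (fun m n => A m n / A 0 0) j k l := by
  simp only [Finset.sum_range_succ, Finset.sum_range_zero, stencilTerm]
  rcases mem_offsets.1 hk with rfl | rfl | rfl <;> rcases mem_offsets.1 hl with rfl | rfl | rfl <;>
  · simp only [stencilCoeff, nineWeights]
    field_simp
    ring

theorem continuousOn_stencilTerm {T : Type*} [TopologicalSpace T] {s : Set T} {A : T → ℕ → ℕ → ℝ}
    (hA : ∀ i j, ContinuousOn (fun t => A t i j) s) (j : ℕ) (k l : ℤ) :
    ContinuousOn (fun t => stencilTerm (A t) j k l) s := by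
  unfold stencilTerm
  split
  all_goals first
    | exact continuousOn_const
    | (refine continuousOn_nineWeights ?_ ?_ ?_ ?_ ?_ ?_ ?_ ?_ ?_ k l <;> fun_prop)

theorem stencilMoment_eq_sum (c : ℕ → ℤ → ℤ → ℝ) (J : ℕ → ℕ → ℝ) (N : ℕ) :
    stencilMoment c J N = ∑ m ∈ Finset.range (N + 1), ∑ n ∈ Finset.range (N + 1 - m),
      (J m n / ((m.factorial : ℝ) * (n.factorial : ℝ))) *
      ∑ k ∈ offsets, ∑ l ∈ offsets, c (N - (m + n)) k l * ((k : ℝ) ^ m * (l : ℝ) ^ n) := by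
  rw [← sum_indicesBelow (N + 1) fun m n => (J m n / ((m.factorial : ℝ) * (n.factorial : ℝ))) *
      ∑ k ∈ offsets, ∑ l ∈ offsets, c (N - (m + n)) k l * ((k : ℝ) ^ m * (l : ℝ) ^ n)]
  refine Finset.sum_congr rfl fun q _ => ?_
  rw [Finset.mul_sum]
  refine Finset.sum_congr rfl fun k _ => ?_
  rw [Finset.mul_sum]
  refine Finset.sum_congr rfl fun l _ => ?_
  ring

theorem sum_nineWeights (a b c d e f g h i : ℝ) (w : ℤ → ℤ → ℝ) :
    ∑ k ∈ offsets, ∑ l ∈ offsets, nineWeights a b c d e f g h i k l * w k l =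
      a * w (-1) (-1) + b * w (-1) 0 + c * w (-1) 1 + (d * w 0 (-1) + e * w 0 0 + f * w 0 1) +
        (g * w 1 (-1) + h * w 1 0 + i * w 1 1) := by
  simp only [sum_offsets, nineWeights]

/-- Each moment lies in the span of the derivatives of the equation. At h = 0 the stencil expands as
24 h^2 Δ + 2 h^4 Δ^2 + …, which explains the leading coefficients 24 and 2; the higher weights are
corrections for the derivatives of a. Fifth derivatives of J drop out by symmetry of the h^0
weights, so two derivatives of the equation are enough. -/
theorem stencilMoment_stencilTerm_eq_zero {A J : ℕ → ℕ → ℝ} (hA : A 0 0 = 1)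
    (hJ : ∀ m n, ellipticJet A J m n = 0) {N : ℕ} (hN : N < 6) :
    stencilMoment (stencilTerm A) J N = 0 := by
  -- The names record derivatives that the equations determine: `h20` is the equation itself, `h30`
  -- and `h21` its first derivatives, `h40` and `h22` its second pure derivatives in x and in y.
  have h20 := hJ 0 0
  have h21 := hJ 0 1
  have h30 := hJ 1 0
  have h22 := hJ 0 2
  have h40 := hJ 2 0
  simp only [ellipticJet, Finset.sum_range_succ, Finset.sum_range_zero, hA, Nat.choose_self,
    Nat.choose_zero_right, Nat.choose_one_right, Nat.sub_self, Nat.sub_zero, Nat.cast_one,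
    Nat.cast_ofNat, zero_add, one_mul, Nat.reduceAdd, Nat.reduceSub] at h20 h21 h30 h22 h40
  rw [stencilMoment_eq_sum]
  interval_cases N <;>
    simp only [Finset.sum_range_succ, Finset.sum_range_zero, stencilTerm, sum_nineWeights,
      Nat.reduceAdd, Nat.reduceSub, Nat.factorial, Nat.succ_eq_add_one, Nat.reduceMul,
      Nat.cast_one, Nat.cast_ofNat, zero_add, Int.cast_neg, Int.cast_one, Int.cast_zero,
      zero_mul, Finset.sum_const_zero]
  · ring
  · ring
  · linear_combination (24) * h20
  · linear_combination (12 * A 0 1 - 12 * A 1 0) * h20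
  · linear_combination (2) * h40 + (2) * h22 + (-2 * A 1 0) * h30 + (-2 * A 0 1) * h21 + (-2 * A 0 2 - 4 * A 1
        1 - 6 * A 2 0 - 2 * A 0 1 * A 1 0 + 10 * A 1 0 ^ 2) * h20
  · linear_combination (A 0 1 - A 1 0) * h40 + (A 0 1 - A 1 0) * h22 + (-A 0 1 * A 1 0 + A 1 0 ^ 2) * h30 + (A
        0 1 * A 1 0 - A 0 1 ^ 2) * h21 + (-A 1 2 - A 3 0 - A 0 1 * A 0 2 + A 0 1 * A 1 1 - 3 * A
        0 1 * A 2 0 + 2 * A 0 2 * A 1 0 + 2 * A 1 0 * A 1 1 + 7 * A 1 0 * A 2 0 + 3 * A 0 1 * A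
        1 0 ^ 2 - A 0 1 ^ 2 * A 1 0 + A 0 1 ^ 3 - 7 * A 1 0 ^ 3) * h20

/-- A response to the source has zero initial data, so its first nonzero contribution is the second
x-derivative. This is the leading term of C_{f,0,0}. -/
theorem stencilMoment_stencilTerm_source (A : ℕ → ℕ → ℝ) {J : ℕ → ℕ → ℝ} (h₀ : ∀ n, J 0 n = 0)
    (h₁ : ∀ n, J 1 n = 0) : stencilMoment (stencilTerm A) J 0 = 0 ∧
      stencilMoment (stencilTerm A) J 1 = 0 ∧ stencilMoment (stencilTerm A) J 2 = 24 * J 2 0 := by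
  simp only [stencilMoment_eq_sum, Finset.sum_range_succ, Finset.sum_range_zero, stencilTerm,
    sum_nineWeights, Nat.reduceAdd, Nat.reduceSub, Nat.factorial, Nat.succ_eq_add_one,
    Nat.reduceMul, Nat.cast_one, Nat.cast_ofNat, zero_add, Int.cast_neg, Int.cast_one,
    Int.cast_zero, h₀, h₁]
  refine ⟨?_, ?_, ?_⟩ <;> ring

theorem ellipticJet_div (A U : ℕ → ℕ → ℝ) (c : ℝ) (m n : ℕ) :
    ellipticJet (fun i j => A i j / c) U m n = ellipticJet A U m n / c := by
  simp only [ellipticJet, Finset.sum_div]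
  refine Finset.sum_congr rfl fun i _ => Finset.sum_congr rfl fun j _ => ?_
  ring

theorem solutionJet_source_two_zero {A : ℕ → ℕ → ℝ} (hA : A 0 0 ≠ 0) :
    solutionJet A (fun i j => if i = 0 ∧ j = 0 then 1 else 0) 0 0 2 0 = -1 / A 0 0 := by
  have h := solutionJet_spec hA (fun i j => if i = 0 ∧ j = 0 then 1 else 0) 0 0 0 0
  simp only [ellipticJet, Finset.sum_range_one, solutionJet_zero, solutionJet_one, and_self,
    if_true, Nat.sub_self, zero_add, Pi.zero_apply, Nat.choose_self, Nat.cast_one, mul_zero,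
    add_zero, one_mul] at h
  rw [eq_div_iff hA]
  linarith

theorem exists_forall_abs_le {T ι : Type*} [TopologicalSpace T] {K : Set T} (hK : IsCompact K)
    (s : Finset ι) {g : ι → T → ℝ} (hg : ∀ i ∈ s, ContinuousOn (g i) K) :
    ∃ M, 0 ≤ M ∧ ∀ i ∈ s, ∀ p ∈ K, |g i p| ≤ M := by
  have h : ∀ i, ∃ M, 0 ≤ M ∧ (i ∈ s → ∀ p ∈ K, |g i p| ≤ M) := by
    intro i
    by_cases hi : i ∈ s
    · obtain ⟨C, hC⟩ := hK.exists_bound_of_continuousOn (hg i hi)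
      exact ⟨max C 0, le_max_right _ _, fun _ p hp => (hC p hp).trans (le_max_left _ _)⟩
    · exact ⟨0, le_rfl, fun h => absurd h hi⟩
  choose M hM0 hM using h
  exact ⟨∑ i ∈ s, M i, Finset.sum_nonneg fun i _ => hM0 i, fun i hi p hp => (hM i hi p hp).trans
    (Finset.single_le_sum (f := M) (fun j _ => hM0 j) hi)⟩

theorem norm_stencil_offset_le {h : ℝ} (h0 : 0 ≤ h) {k l : ℤ} (hk : k ∈ offsets)
    (hl : l ∈ offsets) : ‖((k * h, l * h) : ℝ × ℝ)‖ ≤ h := by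
  rw [Prod.norm_def]
  refine max_le ?_ ?_
  · rw [norm_mul, Real.norm_eq_abs, Real.norm_of_nonneg h0]
    exact mul_le_of_le_one_left h0 (abs_le_one_of_mem_offsets hk)
  · rw [norm_mul, Real.norm_eq_abs, Real.norm_of_nonneg h0]
    exact mul_le_of_le_one_left h0 (abs_le_one_of_mem_offsets hl)

/-- The residual of the scheme splits into a Taylor remainder and the contribution of the
homogeneous part of the solution. -/
theorem schemeResidual_eq {a f u : ℝ × ℝ → ℝ} {p : ℝ × ℝ} (hA : mixedPartial a p 0 0 ≠ 0)
    (hrel : ∀ m n, m + n < 4 →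
      mixedPartial f p m n + ellipticJet (mixedPartial a p) (mixedPartial u p) m n = 0) (h : ℝ) :
    schemeResidual a f u p h =
      (∑ k ∈ offsets, ∑ l ∈ offsets, stencilCoeff (mixedPartial a p) h k l *
        (u (stencilPoint p h k l) - jetPoly 6 (mixedPartial u p) (k * h) (l * h))) +
      ∑ k ∈ offsets, ∑ l ∈ offsets, stencilCoeff (mixedPartial a p) h k l *
        jetPoly 6 (solutionJet (mixedPartial a p) 0 (mixedPartial u p 0) (mixedPartial u p 1))
          (k * h) (l * h) := by
  have hj : ∀ X Y, jetPoly 6 (mixedPartial u p) X Y =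
      jetPoly 6 (solutionJet (mixedPartial a p) 0 (mixedPartial u p 0) (mixedPartial u p 1)) X Y +
      ∑ q ∈ indicesBelow 4, mixedPartial f p q.1 q.2 *
        sourcePoly (mixedPartial a p) 5 q.1 q.2 X Y := by
    intro X Y
    -- A Taylor polynomial of degree 5 sees derivatives of total order below 4 + 2, exactly the
    -- range in which four orders of the equation determine the jet.
    rw [jetPoly_congr (solutionJet_decomp hA hrel), jetPoly_add, jetPoly_sum]
    rfl
  have hs : ∑ q ∈ indicesBelow 4, mixedPartial f p q.1 q.2 *
      sourceCoeff (mixedPartial a p) h q.1 q.2 =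
      ∑ k ∈ offsets, ∑ l ∈ offsets, stencilCoeff (mixedPartial a p) h k l *
        ∑ q ∈ indicesBelow 4, mixedPartial f p q.1 q.2 *
          sourcePoly (mixedPartial a p) 5 q.1 q.2 (k * h) (l * h) := by
    simp only [sourceCoeff, Finset.mul_sum]
    rw [Finset.sum_comm]
    refine Finset.sum_congr rfl fun k _ => ?_
    rw [Finset.sum_comm]
    refine Finset.sum_congr rfl fun l _ => Finset.sum_congr rfl fun q _ => ?_
    ring
  rw [schemeResidual, hs]
  simp only [← Finset.sum_sub_distrib, ← Finset.sum_add_distrib, hj]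
  refine Finset.sum_congr rfl fun k _ => Finset.sum_congr rfl fun l _ => ?_
  ring

theorem fourth_order_consistency {U K : Set (ℝ × ℝ)} (hU : IsOpen U) {a f u : ℝ × ℝ → ℝ}
    (ha : ContDiffOn ℝ ∞ a U) (ha0 : ∀ q ∈ U, 0 < a q)
    (hu : ContDiffOn ℝ ∞ u U) (hpde : ∀ q ∈ U, ellipticOp a u q = f q) (hK : IsCompact K)
    (hKU : K ⊆ U) :
    ∃ B > 0, ∃ h₀ > 0, ∀ h : ℝ, 0 < h → h ≤ h₀ → ∀ p ∈ K,
      |schemeResidual a f u p h| ≤ B * h ^ 6 ∧ sourceCoeff (mixedPartial a p) h 0 0 ≠ 0 ∧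
      |schemeResidual a f u p h / sourceCoeff (mixedPartial a p) h 0 0| ≤ B * h ^ 4 := by
  have hcont : ∀ {g : ℝ × ℝ → ℝ}, ContDiffOn ℝ ∞ g U → ∀ m n,
      ContinuousOn (fun p => mixedPartial g p m n) K := fun hg m n =>
    (ContDiffOn.continuousOn_mixedPartial hU le_rfl (contDiffOn_infty.1 hg (m + n))).mono hKU
  -- `mixedPartial a p 0 0` is a p by definition.
  have hA0 : ∀ p ∈ K, 0 < mixedPartial a p 0 0 := fun p hp => ha0 p (hKU hp)
  have hAne : ∀ p ∈ K, mixedPartial a p 0 0 ≠ 0 := fun p hp => (hA0 p hp).ne'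
  set S : ℝ × ℝ → ℕ → ℤ → ℤ → ℝ := fun p =>
    stencilTerm fun m n => mixedPartial a p m n / mixedPartial a p 0 0 with hS
  set H : ℝ × ℝ → ℕ → ℕ → ℝ := fun p =>
    solutionJet (mixedPartial a p) 0 (mixedPartial u p 0) (mixedPartial u p 1) with hH
  set G : ℝ × ℝ → ℕ → ℕ → ℝ := fun p =>
    solutionJet (mixedPartial a p) (fun i j => if i = 0 ∧ j = 0 then 1 else 0) 0 0 with hG
  obtain ⟨M₁, hM₁, b₁⟩ := exists_forall_abs_le hK (Finset.range 6 ×ˢ (offsets ×ˢ offsets))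
    (g := fun x p => S p x.1 x.2.1 x.2.2) fun x _ => continuousOn_stencilTerm
      (fun i j => (hcont ha i j).div (hcont ha 0 0) hAne) _ _ _
  obtain ⟨M₂, hM₂, b₂⟩ := exists_forall_abs_le hK (indicesBelow 6)
    (g := fun x p => H p x.1 x.2) fun x _ => continuousOn_solutionJet (hcont ha) hAne
      (fun _ _ => continuousOn_const) (hcont hu 0) (hcont hu 1) _ _
  obtain ⟨M₃, hM₃, b₃⟩ := exists_forall_abs_le hK (indicesBelow 6)
    (g := fun x p => G p x.1 x.2) fun x _ => continuousOn_solutionJet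
      (F := fun _ i j => if i = 0 ∧ j = 0 then 1 else 0) (w₀ := fun _ => 0) (w₁ := fun _ => 0)
      (hcont ha) hAne (fun _ _ => continuousOn_const) (fun _ => continuousOn_const)
      (fun _ => continuousOn_const) _ _
  obtain ⟨β, hβ0, hβ⟩ := exists_forall_abs_le hK {()}
    (g := fun _ p => mixedPartial a p 0 0) fun _ _ => hcont ha 0 0
  obtain ⟨γ, hγ0, hγ⟩ := exists_forall_abs_le hK {()}
    (g := fun _ p => 1 / mixedPartial a p 0 0) fun _ _ => continuousOn_const.div (hcont ha 0 0) hAne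
  obtain ⟨δ, hδ, C, hC, htaylor⟩ := exists_uniform_taylor_bound (N := 6) hU hK hKU
    (contDiffOn_infty.1 hu 6)
  obtain ⟨B₂, hB₂, e₂⟩ := exists_stencil_expansion_bound 6 6 le_rfl hM₁ hM₂
  obtain ⟨B₃, hB₃, e₃⟩ := exists_stencil_expansion_bound 6 3 (by norm_num) hM₁ hM₃
  set B₁ : ℝ := (∑ k ∈ offsets, ∑ l ∈ offsets, β ^ 4 * (6 * M₁) * C) + β ^ 4 * B₂ with hB₁
  have hB₁0 : 0 ≤ B₁ := add_nonneg (Finset.sum_nonneg fun _ _ => Finset.sum_nonneg fun _ _ => by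
    positivity) (by positivity)
  -- `B₁` bounds the residual; `γ` bounds 1/a on K and converts division by a^3 into a constant. The
  -- last bound on h keeps the h^3 error in C_{f,0,0} below half of its leading term 24 a^3 h^2, and
  -- h ≤ δ keeps the stencil within range of the Taylor bound.
  refine ⟨B₁ * (1 + γ) ^ 3 + B₁ + 1, by positivity, min (min δ 1) (12 / (β * B₃ + 1)),
    lt_min (lt_min hδ one_pos) (by positivity), fun h h0 hh p hp => ?_⟩
  have hhδ : h ≤ δ := hh.trans ((min_le_left _ _).trans (min_le_left _ _))
  have hh1 : h ≤ 1 := hh.trans ((min_le_left _ _).trans (min_le_right _ _))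
  have hh2 : h ≤ 12 / (β * B₃ + 1) := hh.trans (min_le_right _ _)
  set α := mixedPartial a p 0 0 with hα
  have hα0 : 0 < α := hA0 p hp
  have hαβ : α ≤ β := (le_abs_self _).trans (hβ () (by simp) p hp)
  have hαγ : 1 / α ≤ γ := (le_abs_self _).trans (hγ () (by simp) p hp)
  have hSb : ∀ j < 6, ∀ k ∈ offsets, ∀ l ∈ offsets, |S p j k l| ≤ M₁ := fun j hj k hk l hl =>
    b₁ (j, k, l) (by simp [hj, hk, hl]) p hp
  have hHb : ∀ m n, m + n < 6 → |H p m n| ≤ M₂ := fun m n hmn =>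
    b₂ (m, n) (mem_indicesBelow.2 hmn) p hp
  have hGb : ∀ m n, m + n < 6 → |G p m n| ≤ M₃ := fun m n hmn =>
    b₃ (m, n) (mem_indicesBelow.2 hmn) p hp
  have hsum : ∀ J : ℕ → ℕ → ℝ, ∑ k ∈ offsets, ∑ l ∈ offsets,
      stencilCoeff (mixedPartial a p) h k l * jetPoly 6 J (k * h) (l * h) =
      α ^ 4 * ∑ k ∈ offsets, ∑ l ∈ offsets,
        (∑ j ∈ Finset.range 6, h ^ j * S p j k l) * jetPoly 6 J (k * h) (l * h) := by
    intro J
    rw [Finset.mul_sum]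
    refine Finset.sum_congr rfl fun k hk => ?_
    rw [Finset.mul_sum]
    refine Finset.sum_congr rfl fun l hl => ?_
    rw [stencilCoeff_eq (hAne p hp) h hk hl]
    ring
  have hrel : ∀ m n, m + n < 4 →
      mixedPartial f p m n + ellipticJet (mixedPartial a p) (mixedPartial u p) m n = 0 := by
    intro m n _
    have hpU := hU.mem_nhds (hKU hp)
    have hfe : f =ᶠ[𝓝 p] ellipticOp a u := by
      filter_upwards [hpU] with q hq
      exact (hpde q hq).symm
    rw [mixedPartial_congr hfe, mixedPartial_ellipticOp_eq_ellipticJet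
      ((contDiffOn_infty.1 ha _).contDiffAt hpU) ((contDiffOn_infty.1 hu _).contDiffAt hpU),
      neg_add_cancel]
  have hres : |schemeResidual a f u p h| ≤ B₁ * h ^ 6 := by
    rw [schemeResidual_eq (hAne p hp) hrel, hB₁, add_mul, Finset.sum_mul]
    refine (abs_add_le _ _).trans (add_le_add ?_ ?_)
    · refine (Finset.abs_sum_le_sum_abs _ _).trans (Finset.sum_le_sum fun k hk => ?_)
      rw [Finset.sum_mul]
      refine (Finset.abs_sum_le_sum_abs _ _).trans (Finset.sum_le_sum fun l hl => ?_)
      rw [abs_mul, mul_assoc]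
      have hz := norm_stencil_offset_le h0.le hk hl
      have ht := htaylor p hp (k * h, l * h) (hz.trans hhδ)
      refine mul_le_mul ?_ (ht.trans ?_) (abs_nonneg _) (by positivity)
      · rw [stencilCoeff_eq (hAne p hp) h hk hl, abs_mul, abs_of_nonneg (by positivity)]
        refine mul_le_mul (pow_le_pow_left₀ hα0.le hαβ 4) ?_ (abs_nonneg _) (by positivity)
        refine (Finset.abs_sum_le_sum_abs _ _).trans ((Finset.sum_le_sum (g := fun _ => M₁)
          fun j hj => ?_).trans (by simp))
        rw [abs_mul, abs_of_nonneg (by positivity)]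
        exact (mul_le_of_le_one_left (abs_nonneg _) (pow_le_one₀ h0.le hh1)).trans
          (hSb j (Finset.mem_range.1 hj) k hk l hl)
      · exact mul_le_mul_of_nonneg_left (pow_le_pow_left₀ (norm_nonneg _) hz 6) hC
    · have h1 := e₂ (S p) (H p) h hSb hHb h0.le hh1
      have h2 : ∀ N ∈ Finset.range 6, h ^ N * stencilMoment (S p) (H p) N = 0 := by
        intro N hN
        rw [hS, stencilMoment_stencilTerm_eq_zero (div_self (hAne p hp)) _
          (Finset.mem_range.1 hN), mul_zero]
        intro m n
        have := solutionJet_spec (hAne p hp) 0 (mixedPartial u p 0) (mixedPartial u p 1) m n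
        rw [Pi.zero_apply, Pi.zero_apply, zero_add] at this
        rw [ellipticJet_div, this, zero_div]
      rw [Finset.sum_eq_zero h2, sub_zero] at h1
      rw [hsum, abs_mul, abs_of_nonneg (by positivity), mul_assoc]
      exact mul_le_mul (pow_le_pow_left₀ hα0.le hαβ 4) h1 (abs_nonneg _) (by positivity)
  -- After the factor α^4, the second moment 24 · (-1/α) gives the leading term -24 α^3 h^2, of
  -- which half survives the error.
  have hsrc : 12 * α ^ 3 * h ^ 2 ≤ |sourceCoeff (mixedPartial a p) h 0 0| := by
    have h1 := e₃ (S p) (G p) h hSb hGb h0.le hh1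
    obtain ⟨m0, m1, m2⟩ : stencilMoment (S p) (G p) 0 = 0 ∧ stencilMoment (S p) (G p) 1 = 0 ∧
        stencilMoment (S p) (G p) 2 = 24 * G p 2 0 := stencilMoment_stencilTerm_source
      (fun m n => mixedPartial a p m n / mixedPartial a p 0 0) (J := G p)
      (fun n => solutionJet_zero _ _ _ _ n) (fun n => solutionJet_one _ _ _ _ n)
    have hG2 : G p 2 0 = -1 / α := solutionJet_source_two_zero (hAne p hp)
    rw [Finset.sum_range_succ, Finset.sum_range_succ, Finset.sum_range_one, m0, m1, m2, hG2] at h1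
    have h2 : sourceCoeff (mixedPartial a p) h 0 0 = _ := hsum (G p)
    rw [h2]
    set Q := ∑ k ∈ offsets, ∑ l ∈ offsets,
        (∑ j ∈ Finset.range 6, h ^ j * S p j k l) * jetPoly 6 (G p) (k * h) (l * h)
    have h3 : |Q + 24 * h ^ 2 / α| ≤ B₃ * h ^ 3 := by
      refine le_trans (le_of_eq ?_) h1
      congr 1
      ring
    have h4 : β * B₃ * h ≤ 12 := by
      rw [le_div_iff₀ (by positivity)] at hh2
      linarith
    have h5 : α ^ 4 * (B₃ * h ^ 3) ≤ 12 * α ^ 3 * h ^ 2 := by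
      calc α ^ 4 * (B₃ * h ^ 3) = α ^ 3 * h ^ 2 * (α * B₃ * h) := by ring
        _ ≤ α ^ 3 * h ^ 2 * 12 := by
          refine mul_le_mul_of_nonneg_left (le_trans ?_ h4) (by positivity)
          gcongr
        _ = _ := by ring
    have h6 : α ^ 4 * Q ≤ -(12 * α ^ 3 * h ^ 2) := by
      have := mul_le_mul_of_nonneg_left ((le_abs_self _).trans h3) (pow_nonneg hα0.le 4)
      have e : α ^ 4 * (Q + 24 * h ^ 2 / α) = α ^ 4 * Q + 24 * α ^ 3 * h ^ 2 := by
        field_simp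
      rw [e] at this
      linarith
    rw [abs_of_nonpos (h6.trans (by simp; positivity))]
    linarith
  have hpos : 0 < |sourceCoeff (mixedPartial a p) h 0 0| := lt_of_lt_of_le (by positivity) hsrc
  refine ⟨hres.trans (mul_le_mul_of_nonneg_right ?_ (by positivity)), abs_pos.1 hpos, ?_⟩
  · have : 0 ≤ B₁ * (1 + γ) ^ 3 := by positivity
    linarith
  · rw [abs_div, div_le_iff₀ hpos]
    refine hres.trans ?_
    have h7 : 1 ≤ (1 + γ) ^ 3 * α ^ 3 := by
      rw [← mul_pow]
      refine one_le_pow₀ ?_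
      rw [div_le_iff₀ hα0] at hαγ
      nlinarith
    calc B₁ * h ^ 6 ≤ B₁ * h ^ 6 * ((1 + γ) ^ 3 * α ^ 3) := le_mul_of_one_le_right (by positivity) h7
      _ ≤ (B₁ * (1 + γ) ^ 3 + B₁ + 1) * h ^ 4 * (α ^ 3 * h ^ 2) := by
        have : 0 ≤ (B₁ + 1) * h ^ 4 * (α ^ 3 * h ^ 2) := by positivity
        nlinarith
      _ ≤ _ := by
        refine mul_le_mul_of_nonneg_left (le_trans ?_ hsrc) (by positivity)
        have : 0 ≤ α ^ 3 * h ^ 2 := by positivity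
        linarith

/-! ### No compact scheme has accuracy order above six -/

/-- Without source, the recursion expresses a derivative through derivatives of no higher total
order, so the vanishing order of the initial data is inherited by the whole jet. -/
theorem solutionJet_eq_zero {A : ℕ → ℕ → ℝ} {w₀ w₁ : ℕ → ℝ} {d : ℕ}
    (h₀ : ∀ j < d, w₀ j = 0) (h₁ : ∀ j, j + 1 < d → w₁ j = 0) (m n : ℕ) (hmn : m + n < d) :
    solutionJet A 0 w₀ w₁ m n = 0 := by
  induction m using Nat.strong_induction_on generalizing n with
  | _ m ihm =>
    induction n using Nat.strong_induction_on with
    | _ n ihn =>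
      match m with
      | 0 => rw [solutionJet_zero, h₀ n (by omega)]
      | 1 => rw [solutionJet_one, h₁ n (by omega)]
      | m + 2 =>
        have hl : ellipticJetLower A (solutionJet A 0 w₀ w₁) m n = 0 := by
          refine Finset.sum_eq_zero fun i _ => Finset.sum_eq_zero fun j _ => ?_
          have hi := i.2
          have hj := j.2
          rw [ihm (m - i) (by omega) (n - j + 2) (by omega),
            ihm (m - i + 1) (by omega) (n - j) (by omega),
            ihm (m - i) (by omega) (n - j + 1) (by omega)]
          have hU : (if _h : 0 < (i : ℕ) + j then
              solutionJet A 0 w₀ w₁ (m - i + 2) (n - j) else 0) = 0 := by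
            split_ifs with hij
            · rcases Nat.eq_zero_or_pos (i : ℕ) with hi0 | hi0
              · rw [hi0]
                exact ihn (n - j) (by omega) (by omega)
              · exact ihm (m - i + 2) (by omega) (n - j) (by omega)
            · rfl
          rw [hU]
          ring
        rw [solutionJet_add_two, hl]
        simp

/-- In the lowest degree only the terms with undifferentiated a survive, and the equation reduces to
a times the Laplacian. The leading homogeneous part is therefore harmonic, whatever a is. -/
theorem solutionJet_leading {A : ℕ → ℕ → ℝ} (hA : A 0 0 ≠ 0) {w₀ w₁ : ℕ → ℝ} {d : ℕ}
    (h₀ : ∀ j < d, w₀ j = 0) (h₁ : ∀ j, j + 1 < d → w₁ j = 0) {m n : ℕ} (hmn : m + n + 2 = d) :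
    solutionJet A 0 w₀ w₁ (m + 2) n = -solutionJet A 0 w₀ w₁ m (n + 2) := by
  have hz := solutionJet_eq_zero (A := A) h₀ h₁
  have h := solutionJet_spec hA 0 w₀ w₁ m n
  rw [Pi.zero_apply, Pi.zero_apply, zero_add, ellipticJet, Finset.sum_eq_single_of_mem 0 (by simp),
    Finset.sum_eq_single_of_mem 0 (by simp)] at h
  · simp only [Nat.choose_zero_right, Nat.cast_one, Nat.sub_zero, zero_add, one_mul] at h
    rw [hz (m + 1) n (by omega), hz m (n + 1) (by omega), mul_zero, mul_zero, add_zero,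
      add_zero] at h
    exact eq_neg_of_add_eq_zero_left ((mul_eq_zero.1 h).resolve_left hA)
  · intro j hj hj0
    have := Finset.mem_range.1 hj
    rw [hz _ _ (by omega), hz _ _ (by omega), hz _ _ (by omega), hz _ _ (by omega)]
    ring
  · intro i hi hi0
    refine Finset.sum_eq_zero fun j hj => ?_
    have := Finset.mem_range.1 hj
    have := Finset.mem_range.1 hi
    rw [hz _ _ (by omega), hz _ _ (by omega), hz _ _ (by omega), hz _ _ (by omega)]
    ring

theorem ellipticJet_congr {A U V : ℕ → ℕ → ℝ} {m n : ℕ}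
    (h : ∀ i j, i + j ≤ m + n + 2 → U i j = V i j) : ellipticJet A U m n = ellipticJet A V m n := by
  refine Finset.sum_congr rfl fun i hi => Finset.sum_congr rfl fun j hj => ?_
  have := Finset.mem_range.1 hj
  have := Finset.mem_range.1 hi
  rw [h _ _ (by omega), h _ _ (by omega), h _ _ (by omega), h _ _ (by omega)]

theorem stencilPoint_eq (p : ℝ × ℝ) (h : ℝ) (k l : ℤ) :
    stencilPoint p h k l = p + (k * h, l * h) := rfl

/-- The leading coefficients of a polynomial stencil annihilating the Taylor polynomial `U` to high
order annihilate the homogeneous part of lowest degree of `U`. -/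
theorem sum_leading_eq_zero {C : ℤ → ℤ → ℝ[X]} {U : ℕ → ℕ → ℝ} {N d L : ℕ} (hdN : d < N) (hdL : d < L)
    (hU : ∀ m n, m + n < d → U m n = 0)
    (h : (fun h : ℝ => ∑ k ∈ offsets, ∑ l ∈ offsets, (C k l).eval h * jetPoly N U (k * h) (l * h))
      =O[𝓝[>] 0] fun h : ℝ => h ^ L) :
    ∑ k ∈ offsets, ∑ l ∈ offsets, (C k l).eval 0 * ∑ m ∈ Finset.range (d + 1),
      U m (d - m) * (k : ℝ) ^ m * (l : ℝ) ^ (d - m) /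
        ((m.factorial : ℝ) * ((d - m).factorial : ℝ)) = 0 := by
  set T : ℕ × ℕ → ℤ → ℤ → ℝ := fun q k l => U q.1 q.2 * (k : ℝ) ^ q.1 * (l : ℝ) ^ q.2 /
    ((q.1.factorial : ℝ) * (q.2.factorial : ℝ)) with hT
  -- `g` is the stencil sum divided by h^d, continuous up to h = 0. Terms of degree below d, where
  -- the truncated subtraction would be wrong, carry the factor U = 0.
  set g : ℝ → ℝ := fun h => ∑ k ∈ offsets, ∑ l ∈ offsets, (C k l).eval h *
    ∑ q ∈ indicesBelow N, T q k l * h ^ (q.1 + q.2 - d) with hg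
  have hgc : Continuous g := by
    refine continuous_finsetSum _ fun k _ => continuous_finsetSum _ fun l _ =>
      (C k l).continuous.mul (continuous_finsetSum _ fun q _ => by fun_prop)
  have hgh : ∀ h : ℝ, ∑ k ∈ offsets, ∑ l ∈ offsets,
      (C k l).eval h * jetPoly N U (k * h) (l * h) = h ^ d * g h := by
    intro h
    simp only [hg, Finset.mul_sum, jetPoly]
    refine Finset.sum_congr rfl fun k _ => Finset.sum_congr rfl fun l _ =>
      Finset.sum_congr rfl fun q _ => ?_
    by_cases hq : q.1 + q.2 < d
    · simp only [hT, hU _ _ hq]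
      ring
    · have : h ^ q.1 * h ^ q.2 = h ^ d * h ^ (q.1 + q.2 - d) := by
        rw [← pow_add, ← pow_add]
        congr 1
        omega
      rw [mul_pow, mul_pow]
      linear_combination ((C k l).eval h * T q k l) * this
  have hg0 : Tendsto g (𝓝[>] 0) (𝓝 0) := by
    simp only [hgh] at h
    have h2 : g =O[𝓝[>] 0] fun h : ℝ => h ^ (L - d) := by
      refine ((Asymptotics.isBigO_refl (fun h : ℝ => (h ^ d)⁻¹) (𝓝[>] 0)).mul h).congr' ?_ ?_
      · filter_upwards [self_mem_nhdsWithin] with h hh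
        have : h ≠ 0 := (mem_Ioi.1 hh).ne'
        field_simp
      · filter_upwards [self_mem_nhdsWithin] with h hh
        have : h ≠ 0 := (mem_Ioi.1 hh).ne'
        rw [pow_sub₀ _ this hdL.le, mul_comm]
    refine h2.trans_tendsto ?_
    have : Tendsto (fun h : ℝ => h ^ (L - d)) (𝓝 0) (𝓝 (0 ^ (L - d))) :=
      (continuous_pow (L - d)).tendsto 0
    rw [zero_pow (by omega)] at this
    exact this.mono_left nhdsWithin_le_nhds
  have hgz : g 0 = 0 :=
    tendsto_nhds_unique ((hgc.tendsto 0).mono_left nhdsWithin_le_nhds) hg0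
  refine Eq.trans ?_ hgz
  refine Finset.sum_congr rfl fun k _ => Finset.sum_congr rfl fun l _ => ?_
  congr 1
  have hsub : Finset.HasAntidiagonal.antidiagonal d ⊆ indicesBelow N := by
    intro q hq
    rw [mem_indicesBelow, Finset.HasAntidiagonal.mem_antidiagonal.1 hq]
    exact hdN
  rw [← Finset.sum_subset hsub, ← Finset.Nat.sum_antidiagonal_eq_sum_range_succ
    fun i j => U i j * (k : ℝ) ^ i * (l : ℝ) ^ j / ((i.factorial : ℝ) * (j.factorial : ℝ))]
  · refine Finset.sum_congr rfl fun q hq => ?_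
    rw [Finset.HasAntidiagonal.mem_antidiagonal.1 hq, Nat.sub_self, pow_zero, mul_one]
  · intro q _ hq
    rw [Finset.HasAntidiagonal.mem_antidiagonal] at hq
    rcases lt_or_gt_of_ne hq with hlt | hgt
    · simp only [hT, hU _ _ hlt]
      ring
    · rw [zero_pow (by omega), mul_zero]

/-- The choices (α, β) = (1, 0) and (0, 1) give the real and imaginary parts of (l + i k)^d / d!.
The real parts for d = 0, 1, 2, 3, 4, 8 and the imaginary parts for d = 1, 2, 3 are nine independent
functions on the nine points. Degree 8 is needed: among functions with the symmetries of the square,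
degrees 0 and 4 leave one stencil free, with weights 1, 4 and -20 at corners, edges and centre, and
Re z^8 excludes it. -/
theorem eq_zero_of_harmonic_moments {c : ℤ → ℤ → ℝ}
    (h : ∀ d ≤ 8, ∀ α β : ℝ, ∑ k ∈ offsets, ∑ l ∈ offsets, c k l * ∑ m ∈ Finset.range (d + 1),
      (-1) ^ (m / 2) * (if m % 2 = 0 then α else β) * (k : ℝ) ^ m * (l : ℝ) ^ (d - m) /
        ((m.factorial : ℝ) * ((d - m).factorial : ℝ)) = 0) {k l : ℤ} (hk : k ∈ offsets)
    (hl : l ∈ offsets) : c k l = 0 := by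
  have h0 := h 0 (by norm_num) 1 0
  have h1 := h 1 (by norm_num) 1 0
  have h1' := h 1 (by norm_num) 0 1
  have h2 := h 2 (by norm_num) 1 0
  have h2' := h 2 (by norm_num) 0 1
  have h3 := h 3 (by norm_num) 1 0
  have h3' := h 3 (by norm_num) 0 1
  have h4 := h 4 (by norm_num) 1 0
  have h8 := h 8 (by norm_num) 1 0
  simp only [sum_offsets, Finset.sum_range_succ, Finset.sum_range_zero] at h0 h1 h1' h2 h2' h3 h3' h4 h8
  norm_num [Nat.factorial] at h0 h1 h1' h2 h2' h3 h3' h4 h8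
  rcases mem_offsets.1 hk with rfl | rfl | rfl <;> rcases mem_offsets.1 hl with rfl | rfl | rfl <;>
    linarith

theorem not_hasCompactScheme {a : ℝ × ℝ → ℝ} {p : ℝ × ℝ} (ha : ContDiffAt ℝ ∞ a p)
    (ha0 : a p ≠ 0) {M : ℕ} (hM : 7 ≤ M) : ¬ HasCompactScheme a p M := by
  rintro ⟨C, Cf, -, -, ⟨k₀, hk₀, l₀, hl₀, hne⟩, h⟩
  refine hne (eq_zero_of_harmonic_moments (c := fun k l => (C k l).eval 0) ?_ hk₀ hl₀)
  intro d hd α β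
  set A := mixedPartial a p with hA
  have hA0 : A 0 0 ≠ 0 := ha0
  set w₀ : ℕ → ℝ := fun j => if j = d then α else 0 with hw₀
  set w₁ : ℕ → ℝ := fun j => if j + 1 = d then β else 0 with hw₁
  set U := solutionJet A 0 w₀ w₁ with hU
  have z₀ : ∀ j < d, w₀ j = 0 := fun j hj => if_neg hj.ne
  have z₁ : ∀ j, j + 1 < d → w₁ j = 0 := fun j hj => if_neg hj.ne
  have hlead : ∀ m ≤ d, U m (d - m) = (-1) ^ (m / 2) * (if m % 2 = 0 then α else β) := by
    intro m
    induction m using Nat.strong_induction_on with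
    | _ m ih =>
      match m with
      | 0 => intro _; simp [hU, solutionJet_zero, hw₀]
      | 1 =>
        intro h1
        simp only [hU, solutionJet_one, hw₁]
        rw [if_pos (by omega)]
        simp
      | m + 2 =>
        intro h2
        have e := ih m (by omega) (by omega)
        rw [show d - m = d - (m + 2) + 2 by omega] at e
        rw [hU, solutionJet_leading hA0 z₀ z₁ (by omega), ← hU, e, Nat.add_div_right m two_pos,
          Nat.add_mod_right, pow_succ]
        ring
  -- The degree M + 2 covers every derivative of u entering source derivatives of order below M, so
  -- all of these vanish and the C_f terms disappear.
  set u : ℝ × ℝ → ℝ := fun q => jetPoly (M + 3) U (q.1 - p.1) (q.2 - p.2) with hu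
  have husm : ContDiff ℝ ∞ u := by
    have h1 : ContDiff ℝ ∞ fun q : ℝ × ℝ => (q.1 - p.1, q.2 - p.2) := by fun_prop
    exact (contDiff_jetPoly (M + 3) U ∞).comp h1
  have hf0 : ∀ q ∈ indicesBelow M, mixedPartial (ellipticOp a u) p q.1 q.2 = 0 := by
    intro q hq
    have hq' := mem_indicesBelow.1 hq
    rw [mixedPartial_ellipticOp_eq_ellipticJet (contDiffAt_infty.1 ha _)
      (contDiffAt_infty.1 husm.contDiffAt _), neg_eq_zero]
    rw [ellipticJet_congr fun i j hij => mixedPartial_jetPoly (by omega) U p]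
    have := solutionJet_spec hA0 0 w₀ w₁ q.1 q.2
    rwa [Pi.zero_apply, Pi.zero_apply, zero_add] at this
  have hO := h u husm.contDiffAt
  have hsum : ∀ h : ℝ, ∑ q ∈ indicesBelow M,
      mixedPartial (ellipticOp a u) p q.1 q.2 * (Cf q.1 q.2).eval h = 0 := fun h =>
    Finset.sum_eq_zero fun q hq => by rw [hf0 q hq, zero_mul]
  simp only [hsum, sub_zero] at hO
  simp only [hu, stencilPoint, add_sub_cancel_left] at hO
  -- The inequality d < M + 2 for all d ≤ 8 is where M ≥ 7 enters.
  have key := sum_leading_eq_zero (by omega) (by omega) (solutionJet_eq_zero z₀ z₁) hO (d := d)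
  refine Eq.trans ?_ key
  refine Finset.sum_congr rfl fun k _ => Finset.sum_congr rfl fun l _ => ?_
  congr 1
  refine Finset.sum_congr rfl fun m hm => ?_
  rw [← hU, hlead m (by have := Finset.mem_range.1 hm; omega)]

/-! ### A compact scheme of accuracy order six -/

/-- The coefficients of a nine-point scheme for `Δv = q v`, with `Q m n` standing for
`q^{(m,n)}`, as terms in the powers of `h`. -/
def schrodingerTerm (Q : ℕ → ℕ → ℝ) : ℕ → ℤ → ℤ → ℝ
  | 0 => nineWeights
      (1)
      (4)
      (1)
      (4)
      (-20)
      (4)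
      (1)
      (4)
      (1)
  | 1 => fun _ _ => 0
  | 2 => nineWeights
      (0)
      ((1 / 5) * Q 0 0)
      (0)
      ((1 / 5) * Q 0 0)
      (-(34 / 5) * Q 0 0)
      ((1 / 5) * Q 0 0)
      (0)
      ((1 / 5) * Q 0 0)
      (0)
  | 3 => nineWeights
      ((7 / 30) * Q 0 1 + (7 / 30) * Q 1 0)
      ((7 / 15) * Q 0 1 + (11 / 15) * Q 1 0)
      ((7 / 30) * Q 1 0)
      ((11 / 15) * Q 0 1 + (7 / 15) * Q 1 0)
      (-(7 / 3) * Q 0 1 - (7 / 3) * Q 1 0)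
      ((1 / 5) * Q 0 1 + (7 / 15) * Q 1 0)
      ((7 / 30) * Q 0 1)
      ((7 / 15) * Q 0 1 + (1 / 5) * Q 1 0)
      (0)
  | 4 => nineWeights
      (0)
      ((1 / 30) * Q 0 2 - (1 / 30) * Q 2 0)
      ((2 / 15) * Q 1 1)
      (0)
      (-(17 / 30) * Q 0 2 - (4 / 15) * Q 1 1 - (13 / 30) * Q 2 0 - (7 / 10) * Q 0 0 ^ 2)
      (0)
      ((2 / 15) * Q 1 1)
      ((1 / 30) * Q 0 2 - (1 / 30) * Q 2 0)
      (0)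
  | 5 => nineWeights
      (0)
      ((1 / 30) * Q 0 3 + (1 / 15) * Q 1 2 + (1 / 15) * Q 2 1 + (1 / 30) * Q 3 0 - (1 / 60) * Q 0
        0 * Q 0 1 - (1 / 60) * Q 0 0 * Q 1 0)
      (0)
      ((1 / 15) * Q 0 3 + (2 / 15) * Q 2 1 - (1 / 30) * Q 0 0 * Q 0 1)
      (-(2 / 15) * Q 0 3 - (4 / 15) * Q 2 1 - (19 / 30) * Q 0 0 * Q 0 1 - (7 / 10) * Q 0 0 * Q 1
        0)
      (0)
      (0)
      ((1 / 30) * Q 0 3 - (1 / 15) * Q 1 2 + (1 / 15) * Q 2 1 - (1 / 30) * Q 3 0 - (1 / 60) * Q 0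
        0 * Q 0 1 + (1 / 60) * Q 0 0 * Q 1 0)
      (0)
  | 6 => nineWeights
      (0)
      ((7 / 60) * Q 0 1 * Q 1 0 + (7 / 60) * Q 1 0 ^ 2)
      (0)
      ((7 / 60) * Q 0 1 * Q 1 0 + (7 / 60) * Q 0 1 ^ 2)
      (-(1 / 60) * Q 0 4 - (1 / 15) * Q 2 2 - (1 / 60) * Q 4 0 - (2 / 15) * Q 0 0 * Q 0 2 - (2 /
        15) * Q 0 0 * Q 1 1 - (1 / 10) * Q 0 0 * Q 2 0 - (7 / 30) * Q 0 1 * Q 1 0 - (1 / 60) * Q 0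
        1 ^ 2 - (1 / 60) * Q 1 0 ^ 2 - (1 / 30) * Q 0 0 ^ 3)
      (0)
      (0)
      (0)
      (0)
  | 7 => nineWeights
      (0)
      (0)
      (0)
      (0)
      (-(1 / 30) * Q 0 0 * Q 0 3 - (1 / 15) * Q 0 0 * Q 2 1 - (7 / 120) * Q 0 1 * Q 0 2 - (7 /
        120) * Q 0 1 * Q 2 0 - (7 / 120) * Q 0 2 * Q 1 0 - (7 / 120) * Q 1 0 * Q 2 0 - (1 / 24) *
        Q 0 0 ^ 2 * Q 0 1 - (7 / 120) * Q 0 0 ^ 2 * Q 1 0)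
      (0)
      (0)
      (0)
      (0)
  | _ => fun _ _ => 0

-- The h^0 weights annihilate harmonic polynomials through degree 7: their expansion is 6 h^2 Δ +
-- h^4 Δ^2 / 2 + h^6 (∂x^4 + 4 ∂x^2 ∂y^2 + ∂y^4) Δ / 60 up to order 7. These coefficients multiply
-- the derivatives of Δv = q v in the certificates; the other terms compensate for derivatives of q.
-- Odd derivatives of the top order cancel by symmetry.
set_option maxHeartbeats 1000000 in
theorem stencilMoment_schrodingerTerm_eq_zero {Q V : ℕ → ℕ → ℝ}
    (hV : ∀ m n, m + n < 5 → V (m + 2) n + V m (n + 2) =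
      ∑ i ∈ Finset.range (m + 1), ∑ j ∈ Finset.range (n + 1),
        (m.choose i : ℝ) * (n.choose j : ℝ) * (Q i j * V (m - i) (n - j)))
    {N : ℕ} (hN : N < 8) : stencilMoment (schrodingerTerm Q) V N = 0 := by
  have h00 := hV 0 0 (by norm_num)
  have h01 := hV 0 1 (by norm_num)
  have h10 := hV 1 0 (by norm_num)
  have h02 := hV 0 2 (by norm_num)
  have h20 := hV 2 0 (by norm_num)
  have h04 := hV 0 4 (by norm_num)
  have h22 := hV 2 2 (by norm_num)
  have h40 := hV 4 0 (by norm_num)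
  simp only [Finset.sum_range_succ, Finset.sum_range_zero, Nat.choose, Nat.reduceAdd, Nat.reduceSub,
    Nat.sub_self, Nat.sub_zero,
    Nat.cast_one, Nat.cast_ofNat, zero_add, one_mul] at h00 h01 h10 h02 h20 h04 h22 h40
  rw [stencilMoment_eq_sum]
  interval_cases N <;>
    simp only [Finset.sum_range_succ, Finset.sum_range_zero, schrodingerTerm, sum_nineWeights,
      Nat.reduceAdd, Nat.reduceSub, Nat.factorial, Nat.succ_eq_add_one, Nat.reduceMul,
      Nat.cast_one, Nat.cast_ofNat, zero_add, Int.cast_neg, Int.cast_one, Int.cast_zero,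
      zero_mul, Finset.sum_const_zero]
  · ring
  · ring
  · linear_combination (6) * h00
  · ring
  · linear_combination ((1 / 2)) * h20 + ((1 / 2)) * h02 + ((7 / 10) * Q 0 0) * h00
  · linear_combination ((7 / 10) * Q 0 1 + (7 / 10) * Q 1 0) * h00
  · linear_combination ((1 / 60)) * h40 + ((1 / 15)) * h22 + ((1 / 60)) * h04 + ((1 / 30) * Q 0 0)
      * h20 + ((1 / 30) * Q 0 0) * h02 + (-(1 / 10) * Q 1 0) * h10 + (-(1 / 10) * Q 0 1) * h01 +
      ((1 / 10) * Q 0 2 + (2 / 15) * Q 1 1 + (1 / 15) * Q 2 0 + (1 / 30) * Q 0 0 ^ 2) * h00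
  · linear_combination ((7 / 120) * Q 0 1 + (7 / 120) * Q 1 0) * h20 + ((7 / 120) * Q 0 1 + (7 /
      120) * Q 1 0) * h02 + ((1 / 30) * Q 0 3 + (1 / 15) * Q 2 1 + (1 / 24) * Q 0 0 * Q 0 1 + (7 /
      120) * Q 0 0 * Q 1 0) * h00

/-! ### Truncated polynomial weights and the treatment of the source. -/

/-- The Taylor polynomial with derivatives `J` along the ray through the offset `(k, l)`. -/
def jetRay (N : ℕ) (J : ℕ → ℕ → ℝ) (k l : ℤ) : ℝ[X] :=
  ∑ q ∈ indicesBelow N, Polynomial.C (J q.1 q.2 * (k : ℝ) ^ q.1 * (l : ℝ) ^ q.2 /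
    ((q.1.factorial : ℝ) * (q.2.factorial : ℝ))) * X ^ (q.1 + q.2)

theorem eval_jetRay (N : ℕ) (J : ℕ → ℕ → ℝ) (k l : ℤ) (h : ℝ) :
    (jetRay N J k l).eval h = jetPoly N J (k * h) (l * h) := by
  simp only [jetRay, jetPoly, eval_finsetSum, eval_mul, eval_C, eval_pow, eval_X]
  refine Finset.sum_congr rfl fun q _ => ?_
  rw [mul_pow, mul_pow, pow_add]
  ring

theorem Polynomial.isBigO_one (P : ℝ[X]) :
    (fun h : ℝ => P.eval h) =O[𝓝[>] 0] fun _ => (1 : ℝ) :=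
  ((P.continuous.tendsto 0).mono_left nhdsWithin_le_nhds).isBigO_one ℝ

/-- Truncation of a polynomial at a given degree. -/
theorem exists_polynomial_truncation (P : ℝ[X]) (n : ℕ) : ∃ R : ℝ[X], R.natDegree ≤ n ∧
    R.eval 0 = P.eval 0 ∧
    (fun h : ℝ => R.eval h - P.eval h) =O[𝓝[>] 0] fun h : ℝ => h ^ (n + 1) := by
  have key : ∀ h : ℝ, (P %ₘ X ^ (n + 1)).eval h - P.eval h =
      h ^ (n + 1) * (-(P /ₘ X ^ (n + 1))).eval h := by
    intro h
    have := congrArg (eval h) (modByMonic_add_div P (X ^ (n + 1)))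
    rw [eval_add, eval_mul, eval_pow, eval_X] at this
    rw [eval_neg, ← this]
    ring
  refine ⟨P %ₘ X ^ (n + 1), ?_, ?_, ?_⟩
  · have := natDegree_modByMonic_lt P (monic_X_pow (R := ℝ) (n + 1)) (by
      intro h
      have := congrArg natDegree h
      simp at this)
    rw [natDegree_X_pow] at this
    omega
  · have := key 0
    rw [zero_pow (by omega), zero_mul] at this
    linarith
  · simp only [key]
    simpa using (Asymptotics.isBigO_refl (fun h : ℝ => h ^ (n + 1)) (𝓝[>] 0)).mul
      (Polynomial.isBigO_one (-(P /ₘ X ^ (n + 1))))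

theorem tendsto_stencilPoint (p : ℝ × ℝ) (k l : ℤ) :
    Tendsto (fun h : ℝ => stencilPoint p h k l) (𝓝[>] 0) (𝓝 p) := by
  have h : Continuous fun h : ℝ => stencilPoint p h k l := by
    unfold stencilPoint
    fun_prop
  have h0 : stencilPoint p 0 k l = p := by simp [stencilPoint]
  have := (h.tendsto 0).mono_left (nhdsWithin_le_nhds (s := Ioi 0))
  rwa [h0] at this

theorem isBigO_one_stencilPoint {g : ℝ × ℝ → ℝ} {p : ℝ × ℝ} (hg : ContinuousAt g p) (k l : ℤ) :
    (fun h : ℝ => g (stencilPoint p h k l)) =O[𝓝[>] 0] fun _ => (1 : ℝ) :=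
  (hg.tendsto.comp (tendsto_stencilPoint p k l)).isBigO_one ℝ

theorem isBigO_taylor_stencilPoint {g : ℝ × ℝ → ℝ} {p : ℝ × ℝ} {N : ℕ} (hg : ContDiffAt ℝ N g p)
    {k l : ℤ} (hk : k ∈ offsets) (hl : l ∈ offsets) :
    (fun h : ℝ => (jetRay N (mixedPartial g p) k l).eval h - g (stencilPoint p h k l))
      =O[𝓝[>] 0] fun h : ℝ => h ^ N := by
  obtain ⟨δ, hδ, C, hC, hb⟩ := exists_taylor_bound_at hg
  refine Asymptotics.IsBigO.of_bound C ?_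
  filter_upwards [Ioo_mem_nhdsGT hδ] with h hh
  have hn := norm_stencil_offset_le hh.1.le hk hl
  rw [eval_jetRay, norm_sub_rev, Real.norm_eq_abs, Real.norm_eq_abs, stencilPoint_eq,
    abs_of_nonneg (pow_nonneg hh.1.le N)]
  exact (hb (k * h, l * h) (hn.trans hh.2.le)).trans
    (mul_le_mul_of_nonneg_left (pow_le_pow_left₀ (norm_nonneg _) hn N) hC)

/-- A stencil that is accurate for functions whose source vanishes to high order extends to a
compact scheme. -/
theorem hasCompactScheme_of_vanishing_source {a : ℝ × ℝ → ℝ} {p : ℝ × ℝ}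
    (ha : ContDiffAt ℝ ∞ a p) (ha0 : a p ≠ 0) {M : ℕ} (C : ℤ → ℤ → ℝ[X])
    (hdeg : ∀ k ∈ offsets, ∀ l ∈ offsets, (C k l).natDegree ≤ M + 1)
    (hne : ∃ k ∈ offsets, ∃ l ∈ offsets, (C k l).eval 0 ≠ 0)
    (hC : ∀ v : ℝ × ℝ → ℝ, ContDiffAt ℝ ∞ v p →
      (∀ m n, m + n < M → mixedPartial (ellipticOp a v) p m n = 0) →
      (fun h : ℝ => ∑ k ∈ offsets, ∑ l ∈ offsets, (C k l).eval h * v (stencilPoint p h k l))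
        =O[𝓝[>] 0] fun h : ℝ => h ^ (M + 2)) :
    HasCompactScheme a p M := by
  set A := mixedPartial a p with hA
  set G : ℕ × ℕ → ℕ → ℕ → ℝ := fun q =>
    solutionJet A (fun i j => if i = q.1 ∧ j = q.2 then 1 else 0) 0 0 with hG
  set P : ℕ × ℕ → ℝ[X] := fun q => ∑ k ∈ offsets, ∑ l ∈ offsets, C k l * jetRay (M + 2) (G q) k l
    with hP
  choose R hR1 _ hR3 using fun q => exists_polynomial_truncation (P q) (M + 1)
  refine ⟨C, fun m n => R (m, n), hdeg, fun q _ => hR1 _, hne, fun u hu => ?_⟩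
  set f : ℕ × ℕ → ℝ := fun q => mixedPartial (ellipticOp a u) p q.1 q.2 with hf
  set w : ℕ × ℕ → ℝ × ℝ → ℝ := fun q z => jetPoly (M + 2) (G q) (z.1 - p.1) (z.2 - p.2) with hw
  have hws : ∀ q, ContDiff ℝ ∞ (w q) := by
    intro q
    have h1 : ContDiff ℝ ∞ fun z : ℝ × ℝ => (z.1 - p.1, z.2 - p.2) := by fun_prop
    exact (contDiff_jetPoly (M + 2) (G q) ∞).comp h1
  have hcw : ∀ q, ContDiff ℝ ∞ fun z => -f q * w q z := fun q => contDiff_const.mul (hws q)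
  -- Subtracting the polynomial responses to the source derivatives leaves a function whose source
  -- vanishes to order M. The stencil applied to a response is the polynomial `P q`; its truncation
  -- `R q` is the coefficient of that source derivative.
  set v : ℝ × ℝ → ℝ := fun z => u z + ∑ q ∈ indicesBelow M, -f q * w q z with hv
  have hvs : ContDiffAt ℝ ∞ v p :=
    hu.add (ContDiffAt.sum fun q _ => (hcw q).contDiffAt)
  have hvj : ∀ i j, i + j < M + 2 → mixedPartial v p i j =
      mixedPartial u p i j + ∑ q ∈ indicesBelow M, -f q * G q i j := by
    intro i j hij
    rw [hv, mixedPartial_add (contDiffAt_infty.1 hu _) (ContDiffAt.sum fun q _ =>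
      contDiffAt_infty.1 (hcw q).contDiffAt _), mixedPartial_sum _ fun q _ =>
      contDiffAt_infty.1 (hcw q).contDiffAt _]
    congr 1
    refine Finset.sum_congr rfl fun q _ => ?_
    rw [mixedPartial_const_mul _ (contDiffAt_infty.1 (hws q).contDiffAt _), hw,
      mixedPartial_jetPoly hij]
  have hvf : ∀ m n, m + n < M → mixedPartial (ellipticOp a v) p m n = 0 := by
    intro m n hmn
    rw [mixedPartial_ellipticOp_eq_ellipticJet (contDiffAt_infty.1 ha _)
      (contDiffAt_infty.1 hvs _), ellipticJet_congr fun i j hij => hvj i j (by omega),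
      ellipticJet_add, ellipticJet_sum]
    have h1 : ∀ q ∈ indicesBelow M, -f q * ellipticJet A (G q) m n =
        if q = (m, n) then f (m, n) else 0 := by
      intro q _
      have h2 : _ + ellipticJet A (G q) m n = 0 := solutionJet_spec (A := A) ha0 _ 0 0 m n
      split_ifs with hq
      · subst hq
        rw [if_pos ⟨rfl, rfl⟩] at h2
        rw [eq_neg_of_add_eq_zero_right h2]
        ring
      · rw [if_neg fun h => hq (Prod.ext h.1.symm h.2.symm), zero_add] at h2
        rw [h2, mul_zero]
    rw [Finset.sum_congr rfl h1, Finset.sum_ite_eq', if_pos (mem_indicesBelow.2 hmn), hf]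
    dsimp only
    rw [mixedPartial_ellipticOp_eq_ellipticJet (contDiffAt_infty.1 ha _)
      (contDiffAt_infty.1 hu _)]
    ring
  have hO : (fun h : ℝ => ∑ q ∈ indicesBelow M, f q * ((R q).eval h - (P q).eval h))
      =O[𝓝[>] 0] fun h : ℝ => h ^ (M + 2) :=
    Asymptotics.IsBigO.fun_sum fun q _ => (hR3 q).const_mul_left (f q)
  refine ((hC v hvs hvf).sub hO).congr_left fun h => ?_
  have e1 : ∀ q, (P q).eval h = ∑ k ∈ offsets, ∑ l ∈ offsets,
      (C k l).eval h * w q (stencilPoint p h k l) := by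
    intro q
    simp only [hP, eval_finsetSum, eval_mul, eval_jetRay, hw, stencilPoint, add_sub_cancel_left]
  have e2 : ∑ k ∈ offsets, ∑ l ∈ offsets, (C k l).eval h * v (stencilPoint p h k l) =
      ∑ k ∈ offsets, ∑ l ∈ offsets, (C k l).eval h * u (stencilPoint p h k l) -
        ∑ q ∈ indicesBelow M, f q * (P q).eval h := by
    simp only [e1, Finset.mul_sum]
    rw [Finset.sum_comm (s := indicesBelow M), ← Finset.sum_sub_distrib]
    refine Finset.sum_congr rfl fun k _ => ?_
    rw [Finset.sum_comm (s := indicesBelow M), ← Finset.sum_sub_distrib]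
    refine Finset.sum_congr rfl fun l _ => ?_
    rw [hv]
    simp only [mul_add, Finset.mul_sum]
    rw [sub_eq_add_neg, ← Finset.sum_neg_distrib]
    congr 1
    refine Finset.sum_congr rfl fun q _ => ?_
    ring
  rw [e2]
  simp only [mul_sub, Finset.sum_sub_distrib, hf]
  ring

/-! ### Reduction to Δv = q v and the scheme of order six. -/

theorem ContDiffAt.partialX_infty {g : ℝ × ℝ → ℝ} {p : ℝ × ℝ} (hg : ContDiffAt ℝ ∞ g p) :
    ContDiffAt ℝ ∞ (_root_.partialX g) p :=
  contDiffAt_infty.2 fun _ => (contDiffAt_infty.1 hg _).partialX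

theorem ContDiffAt.partialY_infty {g : ℝ × ℝ → ℝ} {p : ℝ × ℝ} (hg : ContDiffAt ℝ ∞ g p) :
    ContDiffAt ℝ ∞ (_root_.partialY g) p :=
  contDiffAt_infty.2 fun _ => (contDiffAt_infty.1 hg _).partialY

/-- The substitution `v = √a u` turns `∇ · (a ∇u)` into `√a (Δv - q v)` with `q = Δ√a / √a`. -/
theorem liouville_transform {s u : ℝ × ℝ → ℝ} {p : ℝ × ℝ} (hs : ContDiffAt ℝ ∞ s p)
    (hs0 : s p ≠ 0) (hu : ContDiffAt ℝ ∞ u p) :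
    (fun z => partialX (partialX fun z => s z * u z) z + partialY (partialY fun z => s z * u z) z)
      =ᶠ[𝓝 p] fun z =>
        (partialX (partialX s) z + partialY (partialY s) z) / s z * (s z * u z) +
          (-(s z)⁻¹) * ellipticOp (fun z => s z * s z) u z := by
  have h0 := hs.continuousAt.eventually_ne hs0
  have hu2 : ContDiffAt ℝ (2 : ℕ) u p := contDiffAt_infty.1 hu _
  have hs2 : ContDiffAt ℝ (2 : ℕ) s p := contDiffAt_infty.1 hs _
  have hs1 : ContDiffAt ℝ (1 : ℕ) s p := contDiffAt_infty.1 hs _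
  have h3 := dirDeriv_mul (v := ((1, 0) : ℝ × ℝ)) (n := 0) hs1 hs1
  have h4 := dirDeriv_mul (v := ((0, 1) : ℝ × ℝ)) (n := 0) hs1 hs1
  have h5 := ellipticOp_eventuallyEq (a := fun z => s z * s z) (hs1.mul hs1) hu2
  simp only [← partialX_eq_dirDeriv, ← partialY_eq_dirDeriv] at h3 h4
  filter_upwards [h0, hs2.eventually (by simp), hu2.eventually (by simp), h3, h4, h5]
    with z e0 es eu e3 e4 e5
  have e1 := dirDeriv_dirDeriv_mul (v := (1, 0)) es eu
  have e2 := dirDeriv_dirDeriv_mul (v := (0, 1)) es eu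
  simp only [← partialX_eq_dirDeriv, ← partialY_eq_dirDeriv] at e1 e2
  rw [e1, e2, e5, e3, e4]
  field_simp
  ring

/-- Since v = √a u, weights D for v become weights D · √a(stencil point) for u. Replacing √a by its
Taylor polynomial and dropping powers above h^7 costs O(h^8). The corner weight at h = 0 is √a(p),
so the scheme is nontrivial. -/
theorem hasCompactScheme_six {a : ℝ × ℝ → ℝ} {p : ℝ × ℝ} (ha : ContDiffAt ℝ ∞ a p)
    (ha0 : 0 < a p) : HasCompactScheme a p 6 := by
  set s : ℝ × ℝ → ℝ := fun z => √(a z) with hs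
  have hss : ContDiffAt ℝ ∞ s p := ha.sqrt ha0.ne'
  have hs0 : s p ≠ 0 := (Real.sqrt_pos.2 ha0).ne'
  have has : a =ᶠ[𝓝 p] fun z => s z * s z := by
    filter_upwards [ha.continuousAt.eventually (lt_mem_nhds ha0)] with z hz
    exact (Real.mul_self_sqrt (le_of_lt hz)).symm
  set q : ℝ × ℝ → ℝ := fun z => (partialX (partialX s) z + partialY (partialY s) z) / s z with hq
  have hqs : ContDiffAt ℝ ∞ q p :=
    (hss.partialX_infty.partialX_infty.add hss.partialY_infty.partialY_infty).div hss hs0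
  set c := schrodingerTerm (mixedPartial q p) with hc
  set D : ℤ → ℤ → ℝ[X] := fun k l => ∑ j ∈ Finset.range 8, Polynomial.C (c j k l) * X ^ j with hD
  have hDe : ∀ k l h, (D k l).eval h = ∑ j ∈ Finset.range 8, h ^ j * c j k l := by
    intro k l h
    simp only [hD, eval_finsetSum, eval_mul, eval_C, eval_pow, eval_X]
    exact Finset.sum_congr rfl fun j _ => mul_comm _ _
  set S : ℤ → ℤ → ℝ[X] := jetRay 8 (mixedPartial s p) with hS
  choose R hR1 hR2 hR3 using fun k l => exists_polynomial_truncation (D k l * S k l) 7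
  refine hasCompactScheme_of_vanishing_source ha ha0.ne' R (fun k _ l _ => hR1 k l)
    ⟨1, by simp [offsets], 1, by simp [offsets], ?_⟩ fun u hu hu0 => ?_
  · rw [hR2, eval_mul, hDe, hS, eval_jetRay, mul_zero, jetPoly_zero_zero (by norm_num),
      Finset.sum_range_succ']
    simpa [hc, schrodingerTerm, nineWeights, mixedPartial] using hs0
  set v : ℝ × ℝ → ℝ := fun z => s z * u z with hv
  have hvs : ContDiffAt ℝ ∞ v p := hss.mul hu
  set V := mixedPartial v p with hV
  have hell : ContDiffAt ℝ ∞ (ellipticOp a u) p := by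
    have h1 : ContDiffAt ℝ ∞ (fun z => -(partialX (fun q => a q * partialX u q) z +
        partialY (fun q => a q * partialY u q) z)) p :=
      ((ha.mul hu.partialX_infty).partialX_infty.add (ha.mul hu.partialY_infty).partialY_infty).neg
    exact h1
  have hrel : ∀ m n, m + n < 5 → V (m + 2) n + V m (n + 2) =
      ∑ i ∈ Finset.range (m + 1), ∑ j ∈ Finset.range (n + 1), (m.choose i : ℝ) * (n.choose j : ℝ) *
        (mixedPartial q p i j * V (m - i) (n - j)) := by
    intro m n hmn
    have hsi : ContDiffAt ℝ ∞ (fun z => -(s z)⁻¹) p := (hss.inv hs0).neg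
    have hea : ellipticOp a u =ᶠ[𝓝 p] ellipticOp (fun z => s z * s z) u := by
      have h1 : ∀ w : ℝ × ℝ, (fun z => a z * dirDeriv w u z) =ᶠ[𝓝 p]
          fun z => s z * s z * dirDeriv w u z := fun w => has.mul EventuallyEq.rfl
      filter_upwards [dirDeriv_congr (v := (1, 0)) (h1 (1, 0)),
        dirDeriv_congr (v := (0, 1)) (h1 (0, 1))] with z h2 h3
      change -(dirDeriv _ _ z + dirDeriv _ _ z) = -(dirDeriv _ _ z + dirDeriv _ _ z)
      exact congrArg₂ (fun x y => -(x + y)) h2 h3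
    have hl : (fun z => partialX (partialX v) z + partialY (partialY v) z) =ᶠ[𝓝 p]
        fun z => q z * v z + -(s z)⁻¹ * ellipticOp a u z := by
      filter_upwards [liouville_transform hss hs0 hu, hea] with z h1 h2
      rw [h1, h2]
    have e := mixedPartial_congr hl m n
    rw [mixedPartial_add (contDiffAt_infty.1 hvs.partialX_infty.partialX_infty _)
        (contDiffAt_infty.1 hvs.partialY_infty.partialY_infty _),
      mixedPartial_add (contDiffAt_infty.1 (hqs.mul hvs) _)
        (contDiffAt_infty.1 (hsi.mul hell) _),
      mixedPartial_mul (contDiffAt_infty.1 hqs _) (contDiffAt_infty.1 hvs _),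
      mixedPartial_mul (contDiffAt_infty.1 hsi _) (contDiffAt_infty.1 hell _),
      mixedPartial_partialX (contDiffAt_infty.1 hvs.partialX_infty _),
      mixedPartial_partialX (contDiffAt_infty.1 hvs _), mixedPartial_partialY,
      mixedPartial_partialY] at e
    -- By the Leibniz rule the source term contains only derivatives of `ellipticOp a u` of order
    -- below 6, all of which vanish.
    refine e.trans (add_eq_left.2 ?_)
    refine Finset.sum_eq_zero fun i _ => Finset.sum_eq_zero fun j _ => ?_
    rw [hu0 _ _ (by omega), mul_zero, mul_zero]
  have hmain : (fun h : ℝ => ∑ k ∈ offsets, ∑ l ∈ offsets,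
      (D k l).eval h * (jetRay 8 V k l).eval h) =O[𝓝[>] 0] fun h : ℝ => h ^ 8 := by
    obtain ⟨M₁, hM₁, b₁⟩ := exists_forall_abs_le (T := Unit) isCompact_univ
      (Finset.range 8 ×ˢ offsets ×ˢ offsets) (g := fun x _ => c x.1 x.2.1 x.2.2)
      fun _ _ => continuousOn_const
    obtain ⟨M₂, hM₂, b₂⟩ := exists_forall_abs_le (T := Unit) isCompact_univ
      (indicesBelow 8) (g := fun x _ => V x.1 x.2) fun _ _ => continuousOn_const
    obtain ⟨B, -, hB⟩ := exists_stencil_expansion_bound 8 8 le_rfl hM₁ hM₂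
    refine Asymptotics.IsBigO.of_bound B ?_
    filter_upwards [Ioo_mem_nhdsGT (zero_lt_one (α := ℝ))] with h hh
    have h1 := hB c V h (fun j hj k hk l hl => b₁ (j, k, l) (by simp [hj, hk, hl]) () trivial)
      (fun m n hmn => b₂ (m, n) (mem_indicesBelow.2 hmn) () trivial) hh.1.le hh.2.le
    have h2 : ∀ N ∈ Finset.range 8, h ^ N * stencilMoment c V N = 0 := fun N hN => by
      rw [hc, stencilMoment_schrodingerTerm_eq_zero hrel (Finset.mem_range.1 hN), mul_zero]
    rw [Finset.sum_eq_zero h2, sub_zero] at h1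
    simp only [hDe, eval_jetRay]
    rw [Real.norm_eq_abs, Real.norm_eq_abs, abs_of_nonneg (pow_nonneg hh.1.le 8)]
    exact h1
  -- Three O(h^8) errors: truncating D · S, replacing the Taylor polynomial of √a by its values, and
  -- replacing that of v by its values. Added to `hmain` they telescope to the sum of R u because v
  -- = √a u.
  have hrest : (fun h : ℝ => ∑ k ∈ offsets, ∑ l ∈ offsets,
      (((R k l).eval h - (D k l * S k l).eval h) * u (stencilPoint p h k l)
        + (D k l).eval h * (((S k l).eval h - s (stencilPoint p h k l)) * u (stencilPoint p h k l))
        - (D k l).eval h * ((jetRay 8 V k l).eval h - v (stencilPoint p h k l))))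
      =O[𝓝[>] 0] fun h : ℝ => h ^ 8 := by
    refine Asymptotics.IsBigO.fun_sum fun k hk => Asymptotics.IsBigO.fun_sum fun l hl => ?_
    have hub := isBigO_one_stencilPoint hu.continuousAt k l
    have hDb := Polynomial.isBigO_one (D k l)
    have t1 := (hR3 k l).mul hub
    have t2 := hDb.mul ((isBigO_taylor_stencilPoint (contDiffAt_infty.1 hss 8) hk hl).mul hub)
    have t3 := hDb.mul (isBigO_taylor_stencilPoint (contDiffAt_infty.1 hvs 8) hk hl)
    simp only [mul_one, one_mul] at t1 t2 t3
    exact (t1.add t2).sub t3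
  refine (hmain.add hrest).congr_left fun h => ?_
  simp only [← Finset.sum_add_distrib, eval_mul, hv]
  refine Finset.sum_congr rfl fun k _ => Finset.sum_congr rfl fun l _ => ?_
  ring

end

/-! ### The two assertions combined. -/

theorem mainTheorem1 (l₁ l₂ l₃ l₄ : ℝ) (hl : l₁ < l₂) (hl' : l₃ < l₄)
    (Ω : Set (ℝ × ℝ)) (hΩ : Ω = rect l₁ l₂ l₃ l₄)
    (ψ : ℝ × ℝ → ℝ) (hψ : ContDiff ℝ ∞ ψ)
    (Γ : Set (ℝ × ℝ)) (hΓ : Γ = interface Ω ψ)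
    (a f : ℝ × ℝ → ℝ)
    (ha : ContDiffOn ℝ ∞ a (Ω \ Γ)) (ha_pos : ∀ q ∈ Ω \ Γ, 0 < a q)
    (hf : ContDiffOn ℝ ∞ f (Ω \ Γ)) :
    (∀ u : ℝ × ℝ → ℝ, ContDiffOn ℝ 5 u (Ω \ Γ) →
      (∀ q ∈ Ω \ Γ, ellipticOp a u q = f q) →
      ∀ K : Set (ℝ × ℝ), IsCompact K → K ⊆ Ω \ Γ →
        ∃ B > 0, ∃ h₀ > 0, ∀ h : ℝ, 0 < h → h ≤ h₀ → ∀ p ∈ K, IsRegularPoint ψ p h →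
          |schemeResidual a f u p h| ≤ B * h ^ 6 ∧
          sourceCoeff (mixedPartial a p) h 0 0 ≠ 0 ∧
          |schemeResidual a f u p h / sourceCoeff (mixedPartial a p) h 0 0| ≤ B * h ^ 4) ∧
    (∀ p ∈ Ω \ Γ, IsGreatest {M : ℕ | HasCompactScheme a p M} 6) := by
  have hU : IsOpen (Ω \ Γ) := by
    have h : Ω \ Γ = rect l₁ l₂ l₃ l₄ ∩ {q | ψ q ≠ 0} := by
      ext q
      simp only [hΩ, hΓ, interface, Set.mem_sdiff, mem_ofPred_eq, mem_inter_iff]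
      tauto
    rw [h]
    exact (isOpen_Ioo.prod isOpen_Ioo).inter (isOpen_ne_fun hψ.continuous continuous_const)
  refine ⟨fun u hu hpde K hK hKU => ?_, fun p hp => ?_⟩
  -- Five derivatives would give only an O(h^5) Taylor remainder; smoothness of a and f supplies the
  -- missing one.
  · have hu' : ContDiffOn ℝ ∞ u (Ω \ Γ) :=
      contDiffOn_of_ellipticOp hU ha (fun q hq => (ha_pos q hq).ne') hf
        (hu.of_le (by norm_num)) hpde
    obtain ⟨B, hB, h₀, hh₀, H⟩ := fourth_order_consistency hU ha ha_pos hu' hpde hK hKU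
    exact ⟨B, hB, h₀, hh₀, fun h h0 h1 p hp _ => H h h0 h1 p hp⟩
  · have hap : ContDiffAt ℝ ∞ a p := ha.contDiffAt (hU.mem_nhds hp)
    refine ⟨hasCompactScheme_six hap (ha_pos p hp), fun M hM => ?_⟩
    by_contra hlt
    exact not_hasCompactScheme hap (ha_pos p hp).ne' (by omega) hM
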